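/- Let $R(x)=(1+|x|^2)^{1/2}$ for $x\in\mathbb R^3$, let $q>7+\sqrt{33}$ and $p=4-\frac8q$. For $\sigma:\mathbb R^3\to\mathbb R$ and $r>0$ put $\|\sigma\|_r=\sup_x|\sigma(x)|R(x)^r$; for a $C^1$ function $g$ on $\mathbb R^3\times\mathbb R^3$ put $$\|g\|_q=\sup_{x,v}|g(x,v)|\,(1+|x|^2+|v|^q),\qquad |||g|||=\|g\|_q+\|\nabla_{x,v}\,g\|_q+\Big\|\int g\,dv\Big\|_p ,$$ where $\|\nabla_{x,v}\,g\|_q$ is defined by the same formula with $|\nabla_{x,v}\,g|$ in place of $|g|$. Assume: (I) $F:\mathbb R^3\to[0,\infty)$ is $C^2$ and radial, $F(v)=F_R(|v|)$, with $F_R''(0)<0$, and there is $W\in(0,\infty)$ with $F_R'(u)<0$ for $u\in(0,W)$ and $F_R(u)=0$ for $u\ge W$. (II) $f_0:\mathbb R^3\times\mathbb R^3\to[0,\infty)$ is $C^1$ with compact $v$-support (uniformly in $x$), and there is $N>0$ with $f_0(x,v)=F(v)$ whenever $|x|>N$. (No spherical symmetry is assumed.) (IV) $A:[0,\infty)\times\mathbb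 R^3\to\mathbb R^3$ is $C^1$ and, for some $C>0$ and all $t\ge0$, $x\in\mathbb R^3$: $|A(t,x)|\le CR(x)^{-2}$, $|\partial_xA(t,x)|\le CR(x)^{-3}$ and $\nabla_x\cdot A(t,x)=0$. Then for every $t\ge0$ and $M\ge0$ there is a finite constant $C_{p,t}(M)$, depending only on $q$, $F$, $f_0$, $A$, $t$ and $M$, with the following property. Let $T>0$ and let $f:[0,T)\times\mathbb R^3\times\mathbb R^3\to[0,\infty)$ be a $C^1$ solution of $$\partial_tf+v\cdot\nabla_xf-(E+A)\cdot\nabla_vf=0,\quad \rho(t,x)=\int(F(v)-f(t,x,v))\,dv,\quad E(t,x)=\int\rho(t,y)\frac{x-y}{|x-y|^3}\,dy,\quad f(0,\cdot,\cdot)=f_0,$$ with $|||(F-f)(t)|||<\infty$ for every $t\in[0,T)$. Then for every $t\in[0,T)$ and every finite $M$ with $\sup_{\tau\in[0,t]}\|\rho(\tau)\|_p\le M$, $$\|\rho(t)\|_6=\sup_x|\rho(t,x)|\,(1+|x|^2)^3\le C_{p,t}(M).$$ -/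

import Mathlib

open MeasureTheory Set
open scoped NNReal ENNReal

/-- Three-dimensional Euclidean space, used both for positions and for velocities. -/
abbrev Space3 : Type := EuclideanSpace ℝ (Fin 3)

noncomputable section

namespace VlasovPoisson

/-- The weight `R(x) = (1 + |x|²)^(1/2)`. -/
def R (x : Space3) : ℝ := Real.sqrt (1 + ‖x‖ ^ 2)

/-- The exponent `p = 4 - 8 / q`. -/
def pOf (q : ℝ) : ℝ := 4 - 8 / q

/-- The weighted sup norm `‖σ‖_r = sup_x |σ(x)| R(x)^r` (possibly infinite). -/
def spaceNorm (r : ℝ) (σ : Space3 → ℝ) : ℝ≥0∞ :=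
  ⨆ x : Space3, ENNReal.ofReal (|σ x| * R x ^ r)

/-- The weighted sup norm `‖g‖_q = sup_{x,v} |g(x,v)| (1 + |x|² + |v|^q)` (possibly infinite). -/
def phaseNorm (q : ℝ) (g : Space3 → Space3 → ℝ) : ℝ≥0∞ :=
  ⨆ (x : Space3) (v : Space3), ENNReal.ofReal (|g x v| * (1 + ‖x‖ ^ 2 + ‖v‖ ^ q))

/-- The Euclidean length of the full gradient `(∇ₓ g, ∇ᵥ g)` at `(x, v)`. -/
def gradLength (g : Space3 → Space3 → ℝ) (x v : Space3) : ℝ :=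
  Real.sqrt (‖gradient (fun y => g y v) x‖ ^ 2 + ‖gradient (fun w => g x w) v‖ ^ 2)

/-- The norm `|||g||| = ‖g‖_q + ‖∇g‖_q + ‖∫ g dv‖_p` with `p = 4 - 8 / q`. -/
def tripleNorm (q : ℝ) (g : Space3 → Space3 → ℝ) : ℝ≥0∞ :=
  phaseNorm q g + phaseNorm q (gradLength g) + spaceNorm (pOf q) (fun x => ∫ v, g x v)

/-- The divergence of a vector field on three-dimensional space. -/
def divergence (B : Space3 → Space3) (x : Space3) : ℝ :=
  ∑ i : Fin 3, (fderiv ℝ B x (EuclideanSpace.single i 1)) i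

/-- The charge density `ρ(t,x) = ∫ (F(v) - f(t,x,v)) dv`. -/
def rho (F : Space3 → ℝ) (f : ℝ → Space3 → Space3 → ℝ) (t : ℝ) (x : Space3) : ℝ :=
  ∫ v, (F v - f t x v)

/-- The electric field `E(x) = ∫ σ(y) (x - y) / |x - y|³ dy` of a charge density `σ`. -/
def field (σ : Space3 → ℝ) (x : Space3) : Space3 :=
  ∫ y, (σ y / ‖x - y‖ ^ 3) • (x - y)

/-- The conditions on the background: `F(v) = F_R(|v|)` is nonnegative and `C²`, `F_R''(0) < 0`,
and `F_R' < 0` on `(0,W)`, `F_R = 0` on `[W,∞)` for some `W > 0`. The profile `F_R` lives on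
`[0,∞)`, so its derivatives are taken within that half-line. -/
def BackgroundCondition (F : Space3 → ℝ) : Prop :=
  (∀ v, 0 ≤ F v) ∧ ContDiff ℝ 2 F ∧
  ∃ FR : ℝ → ℝ, (∀ v, F v = FR ‖v‖) ∧
    iteratedDerivWithin 2 FR (Ici 0) 0 < 0 ∧
    ∃ W : ℝ, 0 < W ∧ (∀ u ∈ Ioo 0 W, derivWithin FR (Ici 0) u < 0) ∧ ∀ u, W ≤ u → FR u = 0

/-- The conditions on the initial datum: `f₀` is `C¹`, nonnegative, has compact velocity support,
and equals `F(v)` for large `|x|`. No symmetry is required. -/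
def InitialCondition (F : Space3 → ℝ) (f₀ : Space3 → Space3 → ℝ) : Prop :=
  ContDiff ℝ 1 (fun z : Space3 × Space3 => f₀ z.1 z.2) ∧
  (∀ x v, 0 ≤ f₀ x v) ∧
  (∃ K : Set Space3, IsCompact K ∧ ∀ x, ∀ v ∉ K, f₀ x v = 0) ∧
  ∃ N : ℝ, 0 < N ∧ ∀ x v, N < ‖x‖ → f₀ x v = F v

/-- The conditions on the external field for times `t ≥ 0`: `A` is `C¹`, `|A| ≤ C R⁻²`,
`|∂ₓA| ≤ C R⁻³` and `div A = 0`. -/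
def ExternalFieldCondition (A : ℝ → Space3 → Space3) : Prop :=
  ContDiffOn ℝ 1 (fun z : ℝ × Space3 => A z.1 z.2) (Ici 0 ×ˢ univ) ∧
  (∃ C : ℝ, 0 < C ∧ ∀ t, 0 ≤ t → ∀ x,
    ‖A t x‖ ≤ C * R x ^ (-2 : ℝ) ∧ ‖fderiv ℝ (A t) x‖ ≤ C * R x ^ (-3 : ℝ)) ∧
  ∀ t, 0 ≤ t → ∀ x, divergence (A t) x = 0

/-- `f` is a `C¹` solution on `[0,T) × ℝ³ × ℝ³` of the Vlasov-Poisson system with background `F`,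
external field `A` and initial datum `f₀`. The integrals defining `ρ` and `E` converge; the time
derivative at `t = 0` is one-sided. -/
structure IsSolution (F : Space3 → ℝ) (f₀ : Space3 → Space3 → ℝ) (A : ℝ → Space3 → Space3)
    (T : ℝ) (f : ℝ → Space3 → Space3 → ℝ) : Prop where
  contDiffOn : ContDiffOn ℝ 1 (fun z : ℝ × Space3 × Space3 => f z.1 z.2.1 z.2.2)
    (Ico 0 T ×ˢ univ)
  nonneg : ∀ t ∈ Ico 0 T, ∀ x v, 0 ≤ f t x v
  integrable_velocity : ∀ t ∈ Ico 0 T, ∀ x, Integrable (fun v => F v - f t x v)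
  integrable_field : ∀ t ∈ Ico 0 T, ∀ x,
    Integrable (fun y => (rho F f t y / ‖x - y‖ ^ 3) • (x - y))
  vlasov : ∀ t ∈ Ico 0 T, ∀ x v,
    derivWithin (fun s => f s x v) (Ico 0 T) t
      + inner ℝ v (gradient (fun y => f t y v) x)
      - inner ℝ (field (rho F f t) x + A t x) (gradient (fun w => f t x w) v) = 0
  initial : ∀ x v, f 0 x v = f₀ x v

end VlasovPoisson

end

noncomputable section

namespace VlasovPoisson

open Metric Filter Topology

/-! Far from the origin, the characteristic that ends at `(x, v)` at time `s` still starts where the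
datum equals `F`. So `ρ(s, x) = ∫ (F(v) - F(G(v))) dv`, where `G(v)` is its initial velocity. If the
force `H = E + A` has Lipschitz constant `O(R⁻³)` near `x`, then `G` minus the identity has
Lipschitz constant `O(R⁻³)`, and the substitution `w = G(v)` turns the integral into `∫ (|det DG| -
1) F(G(v)) dv`. Here `det DG = 1 + tr(DG - 1) + O(R⁻⁶)`. To first order in `H` the trace is the
integral of `(τ - s) div H` along the characteristic, with `div H = 4πρ` because `A` is divergence
free; the second order remainder is again `O(R⁻⁶)`. Hence `|ρ(s, x)|` is at most `C R⁻⁶` plus a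
constant times the time integral of the supremum of `|ρ|` over a ball around `x` on which `R` is
comparable to `R(x)` (`ForceBounds.abs_rho_le`). A Grönwall argument then yields the decay `R⁻⁶`
(`exists_rho_decay`).

The work lies in a Lipschitz bound for `E` that depends only on the data, `t` and `M`. Truncating
the Coulomb kernel at distance `d` costs `log (1/d)`, and the part inside `d` needs a modulus of
continuity of `ρ`. With `d` the inverse of the Lipschitz constant of `f`, that constant enters the
estimate of the force only through its logarithm, so Grönwall along characteristics closes
(`IsSolution.lipschitz_bound`). Afterwards `d` of order `R⁻³` gives the weight `R⁻³`, the logarithm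
being absorbed because `p > 3` (`norm_field_sub_le_weight`).

Differentiability of `E` is never needed: its divergence is a limit of difference quotients
(`tendsto_divQuot_field`), and `G` is differentiated almost everywhere by Rademacher's theorem
(`abs_integral_sub_comp_le`). Both a priori bounds iterate `m ↦ a + m / 2` (`halving_iterate`), from
a starting value made finite by an auxiliary `ε` that finally tends to zero. -/

/-! ### The weight `R` and convolutions with its powers. -/

lemma R_sq (x : Space3) : R x ^ 2 = 1 + ‖x‖ ^ 2 := Real.sq_sqrt (by positivity)

lemma one_le_R (x : Space3) : 1 ≤ R x :=
  Real.one_le_sqrt.2 (by nlinarith [sq_nonneg ‖x‖])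

lemma R_pos (x : Space3) : 0 < R x := zero_lt_one.trans_le (one_le_R x)

lemma norm_le_R (x : Space3) : ‖x‖ ≤ R x := Real.le_sqrt_of_sq_le (by linarith)

lemma R_le_one_add_norm (x : Space3) : R x ≤ 1 + ‖x‖ := by
  apply Real.sqrt_le_iff.2
  constructor
  · positivity
  · nlinarith [norm_nonneg x]

lemma R_le_add (x y : Space3) : R x ≤ R y + ‖x - y‖ := by
  have h1 : ‖x‖ ≤ ‖y‖ + ‖x - y‖ := by
    have := norm_add_le y (x - y)
    simpa using this
  have h2 := norm_le_R y
  have h3 := R_sq y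
  apply Real.sqrt_le_iff.2
  refine ⟨by have := R_pos y; positivity, ?_⟩
  nlinarith [norm_nonneg x, norm_nonneg y, norm_nonneg (x - y),
    mul_le_mul_of_nonneg_right h2 (norm_nonneg (x - y)), mul_self_le_mul_self (norm_nonneg x) h1]

lemma R_half_le {x y : Space3} (h : ‖x - y‖ ≤ R x / 2) : R x / 2 ≤ R y := by
  have := R_le_add x y
  linarith

/-- The mass of the weight `R ^ (-p)`. -/
def weightMass (p : ℝ) : ℝ := ∫ y : Space3, R y ^ (-p)

lemma integrable_R_rpow {p : ℝ} (hp : 3 < p) : Integrable (fun y : Space3 => R y ^ (-p)) := by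
  have h := integrable_rpow_neg_one_add_norm_sq (E := Space3) (μ := volume) (r := p)
    (by simpa using hp)
  refine h.congr (Eventually.of_forall fun y => ?_)
  simp only [R]
  rw [Real.sqrt_eq_rpow, ← Real.rpow_mul (by positivity)]
  congr 1
  ring

lemma weightMass_nonneg (p : ℝ) : 0 ≤ weightMass p :=
  integral_nonneg fun y => Real.rpow_nonneg (R_pos y).le _

/-- For nearby points the weights are comparable. -/
lemma R_rpow_neg_le {r : ℝ} (hr : 0 ≤ r) {x y : Space3} (h : ‖x - y‖ ≤ R x / 2) :
    R y ^ (-r) ≤ 2 ^ r * R x ^ (-r) := by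
  have h1 := R_half_le h
  have h2 : R y ^ (-r) ≤ (R x / 2) ^ (-r) :=
    Real.rpow_le_rpow_of_nonpos (by have := R_pos x; positivity) h1 (by linarith)
  refine h2.trans (le_of_eq ?_)
  rw [Real.div_rpow (R_pos x).le (by norm_num), Real.rpow_neg (by norm_num : (0:ℝ) ≤ 2)]
  field_simp

/-- The volume of the unit ball. -/
def ballVol : ℝ := volume.real (ball (0 : Space3) 1)

lemma ballVol_nonneg : 0 ≤ ballVol := measureReal_nonneg

/-- Polar coordinates. The factor `3 * ballVol` is the area of the unit sphere and stands for `4π`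
throughout. -/
lemma setIntegral_ball_norm (φ : ℝ → ℝ) (r : ℝ) :
    ∫ z in ball (0 : Space3) r, φ ‖z‖ = 3 * ballVol * ∫ y in Ioo 0 r, y ^ 2 * φ y := by
  have h := integral_fun_norm_addHaar (volume : Measure Space3) ((Iio r).indicator φ)
  have e1 : ∫ z in ball (0 : Space3) r, φ ‖z‖ = ∫ z : Space3, (Iio r).indicator φ ‖z‖ := by
    rw [← integral_indicator measurableSet_ball]
    congr 1
    ext z
    simp [indicator]
  rw [e1, h]
  have e2 : ∫ y in Ioi (0 : ℝ), y ^ (Module.finrank ℝ Space3 - 1) • (Iio r).indicator φ y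
      = ∫ y in Ioo 0 r, y ^ 2 * φ y := by
    have : Ioo 0 r = Ioi 0 ∩ Iio r := by ext; simp
    rw [this, ← setIntegral_indicator measurableSet_Iio]
    congr 1
    ext y
    by_cases hy : y < r <;> simp [indicator, hy]
  rw [e2]
  simp [ballVol]
  ring

lemma integrableOn_ball_inv_sq (r : ℝ) :
    IntegrableOn (fun z : Space3 => (‖z‖ ^ 2)⁻¹) (ball 0 r) := by
  refine (integrableOn_fun_norm_addHaar (volume : Measure Space3)
    (f := fun y : ℝ => (y ^ 2)⁻¹)).2 ?_
  have : IntegrableOn (fun _ : ℝ => (1 : ℝ)) (Ioo 0 r) := by simp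
  refine this.congr_fun (fun y hy => ?_) measurableSet_Ioo
  have : y ≠ 0 := hy.1.ne'
  simp
  field_simp

lemma setIntegral_ball_inv_sq {r : ℝ} (hr : 0 ≤ r) :
    ∫ z in ball (0 : Space3) r, (‖z‖ ^ 2)⁻¹ = 3 * ballVol * r := by
  rw [setIntegral_ball_norm (fun y => (y ^ 2)⁻¹) r]
  congr 1
  rw [setIntegral_congr_fun (g := fun _ => (1 : ℝ)) measurableSet_Ioo]
  · simp [hr]
  · intro y hy
    have : y ≠ 0 := hy.1.ne'
    simp only
    field_simp

lemma integrableOn_ball_inv_max_cube {d : ℝ} (hd : 0 < d) (r : ℝ) :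
    IntegrableOn (fun z : Space3 => (max ‖z‖ d ^ 3)⁻¹) (ball 0 r) := by
  have hc : Continuous (fun z : Space3 => (max ‖z‖ d ^ 3)⁻¹) := by
    refine Continuous.inv₀ (by fun_prop) fun z => ?_
    have : 0 < max ‖z‖ d := lt_max_of_lt_right hd
    positivity
  exact (hc.continuousOn.integrableOn_compact (isCompact_closedBall 0 r)).mono_set
    ball_subset_closedBall

/-- The plateau `‖z‖ < d` contributes its volume times `d⁻³`, and the shells between `d` and `r`
contribute the logarithm, which is the price of truncation. -/
lemma setIntegral_ball_inv_max_cube {d r : ℝ} (hd : 0 < d) (hr : d ≤ r) :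
    ∫ z in ball (0 : Space3) r, (max ‖z‖ d ^ 3)⁻¹ = ballVol * (1 + 3 * Real.log (r / d)) := by
  rw [setIntegral_ball_norm (fun y => (max y d ^ 3)⁻¹) r, ← integral_Ioc_eq_integral_Ioo,
    ← intervalIntegral.integral_of_le (hd.le.trans hr)]
  have hc : Continuous (fun y : ℝ => y ^ 2 * (max y d ^ 3)⁻¹) := by
    refine Continuous.mul (by fun_prop) (Continuous.inv₀ (by fun_prop) fun z => ?_)
    have : 0 < max z d := lt_max_of_lt_right hd
    positivity
  rw [← intervalIntegral.integral_add_adjacent_intervals (hc.intervalIntegrable 0 d)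
    (hc.intervalIntegrable d r)]
  have e1 : ∫ y in (0 : ℝ)..d, y ^ 2 * (max y d ^ 3)⁻¹ = 1 / 3 := by
    have : ∫ y in (0 : ℝ)..d, y ^ 2 * (max y d ^ 3)⁻¹ = ∫ y in (0 : ℝ)..d, y ^ 2 * (d ^ 3)⁻¹ := by
      refine intervalIntegral.integral_congr fun y hy => ?_
      rw [uIcc_of_le hd.le] at hy
      simp [max_eq_right hy.2]
    rw [this]
    simp
    field_simp
    norm_num
  have e2 : ∫ y in d..r, y ^ 2 * (max y d ^ 3)⁻¹ = Real.log (r / d) := by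
    rw [← integral_inv_of_pos hd (hd.trans_le hr)]
    refine intervalIntegral.integral_congr fun y hy => ?_
    rw [uIcc_of_le hr] at hy
    have : 0 < y := hd.trans_le hy.1
    simp only [max_eq_left hy.1]
    field_simp
  rw [e1, e2]
  ring

/-- Convolution of `R ^ (-p)` with a kernel that is small away from the origin. -/
lemma integral_weight_mul_kernel_le {p : ℝ} (hp : 3 < p) (x : Space3) {κ : Space3 → ℝ}
    (hκ0 : ∀ z, 0 ≤ κ z) (hκm : Measurable κ) {B J : ℝ} (hB0 : 0 ≤ B)
    (hB : ∀ z, R x / 2 ≤ ‖z‖ → κ z ≤ B) (h_int : IntegrableOn κ (ball 0 (R x / 2)))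
    (hJ : ∫ z in ball 0 (R x / 2), κ z ≤ J) :
    Integrable (fun y => R y ^ (-p) * κ (x - y)) ∧
      ∫ y, R y ^ (-p) * κ (x - y) ≤ B * weightMass p + 2 ^ p * R x ^ (-p) * J := by
  set b : Set Space3 := ball 0 (R x / 2)
  have hi1 : Integrable (fun y : Space3 => B * R y ^ (-p)) := (integrable_R_rpow hp).const_mul B
  have hi2 : Integrable (fun y : Space3 => 2 ^ p * R x ^ (-p) * b.indicator κ (x - y)) :=
    ((h_int.integrable_indicator measurableSet_ball).comp_sub_left x).const_mul _
  -- Within `R x / 2` of `x` the weight is comparable to its value at `x` and the kernel contributes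
  -- its mass; farther away the kernel is at most `B` and the weight is integrable.
  have hle : ∀ y, R y ^ (-p) * κ (x - y)
      ≤ B * R y ^ (-p) + 2 ^ p * R x ^ (-p) * b.indicator κ (x - y) := by
    intro y
    have hRy : 0 ≤ R y ^ (-p) := Real.rpow_nonneg (R_pos y).le _
    have hRx : 0 ≤ R x ^ (-p) := Real.rpow_nonneg (R_pos x).le _
    by_cases hy : x - y ∈ b
    · rw [indicator_of_mem hy]
      have h1 : ‖x - y‖ ≤ R x / 2 := by
        have : ‖x - y‖ < R x / 2 := by simpa [b] using hy
        exact this.le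
      have h2 := mul_le_mul_of_nonneg_right
        (R_rpow_neg_le (by linarith : (0 : ℝ) ≤ p) h1) (hκ0 (x - y))
      have := mul_nonneg hB0 hRy
      linarith
    · rw [indicator_of_notMem hy]
      have h1 : R x / 2 ≤ ‖x - y‖ := by simpa [b] using hy
      have := mul_le_mul_of_nonneg_left (hB _ h1) hRy
      linarith
  have hmeas : AEStronglyMeasurable (fun y => R y ^ (-p) * κ (x - y)) volume := by
    refine (integrable_R_rpow hp).aestronglyMeasurable.mul ?_
    exact (hκm.comp (measurable_const.sub measurable_id)).aestronglyMeasurable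
  have hI : Integrable (fun y => R y ^ (-p) * κ (x - y)) := by
    refine (hi1.add hi2).mono' hmeas (Eventually.of_forall fun y => ?_)
    rw [Real.norm_of_nonneg (mul_nonneg (Real.rpow_nonneg (R_pos y).le _) (hκ0 _))]
    exact hle y
  refine ⟨hI, (integral_mono hI (hi1.add hi2) hle).trans ?_⟩
  have e : ∫ y, (B * R y ^ (-p) + 2 ^ p * R x ^ (-p) * b.indicator κ (x - y))
      = B * weightMass p + 2 ^ p * R x ^ (-p) * ∫ z in b, κ z := by
    rw [integral_add hi1 hi2, integral_const_mul, integral_const_mul,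
      integral_sub_left_eq_self (fun z => b.indicator κ z) volume x,
      integral_indicator measurableSet_ball]
    rfl
  refine (le_of_eq e).trans ?_
  have : 0 ≤ (2 : ℝ) ^ p * R x ^ (-p) :=
    mul_nonneg (by positivity) (Real.rpow_nonneg (R_pos x).le _)
  gcongr

/-! ### The truncated Coulomb kernel. -/

/-- The Coulomb kernel truncated at distance `d`; the case `d = 0` is the Coulomb kernel. -/
def ker (d : ℝ) (z : Space3) : Space3 := (max ‖z‖ d ^ 3)⁻¹ • z

/-- The field generated by `σ` through the truncated Coulomb kernel. -/
def fieldReg (d : ℝ) (σ : Space3 → ℝ) (x : Space3) : Space3 := ∫ y, σ y • ker d (x - y)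

lemma field_eq_fieldReg (σ : Space3 → ℝ) (x : Space3) : field σ x = fieldReg 0 σ x := by
  unfold field fieldReg ker
  congr 1
  ext1 y
  rw [smul_smul, max_eq_left (norm_nonneg _), div_eq_mul_inv]

lemma measurable_ker (d : ℝ) : Measurable (ker d) := by
  unfold ker
  fun_prop

lemma norm_ker_le {d : ℝ} (z : Space3) : ‖ker d z‖ ≤ (‖z‖ ^ 2)⁻¹ := by
  rcases eq_or_ne z 0 with rfl | hz
  · simp [ker]
  have hz' : 0 < ‖z‖ := norm_pos_iff.2 hz
  have hm : ‖z‖ ≤ max ‖z‖ d := le_max_left _ _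
  rw [ker, norm_smul, norm_inv, norm_pow, Real.norm_of_nonneg (hz'.le.trans hm)]
  calc (max ‖z‖ d ^ 3)⁻¹ * ‖z‖ ≤ (‖z‖ ^ 3)⁻¹ * ‖z‖ := by gcongr
    _ = (‖z‖ ^ 2)⁻¹ := by field_simp

lemma norm_ker_zero_sub_ker_le {d : ℝ} (z : Space3) :
    ‖ker 0 z - ker d z‖ ≤ (ball (0 : Space3) d).indicator (fun z => (‖z‖ ^ 2)⁻¹) z := by
  by_cases hzd : ‖z‖ < d
  · rw [indicator_of_mem (by simpa using hzd)]
    rcases eq_or_ne z 0 with rfl | hz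
    · simp [ker]
    have hz' : 0 < ‖z‖ := norm_pos_iff.2 hz
    have h3 : (d ^ 3)⁻¹ ≤ (‖z‖ ^ 3)⁻¹ := by gcongr
    have h4 : 0 ≤ (d ^ 3)⁻¹ := by have := hz'.trans hzd; positivity
    rw [ker, ker, max_eq_left hz'.le, max_eq_right hzd.le, ← sub_smul, norm_smul,
      Real.norm_of_nonneg (by linarith)]
    calc ((‖z‖ ^ 3)⁻¹ - (d ^ 3)⁻¹) * ‖z‖ ≤ (‖z‖ ^ 3)⁻¹ * ‖z‖ := by gcongr; linarith
      _ = (‖z‖ ^ 2)⁻¹ := by field_simp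
  · rw [indicator_of_notMem (by simpa using hzd)]
    push Not at hzd
    simp [ker, max_eq_left hzd]

/-- The truncated norms `m`, `n` are 1-Lipschitz in the point, so the inverse cubes differ by a
multiple of `|m - n| ≤ ‖a - b‖`, and `‖b‖ ≤ n` absorbs one power. The bound is a sum of two
integrable kernels, so nothing has to be assumed about the distance from `a` to `b`. -/
lemma norm_ker_sub_ker_le {d : ℝ} (hd : 0 < d) (a b : Space3) :
    ‖ker d a - ker d b‖ ≤ 4 * ‖a - b‖ * ((max ‖a‖ d ^ 3)⁻¹ + (max ‖b‖ d ^ 3)⁻¹) := by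
  set m := max ‖a‖ d
  set n := max ‖b‖ d
  have hm : 0 < m := lt_max_of_lt_right hd
  have hn : 0 < n := lt_max_of_lt_right hd
  have hbn : ‖b‖ ≤ n := le_max_left _ _
  have hmn : |m - n| ≤ ‖a - b‖ :=
    (abs_max_sub_max_le_abs ‖a‖ ‖b‖ d).trans (abs_norm_sub_norm_le a b)
  have e : ker d a - ker d b = (m ^ 3)⁻¹ • (a - b) + ((m ^ 3)⁻¹ - (n ^ 3)⁻¹) • b := by
    simp only [ker, smul_sub, sub_smul]
    abel
  have hinv : |(m ^ 3)⁻¹ - (n ^ 3)⁻¹| = |m - n| * ((m ^ 2 + m * n + n ^ 2) * (m⁻¹ ^ 3 * n⁻¹ ^ 3)) := by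
    have : (m ^ 3)⁻¹ - (n ^ 3)⁻¹ = -(m - n) * ((m ^ 2 + m * n + n ^ 2) * (m⁻¹ ^ 3 * n⁻¹ ^ 3)) := by
      field_simp
      ring
    rw [this, abs_mul, abs_neg, abs_of_pos (by positivity :
      0 < (m ^ 2 + m * n + n ^ 2) * (m⁻¹ ^ 3 * n⁻¹ ^ 3))]
  have hs : 0 ≤ ‖a - b‖ := norm_nonneg _
  set u := m⁻¹
  set w := n⁻¹
  have hu : 0 < u := by positivity
  have hw : 0 < w := by positivity
  have h1 : ‖ker d a - ker d b‖
      ≤ ‖a - b‖ * (u ^ 3 + (u * w ^ 2 + u ^ 2 * w + u ^ 3)) := by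
    rw [e]
    refine (norm_add_le _ _).trans ?_
    rw [norm_smul, norm_smul, Real.norm_eq_abs, Real.norm_eq_abs, hinv,
      abs_of_pos (by positivity : 0 < (m ^ 3)⁻¹)]
    have : |m - n| * ((m ^ 2 + m * n + n ^ 2) * (u ^ 3 * w ^ 3)) * ‖b‖
        ≤ ‖a - b‖ * ((m ^ 2 + m * n + n ^ 2) * (u ^ 3 * w ^ 3)) * n := by gcongr
    have e2 : (m ^ 2 + m * n + n ^ 2) * (u ^ 3 * w ^ 3) * n = u * w ^ 2 + u ^ 2 * w + u ^ 3 := by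
      simp only [u, w]
      field_simp
    have e3 : (m ^ 3)⁻¹ = u ^ 3 := by simp [u]
    rw [e3]
    calc _ ≤ u ^ 3 * ‖a - b‖ + ‖a - b‖ * ((m ^ 2 + m * n + n ^ 2) * (u ^ 3 * w ^ 3)) * n := by
          gcongr
      _ = u ^ 3 * ‖a - b‖ + ‖a - b‖ * ((m ^ 2 + m * n + n ^ 2) * (u ^ 3 * w ^ 3) * n) := by ring
      _ = _ := by rw [e2]; ring
  -- The mixed terms obey `u w² + u² w ≤ u³ + w³`, which is `(u + w)(u - w)² ≥ 0`.
  have h2 : u ^ 3 + (u * w ^ 2 + u ^ 2 * w + u ^ 3) ≤ 4 * (u ^ 3 + w ^ 3) := by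
    nlinarith [mul_nonneg (add_pos hu hw).le (sq_nonneg (u - w)), pow_pos hu 3, pow_pos hw 3]
  calc _ ≤ _ := h1
    _ ≤ ‖a - b‖ * (4 * (u ^ 3 + w ^ 3)) := by gcongr
    _ = _ := by simp only [u, w, inv_pow]; ring

/-! ### Decay of the field, and its splitting into near field and truncated field. -/

section Field

variable {p M : ℝ} {σ : Space3 → ℝ}

lemma integral_weight_inv_sq_le (hp : 3 < p) (x : Space3) :
    Integrable (fun y => R y ^ (-p) * (‖x - y‖ ^ 2)⁻¹) ∧
      ∫ y, R y ^ (-p) * (‖x - y‖ ^ 2)⁻¹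
        ≤ (4 * weightMass p + 2 ^ p * (3 * ballVol)) * R x ^ (-2 : ℝ) := by
  have hR := R_pos x
  have h := integral_weight_mul_kernel_le hp x (κ := fun z => (‖z‖ ^ 2)⁻¹)
    (B := 4 * R x ^ (-2 : ℝ)) (J := 3 * ballVol * (R x / 2)) (fun z => by positivity)
    (by fun_prop) (by positivity) (fun z hz => ?_) (integrableOn_ball_inv_sq _)
    (setIntegral_ball_inv_sq (by positivity)).le
  · refine ⟨h.1, h.2.trans ?_⟩
    -- The neighbourhood of `x` contributes `R^(1 - p)`, which `p > 3` brings below `R⁻²`.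
    have h1 : R x ^ (-p) * R x ≤ R x ^ (-2 : ℝ) := by
      rw [← Real.rpow_add_one hR.ne']
      exact Real.rpow_le_rpow_of_exponent_le (one_le_R x) (by linarith)
    have h2 : 2 ^ p * (3 * ballVol) * (R x ^ (-p) * R x) ≤ 2 ^ p * (3 * ballVol) * R x ^ (-2 : ℝ) := by
      have := ballVol_nonneg
      gcongr
    have h3 : 0 ≤ 2 ^ p * (3 * ballVol) * (R x ^ (-p) * R x) := by
      have := ballVol_nonneg
      positivity
    nlinarith
  · have : (‖z‖ ^ 2)⁻¹ ≤ ((R x / 2) ^ 2)⁻¹ := by gcongr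
    refine this.trans (le_of_eq ?_)
    rw [Real.rpow_neg hR.le, Real.rpow_two]
    field_simp
    norm_num

lemma integral_weight_inv_max_cube_le (hp : 3 < p) {d : ℝ} (hd : 0 < d) (hd2 : d ≤ 1 / 2)
    (x : Space3) :
    Integrable (fun y => R y ^ (-p) * (max ‖x - y‖ d ^ 3)⁻¹) ∧
      ∫ y, R y ^ (-p) * (max ‖x - y‖ d ^ 3)⁻¹
        ≤ 8 * weightMass p * R x ^ (-3 : ℝ)
          + 2 ^ p * ballVol * (R x ^ (-p) * (1 + 3 * Real.log (R x / (2 * d)))) := by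
  have hR := R_pos x
  have hR1 := one_le_R x
  have h := integral_weight_mul_kernel_le hp x (κ := fun z => (max ‖z‖ d ^ 3)⁻¹)
    (B := 8 * R x ^ (-3 : ℝ)) (J := ballVol * (1 + 3 * Real.log ((R x / 2) / d)))
    (fun z => ?_)
    (by fun_prop) (by positivity) (fun z hz => ?_) (integrableOn_ball_inv_max_cube hd _)
    (setIntegral_ball_inv_max_cube hd (by linarith)).le
  · refine ⟨h.1, h.2.trans (le_of_eq ?_)⟩
    rw [div_div]
    ring
  · have : 0 < max ‖z‖ d := lt_max_of_lt_right hd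
    positivity
  · have h1 : R x / 2 ≤ max ‖z‖ d := hz.trans (le_max_left _ _)
    have : (max ‖z‖ d ^ 3)⁻¹ ≤ ((R x / 2) ^ 3)⁻¹ := by gcongr
    refine this.trans (le_of_eq ?_)
    rw [Real.rpow_neg hR.le, show (3 : ℝ) = (3 : ℕ) by norm_num, Real.rpow_natCast]
    field_simp
    norm_num

lemma norm_smul_ker_le (hb : ∀ y, |σ y| ≤ M * R y ^ (-p)) (d : ℝ) (x y : Space3) :
    ‖σ y • ker d (x - y)‖ ≤ M * (R y ^ (-p) * (‖x - y‖ ^ 2)⁻¹) := by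
  rw [norm_smul, Real.norm_eq_abs, ← mul_assoc]
  exact mul_le_mul (hb y) (norm_ker_le _) (norm_nonneg _) ((abs_nonneg _).trans (hb y))

/-- The constant in the decay estimate of the electric field. -/
def fieldConst (p : ℝ) : ℝ := 4 * weightMass p + 2 ^ p * (3 * ballVol)

lemma fieldConst_nonneg (p : ℝ) : 0 ≤ fieldConst p := by
  have := weightMass_nonneg p
  have := ballVol_nonneg
  unfold fieldConst
  positivity

lemma norm_field_le (hp : 3 < p) (hM : 0 ≤ M) (hb : ∀ y, |σ y| ≤ M * R y ^ (-p)) (x : Space3) :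
    ‖field σ x‖ ≤ M * fieldConst p * R x ^ (-2 : ℝ) := by
  rw [field_eq_fieldReg, fieldReg]
  have h := integral_weight_inv_sq_le hp x
  refine (norm_integral_le_of_norm_le (h.1.const_mul M)
    (Eventually.of_forall (norm_smul_ker_le hb 0 x))).trans ?_
  rw [integral_const_mul, mul_assoc]
  exact mul_le_mul_of_nonneg_left h.2 hM

lemma integrable_smul_ker (hp : 3 < p) (hσ : Continuous σ)
    (hb : ∀ y, |σ y| ≤ M * R y ^ (-p)) (d : ℝ) (x : Space3) :
    Integrable (fun y => σ y • ker d (x - y)) := by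
  refine ((integral_weight_inv_sq_le hp x).1.const_mul M).mono' ?_
    (Eventually.of_forall (norm_smul_ker_le hb d x))
  exact hσ.aestronglyMeasurable.smul
    ((measurable_ker d).comp (measurable_const.sub measurable_id)).aestronglyMeasurable

lemma fieldReg_eq_integral_comp_sub (d : ℝ) (σ : Space3 → ℝ) (x : Space3) :
    fieldReg d σ x = ∫ z, σ (x - z) • ker d z := by
  rw [fieldReg, ← integral_sub_left_eq_self (fun y => σ y • ker d (x - y)) volume x]
  simp

lemma integrable_comp_sub_smul_ker (hp : 3 < p) (hσ : Continuous σ)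
    (hb : ∀ y, |σ y| ≤ M * R y ^ (-p)) (d : ℝ) (x : Space3) :
    Integrable (fun z => σ (x - z) • ker d z) := by
  simpa using (integrable_smul_ker hp hσ hb d x).comp_sub_left x

/-- The two kernels differ only inside the ball of radius `d`, where their difference has mass at
most `3 * ballVol * d`. After the substitution `z = x - y` the base point sits in `σ` alone, so the
modulus of continuity of `σ` is what counts. -/
lemma norm_near_field_sub_le (hp : 3 < p) (hσ : Continuous σ)
    (hb : ∀ y, |σ y| ≤ M * R y ^ (-p)) {d η : ℝ} (hd : 0 < d) {x x' : Space3}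
    (hη : ∀ z, ‖z‖ < d → |σ (x' - z) - σ (x - z)| ≤ η) :
    ‖(field σ x' - fieldReg d σ x') - (field σ x - fieldReg d σ x)‖ ≤ 3 * ballVol * d * η := by
  have hi := fun d x => integrable_comp_sub_smul_ker hp hσ hb d x
  have e : (field σ x' - fieldReg d σ x') - (field σ x - fieldReg d σ x)
      = ∫ z, (σ (x' - z) - σ (x - z)) • (ker 0 z - ker d z) := by
    simp only [field_eq_fieldReg, fieldReg_eq_integral_comp_sub]
    rw [← integral_sub (hi 0 x') (hi d x'), ← integral_sub (hi 0 x) (hi d x)]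
    refine (integral_sub ((hi 0 x').sub (hi d x')) ((hi 0 x).sub (hi d x))).symm.trans ?_
    congr 1
    ext1 z
    simp only [sub_smul, smul_sub, Pi.sub_apply]
    abel
  rw [e]
  have hI := ((integrableOn_ball_inv_sq d).integrable_indicator measurableSet_ball).const_mul η
  refine (norm_integral_le_of_norm_le hI (Eventually.of_forall fun z => ?_)).trans ?_
  · rw [norm_smul, Real.norm_eq_abs]
    by_cases hz : ‖z‖ < d
    · have h0 := hη z hz
      exact mul_le_mul h0 (norm_ker_zero_sub_ker_le z) (norm_nonneg _) ((abs_nonneg _).trans h0)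
    · have h1 := norm_ker_zero_sub_ker_le (d := d) z
      rw [indicator_of_notMem (by simpa using hz)] at h1 ⊢
      rw [le_antisymm h1 (norm_nonneg _)]
      simp
  · rw [integral_const_mul, integral_indicator measurableSet_ball, setIntegral_ball_inv_sq hd.le]
    exact le_of_eq (by ring)

/-- Here the difference falls on the kernel, so only the size of `σ` enters. -/
lemma norm_fieldReg_sub_le (hp : 3 < p) (hσ : Continuous σ)
    (hb : ∀ y, |σ y| ≤ M * R y ^ (-p)) {d : ℝ} (hd : 0 < d) (hd2 : d ≤ 1 / 2) (x x' : Space3) :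
    ‖fieldReg d σ x' - fieldReg d σ x‖ ≤ 4 * M * ‖x' - x‖ *
      ((∫ y, R y ^ (-p) * (max ‖x' - y‖ d ^ 3)⁻¹) + ∫ y, R y ^ (-p) * (max ‖x - y‖ d ^ 3)⁻¹) := by
  rw [fieldReg, fieldReg, ← integral_sub (integrable_smul_ker hp hσ hb d x')
    (integrable_smul_ker hp hσ hb d x)]
  have i1 := (integral_weight_inv_max_cube_le hp hd hd2 x').1
  have i2 := (integral_weight_inv_max_cube_le hp hd hd2 x).1
  refine (norm_integral_le_of_norm_le ((i1.add i2).const_mul (4 * M * ‖x' - x‖))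
    (Eventually.of_forall fun y => ?_)).trans ?_
  · rw [← smul_sub, norm_smul, Real.norm_eq_abs]
    have h := norm_ker_sub_ker_le hd (x' - y) (x - y)
    rw [sub_sub_sub_cancel_right] at h
    refine (mul_le_mul (hb y) h (norm_nonneg _) ((abs_nonneg _).trans (hb y))).trans
      (le_of_eq ?_)
    simp only [Pi.add_apply]
    ring
  · rw [integral_const_mul]
    simp only [Pi.add_apply]
    rw [integral_add i1 i2]

end Field

/-! ### Lipschitz estimates of the field. -/

section Field

variable {p M : ℝ} {σ : Space3 → ℝ}

/-- The constant in the Lipschitz estimates of the electric field. -/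
def lipConst (p : ℝ) : ℝ := 8 * weightMass p + 2 ^ p * ballVol * (4 + 3 / (p - 3))

lemma lipConst_nonneg (hp : 3 < p) : 0 ≤ lipConst p := by
  have := weightMass_nonneg p
  have := ballVol_nonneg
  have : 0 < p - 3 := by linarith
  unfold lipConst
  positivity

/-- The gap between `p` and `3` absorbs a logarithm of the weight. -/
lemma R_rpow_mul_log_le (hp : 3 < p) (x : Space3) :
    R x ^ (-p) * Real.log (R x) ≤ R x ^ (-3 : ℝ) / (p - 3) := by
  have hR := R_pos x
  have h := Real.log_le_rpow_div hR.le (show 0 < p - 3 by linarith)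
  calc R x ^ (-p) * Real.log (R x) ≤ R x ^ (-p) * (R x ^ (p - 3) / (p - 3)) := by gcongr
    _ = R x ^ (-3 : ℝ) / (p - 3) := by
      rw [← mul_div_assoc, ← Real.rpow_add hR]
      congr 2
      ring

lemma R_rpow_le_neg_three (hp : 3 < p) (x : Space3) : R x ^ (-p) ≤ R x ^ (-3 : ℝ) :=
  Real.rpow_le_rpow_of_exponent_le (one_le_R x) (by linarith)

lemma R_rpow_le_one {r : ℝ} (hr : r ≤ 0) (x : Space3) : R x ^ r ≤ 1 :=
  Real.rpow_le_one_of_one_le_of_nonpos (one_le_R x) hr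

lemma integral_weight_inv_max_cube_le' (hp : 3 < p) {d : ℝ} (hd : 0 < d) (hd2 : d ≤ 1 / 2)
    (x : Space3) :
    ∫ y, R y ^ (-p) * (max ‖x - y‖ d ^ 3)⁻¹
      ≤ lipConst p * (R x ^ (-3 : ℝ) + R x ^ (-p) * Real.log (1 / d)) := by
  refine (integral_weight_inv_max_cube_le hp hd hd2 x).2.trans ?_
  have hR := R_pos x
  have hl : Real.log (R x / (2 * d)) ≤ Real.log (R x) + Real.log (1 / d) := by
    rw [← Real.log_mul hR.ne' (by positivity)]
    refine Real.log_le_log (by positivity) ?_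
    rw [mul_one_div]
    gcongr
    linarith
  have h0 : 0 ≤ R x ^ (-p) := by positivity
  have h1 := R_rpow_mul_log_le hp x
  have h2 := R_rpow_le_neg_three hp x
  have hl0 : 0 ≤ Real.log (1 / d) := Real.log_nonneg (by rw [le_div_iff₀ hd]; linarith)
  have h3 : R x ^ (-p) * (1 + 3 * Real.log (R x / (2 * d)))
      ≤ (1 + 3 / (p - 3)) * R x ^ (-3 : ℝ) + 3 * (R x ^ (-p) * Real.log (1 / d)) := by
    have := mul_le_mul_of_nonneg_left hl h0
    have e : (1 + 3 / (p - 3)) * R x ^ (-3 : ℝ)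
        = R x ^ (-3 : ℝ) + 3 * (R x ^ (-3 : ℝ) / (p - 3)) := by ring
    rw [e]
    nlinarith
  have hB : 0 ≤ 2 ^ p * ballVol := by have := ballVol_nonneg; positivity
  have hW := weightMass_nonneg p
  have h4 := mul_le_mul_of_nonneg_left h3 hB
  have hp3 : 0 ≤ 3 / (p - 3) := by
    have : 0 < p - 3 := by linarith
    positivity
  have a1 : 0 ≤ R x ^ (-3 : ℝ) := by positivity
  have a2 : 0 ≤ R x ^ (-p) * Real.log (1 / d) := by positivity
  unfold lipConst
  have b1 := mul_nonneg hB a1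
  have b2 := mul_nonneg hB a2
  have b3 := mul_nonneg hW a2
  have b4 := mul_nonneg hp3 b2
  nlinarith

/-- The radius `d` stays free because its uses differ: a fixed radius for local bounds, the inverse
Lipschitz constant of `f` for the a priori bound, and a multiple of `R⁻³` for the weighted one. -/
lemma norm_field_sub_le (hp : 3 < p) (hσ : Continuous σ) (hM : 0 ≤ M)
    (hb : ∀ y, |σ y| ≤ M * R y ^ (-p)) {d η : ℝ} (hd : 0 < d) (hd2 : d ≤ 1 / 2) {x x' : Space3}
    (hη : ∀ z, ‖z‖ < d → |σ (x' - z) - σ (x - z)| ≤ η) :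
    ‖field σ x' - field σ x‖ ≤ 3 * ballVol * d * η + 4 * M * ‖x' - x‖ * (lipConst p *
      ((R x' ^ (-3 : ℝ) + R x' ^ (-p) * Real.log (1 / d))
        + (R x ^ (-3 : ℝ) + R x ^ (-p) * Real.log (1 / d)))) := by
  have e : field σ x' - field σ x
      = ((field σ x' - fieldReg d σ x') - (field σ x - fieldReg d σ x))
        + (fieldReg d σ x' - fieldReg d σ x) := by abel
  rw [e]
  refine (norm_add_le _ _).trans (add_le_add (norm_near_field_sub_le hp hσ hb hd hη)
    ((norm_fieldReg_sub_le hp hσ hb hd hd2 x x').trans ?_))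
  rw [mul_add (lipConst p)]
  gcongr
  · exact integral_weight_inv_max_cube_le' hp hd hd2 x'
  · exact integral_weight_inv_max_cube_le' hp hd hd2 x

/-- Log-Lipschitz estimate of the field. -/
lemma norm_field_sub_le_log (hp : 3 < p) (hσ : Continuous σ) (hM : 0 ≤ M)
    (hb : ∀ y, |σ y| ≤ M * R y ^ (-p)) {d η : ℝ} (hd : 0 < d) (hd2 : d ≤ 1 / 2) {x x' : Space3}
    (hη : ∀ z, ‖z‖ < d → |σ (x' - z) - σ (x - z)| ≤ η) :
    ‖field σ x' - field σ x‖ ≤ 3 * ballVol * d * η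
      + 8 * M * lipConst p * (1 + Real.log (1 / d)) * ‖x' - x‖ := by
  refine (norm_field_sub_le hp hσ hM hb hd hd2 hη).trans ?_
  have hl0 : 0 ≤ Real.log (1 / d) := Real.log_nonneg (by rw [le_div_iff₀ hd]; linarith)
  have hc := lipConst_nonneg hp
  have key : ∀ w : Space3, R w ^ (-3 : ℝ) + R w ^ (-p) * Real.log (1 / d)
      ≤ 1 + Real.log (1 / d) := fun w =>
    add_le_add (R_rpow_le_one (by norm_num) w)
      (mul_le_of_le_one_left hl0 (R_rpow_le_one (by linarith) w))
  have : 4 * M * ‖x' - x‖ * (lipConst p *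
      ((R x' ^ (-3 : ℝ) + R x' ^ (-p) * Real.log (1 / d))
        + (R x ^ (-3 : ℝ) + R x ^ (-p) * Real.log (1 / d))))
      ≤ 4 * M * ‖x' - x‖ * (lipConst p *
      ((1 + Real.log (1 / d)) + (1 + Real.log (1 / d)))) := by
    gcongr 4 * M * ‖x' - x‖ * (lipConst p * (?_ + ?_))
    · exact key x'
    · exact key x
  linarith

/-- The constant in the weighted Lipschitz estimate of the electric field. -/
def gradConst (p : ℝ) : ℝ := 3 * ballVol + 4 * lipConst p * (9 + (2 ^ p + 1) * (1 + 3 / (p - 3)))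

lemma gradConst_nonneg (hp : 3 < p) : 0 ≤ gradConst p := by
  have := lipConst_nonneg hp
  have := ballVol_nonneg
  have : 0 < p - 3 := by linarith
  unfold gradConst
  positivity

lemma norm_field_sub_le_weight (hp : 3 < p) (hσ : Continuous σ) (hM : 0 ≤ M)
    (hb : ∀ y, |σ y| ≤ M * R y ^ (-p)) {Λ : ℝ} (hΛ : 0 ≤ Λ)
    (hL : ∀ y y', |σ y' - σ y| ≤ Λ * ‖y' - y‖) {x x' : Space3} (h : ‖x - x'‖ ≤ R x / 2) :
    ‖field σ x' - field σ x‖ ≤ gradConst p * (M + Λ) * R x ^ (-3 : ℝ) * ‖x' - x‖ := by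
  have hR := R_pos x
  have hR1 := one_le_R x
  set r3 := R x ^ (-3 : ℝ) with hr3
  have hr3pos : 0 < r3 := by positivity
  have hr31 : r3 ≤ 1 := R_rpow_le_one (by norm_num) x
  -- The radius `R⁻³ / 2` gives the near field its factor `R⁻³`, while `log (1/d)` grows only like
  -- `3 log R`, which the surplus decay `R⁻ᵖ` absorbs.
  have hη : ∀ z : Space3, ‖z‖ < r3 / 2 → |σ (x' - z) - σ (x - z)| ≤ Λ * ‖x' - x‖ := fun z _ => by
    simpa using hL (x - z) (x' - z)
  refine (norm_field_sub_le hp hσ hM hb (half_pos hr3pos) (by linarith) hη).trans ?_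
  have hlog : Real.log (1 / (r3 / 2)) ≤ 1 + 3 * Real.log (R x) := by
    rw [one_div_div, Real.log_div (by norm_num) hr3pos.ne', hr3, Real.log_rpow hR]
    have := Real.log_two_lt_d9
    linarith
  have hp3 : 0 < p - 3 := by linarith
  have k1 : R x ^ (-p) * (1 + 3 * Real.log (R x)) ≤ (1 + 3 / (p - 3)) * r3 := by
    have h1 := R_rpow_mul_log_le hp x
    have h2 := R_rpow_le_neg_three hp x
    have e : (1 + 3 / (p - 3)) * r3 = r3 + 3 * (r3 / (p - 3)) := by ring
    rw [e]
    linarith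
  have hlog0 : 0 ≤ 1 + 3 * Real.log (R x) := by
    have := Real.log_nonneg hR1
    linarith
  have k2 : R x ^ (-p) * Real.log (1 / (r3 / 2)) ≤ (1 + 3 / (p - 3)) * r3 :=
    (mul_le_mul_of_nonneg_left hlog (by positivity)).trans k1
  have k3 : R x' ^ (-p) * Real.log (1 / (r3 / 2)) ≤ 2 ^ p * ((1 + 3 / (p - 3)) * r3) := by
    have hw := R_rpow_neg_le (by linarith : (0 : ℝ) ≤ p) h
    have hR' : 0 ≤ R x' ^ (-p) := Real.rpow_nonneg (R_pos x').le _
    calc R x' ^ (-p) * Real.log (1 / (r3 / 2)) ≤ R x' ^ (-p) * (1 + 3 * Real.log (R x)) := by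
          gcongr
      _ ≤ 2 ^ p * R x ^ (-p) * (1 + 3 * Real.log (R x)) := by gcongr
      _ = 2 ^ p * (R x ^ (-p) * (1 + 3 * Real.log (R x))) := by ring
      _ ≤ _ := by gcongr
  have k4 : R x' ^ (-3 : ℝ) ≤ 8 * r3 := by
    have := R_rpow_neg_le (by norm_num : (0 : ℝ) ≤ 3) h
    rwa [show (2 : ℝ) ^ (3 : ℝ) = 8 by norm_num] at this
  have hc := lipConst_nonneg hp
  have hv := ballVol_nonneg
  have hn := norm_nonneg (x' - x)
  have k5 : (R x' ^ (-3 : ℝ) + R x' ^ (-p) * Real.log (1 / (r3 / 2)))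
        + (r3 + R x ^ (-p) * Real.log (1 / (r3 / 2)))
      ≤ (9 + (2 ^ p + 1) * (1 + 3 / (p - 3))) * r3 := by
    linarith
  have k6 := mul_le_mul_of_nonneg_left k5 (by positivity : 0 ≤ 4 * M * ‖x' - x‖ * lipConst p)
  have k7 : 3 * ballVol * (r3 / 2) * (Λ * ‖x' - x‖) ≤ 3 * ballVol * Λ * (r3 * ‖x' - x‖) := by
    have : 0 ≤ 3 * ballVol * Λ * (r3 * ‖x' - x‖) := by positivity
    linarith
  set g := 9 + (2 ^ p + 1) * (1 + 3 / (p - 3)) with hg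
  have hg0 : 0 ≤ g := by positivity
  have k8 : 0 ≤ 3 * ballVol * M * (r3 * ‖x' - x‖) := by positivity
  have k9 : 0 ≤ 4 * lipConst p * g * Λ * (r3 * ‖x' - x‖) := by positivity
  have e : gradConst p * (M + Λ) * r3 * ‖x' - x‖ = 3 * ballVol * M * (r3 * ‖x' - x‖)
      + 3 * ballVol * Λ * (r3 * ‖x' - x‖) + 4 * lipConst p * g * M * (r3 * ‖x' - x‖)
      + 4 * lipConst p * g * Λ * (r3 * ‖x' - x‖) := by
    unfold gradConst
    ring
  rw [e]
  linarith

end Field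

/-! ### The divergence of the field as a limit of difference quotients. -/

/-- The `i`-th coordinate vector. -/
abbrev coordVec (i : Fin 3) : Space3 := EuclideanSpace.single i (1 : ℝ)

/-- The difference quotient that approximates the divergence. -/
def divQuot (B : Space3 → Space3) (x : Space3) (h : ℝ) : ℝ :=
  ∑ i : Fin 3, (B (x + h • coordVec i) i - B x i) / h

lemma hasDerivAt_ker_coord_far {d : ℝ} {z : Space3} (hd : 0 ≤ d) (hz : d < ‖z‖) (i : Fin 3) :
    HasDerivAt (fun h : ℝ => ker d (z + h • coordVec i) i)
      ((‖z‖ ^ 3)⁻¹ - 3 * (‖z‖ ^ 5)⁻¹ * z i ^ 2) 0 := by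
  have hz0 : 0 < ‖z‖ := hd.trans_lt hz
  have hline : HasDerivAt (fun h : ℝ => z + h • coordVec i) (coordVec i) 0 := by
    simpa using ((hasDerivAt_id (0 : ℝ)).smul_const (coordVec i)).const_add z
  have h1 : HasDerivAt (fun h : ℝ => ‖z + h • coordVec i‖ ^ 2) (2 * z i) 0 := by
    have := hline.norm_sq
    simpa [EuclideanSpace.inner_single_right] using this
  have h2 := (h1.rpow_const (p := (-3 / 2 : ℝ)) (Or.inl (by simp; exact norm_pos_iff.1 hz0)))
  have h3 : HasDerivAt (fun h : ℝ => z i + h) 1 0 := by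
    simpa using (hasDerivAt_id (0 : ℝ)).const_add (z i)
  have h4 := h2.mul h3
  have hev : ∀ᶠ h in 𝓝 (0 : ℝ), d < ‖z + h • coordVec i‖ := by
    have : ContinuousAt (fun h : ℝ => ‖z + h • coordVec i‖) 0 := by fun_prop
    exact this.eventually_const_lt (by simpa using hz)
  refine (h4.congr_of_eventuallyEq ?_).congr_deriv ?_
  · filter_upwards [hev] with h hh
    have hp : 0 < ‖z + h • coordVec i‖ := hd.trans_lt hh
    simp only [ker, max_eq_left hh.le, Pi.mul_apply]
    rw [← Real.rpow_natCast _ 2, ← Real.rpow_mul hp.le]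
    norm_num
    ring
  · simp only [zero_smul, add_zero]
    rw [← Real.rpow_natCast _ 2, ← Real.rpow_mul hz0.le, ← Real.rpow_mul hz0.le]
    norm_num
    ring

lemma hasDerivAt_ker_coord_near {d : ℝ} {z : Space3} (hz : ‖z‖ < d) (i : Fin 3) :
    HasDerivAt (fun h : ℝ => ker d (z + h • coordVec i) i) (d ^ 3)⁻¹ 0 := by
  have h3 : HasDerivAt (fun h : ℝ => (d ^ 3)⁻¹ * (z i + h)) (d ^ 3)⁻¹ 0 := by
    simpa using ((hasDerivAt_id (0 : ℝ)).const_add (z i)).const_mul (d ^ 3)⁻¹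
  have hev : ∀ᶠ h in 𝓝 (0 : ℝ), ‖z + h • coordVec i‖ < d := by
    have : ContinuousAt (fun h : ℝ => ‖z + h • coordVec i‖) 0 := by fun_prop
    exact this.eventually_lt_const (by simpa using hz)
  refine h3.congr_of_eventuallyEq ?_
  filter_upwards [hev] with h hh
  simp [ker, max_eq_right hh.le]
  ring

/-- Inside the ball the kernel is the linear map `z / d³`; outside it is the Coulomb kernel, which
is divergence free. The sphere is excluded because the two formulas meet there with a kink. -/
lemma tendsto_divQuot_ker {d : ℝ} (hd : 0 < d) {z : Space3} (hz : ‖z‖ ≠ d) :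
    Tendsto (divQuot (ker d) z) (𝓝[≠] 0)
      (𝓝 ((ball (0 : Space3) d).indicator (fun _ => 3 / d ^ 3) z)) := by
  have conv : ∀ {c : Fin 3 → ℝ}, (∀ i, HasDerivAt (fun h : ℝ => ker d (z + h • coordVec i) i) (c i) 0)
      → Tendsto (divQuot (ker d) z) (𝓝[≠] 0) (𝓝 (∑ i, c i)) := by
    intro c hc
    unfold divQuot
    refine tendsto_finsetSum _ fun i _ => ?_
    have := (hasDerivAt_iff_tendsto_slope_zero.1 (hc i))
    refine this.congr fun h => ?_
    simp [div_eq_inv_mul]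
  rcases lt_or_gt_of_ne hz with h | h
  · rw [indicator_of_mem (by simpa using h)]
    have := conv (fun i => hasDerivAt_ker_coord_near h i)
    convert this using 2
    simp
    ring
  · rw [indicator_of_notMem (by simpa using h.le)]
    have := conv (fun i => hasDerivAt_ker_coord_far hd.le h i)
    convert this using 2
    have hz0 : 0 < ‖z‖ := hd.trans h
    have hs : ‖z‖ ^ 2 = z 0 ^ 2 + z 1 ^ 2 + z 2 ^ 2 := by
      rw [EuclideanSpace.norm_sq_eq]
      simp [Fin.sum_univ_three]
    rw [Fin.sum_univ_three]
    field_simp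
    rw [hs]
    ring

section Divergence

variable {p M : ℝ} {σ : Space3 → ℝ}

lemma abs_divQuot_le {B : Space3 → Space3} {x : Space3} {h L : ℝ}
    (hL : ∀ i, ‖B (x + h • coordVec i) - B x‖ ≤ L * |h|) (hL0 : 0 ≤ L) :
    |divQuot B x h| ≤ 3 * L := by
  unfold divQuot
  refine (Finset.abs_sum_le_sum_abs _ _).trans ?_
  have : ∀ i ∈ (Finset.univ : Finset (Fin 3)),
      |(B (x + h • coordVec i) i - B x i) / h| ≤ L := by
    intro i _
    rw [abs_div]
    refine div_le_of_le_mul₀ (abs_nonneg _) hL0 ?_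
    refine le_trans ?_ (hL i)
    simpa using PiLp.norm_apply_le (B (x + h • coordVec i) - B x) i
  refine (Finset.sum_le_sum this).trans ?_
  simp

lemma divQuot_sub (B B' : Space3 → Space3) (x : Space3) (h : ℝ) :
    divQuot (fun y => B y - B' y) x h = divQuot B x h - divQuot B' x h := by
  unfold divQuot
  rw [← Finset.sum_sub_distrib]
  refine Finset.sum_congr rfl fun i _ => ?_
  simp only [PiLp.sub_apply]
  ring

lemma divQuot_add (B B' : Space3 → Space3) (x : Space3) (h : ℝ) :
    divQuot (fun y => B y + B' y) x h = divQuot B x h + divQuot B' x h := by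
  unfold divQuot
  rw [← Finset.sum_add_distrib]
  refine Finset.sum_congr rfl fun i _ => ?_
  simp only [PiLp.add_apply]
  ring

/-- For `d > 0` the kernel is globally Lipschitz, so its quotients are uniformly bounded and
dominated convergence applies; the exceptional sphere is null. The limit is `3 * ballVol` times the
mean of `σ` over `ball x d`. -/
lemma tendsto_divQuot_fieldReg (hp : 3 < p) (hσ : Continuous σ)
    (hb : ∀ y, |σ y| ≤ M * R y ^ (-p)) {d : ℝ} (hd : 0 < d) (x : Space3) :
    Tendsto (divQuot (fieldReg d σ) x) (𝓝[≠] 0) (𝓝 (3 / d ^ 3 * ∫ y in ball x d, σ y)) := by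
  have hi := fun x => integrable_smul_ker hp hσ hb d x
  have hcoord : ∀ (x : Space3) i, fieldReg d σ x i = ∫ y, σ y * ker d (x - y) i := by
    intro x i
    have := (EuclideanSpace.proj (𝕜 := ℝ) i).integral_comp_comm (hi x)
    simpa [fieldReg] using this.symm
  have hic : ∀ (x : Space3) i, Integrable fun y => σ y * ker d (x - y) i := fun x i => by
    simpa using (EuclideanSpace.proj (𝕜 := ℝ) i).integrable_comp (hi x)
  have e : ∀ h, divQuot (fieldReg d σ) x h = ∫ y, σ y * divQuot (ker d) (x - y) h := by
    intro h
    unfold divQuot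
    simp_rw [hcoord, Finset.mul_sum]
    rw [integral_finsetSum]
    · refine Finset.sum_congr rfl fun i _ => ?_
      rw [← integral_sub (hic _ i) (hic _ i), ← integral_div]
      congr 1
      ext1 y
      rw [show x + h • coordVec i - y = x - y + h • coordVec i by abel]
      ring
    · intro i _
      have := ((hic (x + h • coordVec i) i).sub (hic x i)).div_const h
      refine this.congr (Eventually.of_forall fun y => ?_)
      simp only [Pi.sub_apply]
      rw [show x + h • coordVec i - y = x - y + h • coordVec i by abel]
      ring
  have hlim : 3 / d ^ 3 * ∫ y in ball x d, σ y
      = ∫ y, σ y * (ball (0 : Space3) d).indicator (fun _ => 3 / d ^ 3) (x - y) := by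
    rw [← integral_indicator measurableSet_ball, ← integral_const_mul]
    congr 1
    ext1 y
    by_cases hy : ‖x - y‖ < d
    · rw [indicator_of_mem (by simpa [dist_eq_norm, norm_sub_rev] using hy),
        indicator_of_mem (by simpa using hy)]
      ring
    · rw [indicator_of_notMem (by simpa [dist_eq_norm, norm_sub_rev] using hy),
        indicator_of_notMem (by simpa using hy)]
      ring
  rw [hlim, funext e]
  have hmd : ∀ h, Measurable (divQuot (ker d) · h) := by
    intro h
    unfold divQuot
    refine Finset.measurable_sum _ fun i _ => ?_
    refine Measurable.div_const ?_ h
    have hproj : Measurable fun z : Space3 => z i := by fun_prop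
    exact (hproj.comp ((measurable_ker d).comp (measurable_id.add_const _))).sub
      (hproj.comp (measurable_ker d))
  refine tendsto_integral_filter_of_dominated_convergence
    (fun y => M * R y ^ (-p) * (3 * (8 * (d ^ 3)⁻¹))) ?_ ?_ ?_ ?_
  · refine Eventually.of_forall fun h => hσ.aestronglyMeasurable.mul ?_
    exact ((hmd h).comp (measurable_const.sub measurable_id)).aestronglyMeasurable
  · refine Eventually.of_forall fun h => Eventually.of_forall fun y => ?_
    rw [norm_mul, Real.norm_eq_abs, Real.norm_eq_abs]
    refine mul_le_mul (hb y) ?_ (abs_nonneg _) ((abs_nonneg _).trans (hb y))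
    refine abs_divQuot_le (fun i => ?_) (by positivity)
    refine (norm_ker_sub_ker_le hd _ _).trans ?_
    have hn : ‖x - y + h • coordVec i - (x - y)‖ = |h| := by simp [norm_smul]
    rw [hn]
    calc _ ≤ 4 * |h| * ((d ^ 3)⁻¹ + (d ^ 3)⁻¹) := by gcongr <;> exact le_max_right _ _
      _ = _ := by ring
  · exact ((integrable_R_rpow hp).const_mul M).mul_const _
  · have hnull : ∀ᵐ y : Space3, y ∉ sphere x d :=
      measure_eq_zero_iff_ae_notMem.1 (Measure.addHaar_sphere volume x d)
    filter_upwards [hnull] with y hy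
    refine Tendsto.const_mul _ (tendsto_divQuot_ker hd ?_)
    simpa [dist_eq_norm, norm_sub_rev] using hy

/-- Truncation changes the quotients by at most a multiple of `Λ d`, uniformly in `h`, and the mean
of `σ` over `ball x d` is equally close to `σ x`. So `d` is fixed first, in terms of `ε`, and then
`h` tends to zero. -/
lemma tendsto_divQuot_field (hp : 3 < p) (hσ : Continuous σ)
    (hb : ∀ y, |σ y| ≤ M * R y ^ (-p)) {x : Space3} {Λ : ℝ} (hΛ : 0 ≤ Λ)
    (hL : ∀ y ∈ ball x 2, ∀ y' ∈ ball x 2, |σ y' - σ y| ≤ Λ * ‖y' - y‖) :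
    Tendsto (divQuot (field σ) x) (𝓝[≠] 0) (𝓝 (3 * ballVol * σ x)) := by
  have hc := ballVol_nonneg
  rw [Metric.tendsto_nhds]
  intro ε hε
  -- The bound `1` keeps all shifted points in `ball x 2`. The two errors `9 * ballVol * Λ * d` and
  -- `3 * ballVol * Λ * d` together must stay below `ε / 2`; the `+ 1` covers `Λ = 0`.
  set d : ℝ := min 1 (ε / (24 * ballVol * Λ + 1)) with hd_def
  have hd : 0 < d := by positivity
  have hd1 : d ≤ 1 := min_le_left _ _
  have hdε : 12 * ballVol * Λ * d ≤ ε / 2 := by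
    have h1 : d ≤ ε / (24 * ballVol * Λ + 1) := min_le_right _ _
    rw [le_div_iff₀ (by positivity)] at h1
    linarith
  have hmean : |3 / d ^ 3 * (∫ y in ball x d, σ y) - 3 * ballVol * σ x| ≤ 3 * ballVol * Λ * d := by
    have hvol : volume.real (ball x d) = d ^ 3 * ballVol := by
      rw [Measure.real, Measure.addHaar_ball volume x hd.le, ENNReal.toReal_mul,
        ENNReal.toReal_ofReal (by positivity), finrank_euclideanSpace_fin, ballVol, Measure.real]
    have e1 : 3 / d ^ 3 * (∫ y in ball x d, σ y) - 3 * ballVol * σ x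
        = 3 / d ^ 3 * ∫ y in ball x d, (σ y - σ x) := by
      rw [integral_sub ((hσ.continuousOn.integrableOn_compact (isCompact_closedBall x d)).mono_set
        ball_subset_closedBall) (integrableOn_const measure_ball_lt_top.ne), setIntegral_const, hvol,
        smul_eq_mul, mul_sub]
      field_simp
    have e2 : ‖∫ y in ball x d, (σ y - σ x)‖ ≤ Λ * d * volume.real (ball x d) := by
      refine norm_setIntegral_le_of_norm_le_const measure_ball_lt_top fun y hy => ?_
      have hy' : ‖y - x‖ < d := by simpa [dist_eq_norm] using hy
      refine (hL x (by simp) y ?_).trans (by gcongr)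
      simp only [mem_ball, dist_eq_norm]
      linarith
    rw [e1, abs_mul, abs_of_pos (by positivity : 0 < 3 / d ^ 3)]
    rw [Real.norm_eq_abs, hvol] at e2
    calc _ ≤ 3 / d ^ 3 * (Λ * d * (d ^ 3 * ballVol)) := by gcongr
      _ = _ := by field_simp
  have hnear : ∀ᶠ h in 𝓝[≠] (0 : ℝ), |h| < 1 := by
    refine nhdsWithin_le_nhds ?_
    have : ContinuousAt (fun h : ℝ => |h|) 0 := by fun_prop
    exact this.eventually_lt_const (by simp)
  have hreg := (Metric.tendsto_nhds.1 (tendsto_divQuot_fieldReg hp hσ hb hd x)) (ε / 2) (half_pos hε)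
  filter_upwards [hnear, hreg] with h h1 h2
  have h3 : |divQuot (field σ) x h - divQuot (fieldReg d σ) x h| ≤ 3 * (3 * ballVol * d * Λ) := by
    rw [← divQuot_sub]
    refine abs_divQuot_le (fun i => ?_) (by positivity)
    have hn : ‖h • coordVec i‖ = |h| := by simp [norm_smul]
    refine (norm_near_field_sub_le hp hσ hb hd (η := Λ * |h|) fun z hz => ?_).trans
      (le_of_eq (by ring))
    refine (hL (x - z) ?_ (x + h • coordVec i - z) ?_).trans (le_of_eq ?_)
    · simp only [mem_ball, dist_eq_norm, sub_sub_cancel_left, norm_neg]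
      linarith
    · rw [mem_ball, dist_eq_norm, show x + h • coordVec i - z - x = h • coordVec i - z by abel]
      have := norm_sub_le (h • coordVec i) z
      linarith
    · rw [show x + h • coordVec i - z - (x - z) = h • coordVec i by abel, hn]
  rw [Real.dist_eq] at h2 ⊢
  have e : divQuot (field σ) x h - 3 * ballVol * σ x
      = (divQuot (field σ) x h - divQuot (fieldReg d σ) x h)
        + (divQuot (fieldReg d σ) x h - 3 / d ^ 3 * ∫ y in ball x d, σ y)
        + (3 / d ^ 3 * (∫ y in ball x d, σ y) - 3 * ballVol * σ x) := by ring
  rw [e]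
  have := abs_add_three (divQuot (field σ) x h - divQuot (fieldReg d σ) x h)
    (divQuot (fieldReg d σ) x h - 3 / d ^ 3 * ∫ y in ball x d, σ y)
    (3 / d ^ 3 * (∫ y in ball x d, σ y) - 3 * ballVol * σ x)
  linarith

end Divergence

/-! ### Solutions along characteristics and their domain of dependence. -/

/-- The total force field `E + A`. -/
def force (F : Space3 → ℝ) (f : ℝ → Space3 → Space3 → ℝ) (A : ℝ → Space3 → Space3)
    (s : ℝ) (x : Space3) : Space3 := field (rho F f s) x + A s x

/-- The backward characteristic `X' = V`, `V' = -H(τ, X)` on `[0, s]` ending at `(x, v)`. -/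
structure IsCharacteristic (H : ℝ → Space3 → Space3) (s : ℝ) (x v : Space3)
    (X V : ℝ → Space3) : Prop where
  X_end : X s = x
  V_end : V s = v
  deriv_X : ∀ τ ∈ Icc 0 s, HasDerivWithinAt X (V τ) (Icc 0 s) τ
  deriv_V : ∀ τ ∈ Icc 0 s, HasDerivWithinAt V (-H τ (X τ)) (Icc 0 s) τ

section Solution

variable {F : Space3 → ℝ} {f₀ : Space3 → Space3 → ℝ} {A : ℝ → Space3 → Space3} {T : ℝ}
  {f : ℝ → Space3 → Space3 → ℝ}

lemma IsSolution.hasFDerivWithinAt (hS : IsSolution F f₀ A T f) {s : ℝ} (hs : s ∈ Ico 0 T)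
    (x v : Space3) :
    HasFDerivWithinAt (fun z : ℝ × Space3 × Space3 => f z.1 z.2.1 z.2.2)
      (fderivWithin ℝ (fun z : ℝ × Space3 × Space3 => f z.1 z.2.1 z.2.2) (Ico 0 T ×ˢ univ) (s, x, v))
      (Ico 0 T ×ˢ univ) (s, x, v) :=
  ((hS.contDiffOn.differentiableOn one_ne_zero) (s, x, v) ⟨hs, trivial⟩).hasFDerivWithinAt

/-- The Vlasov equation: the derivative in the characteristic direction vanishes. -/
lemma IsSolution.fderivWithin_characteristic (hS : IsSolution F f₀ A T f) {s : ℝ}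
    (hs : s ∈ Ico 0 T) (x v : Space3) :
    fderivWithin ℝ (fun z : ℝ × Space3 × Space3 => f z.1 z.2.1 z.2.2) (Ico 0 T ×ˢ univ) (s, x, v)
      (1, v, -force F f A s x) = 0 := by
  have hD := hS.hasFDerivWithinAt hs x v
  set D := fderivWithin ℝ (fun z : ℝ × Space3 × Space3 => f z.1 z.2.1 z.2.2)
    (Ico 0 T ×ˢ univ) (s, x, v)
  have ht : derivWithin (fun s => f s x v) (Ico 0 T) s = D (1, 0, 0) := by
    have h1 : HasDerivWithinAt (fun s : ℝ => (s, x, v)) (1, 0, 0) (Ico 0 T) s :=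
      (hasDerivWithinAt_id s _).prodMk (hasDerivWithinAt_const _ _ _)
    have h2 := hD.comp_hasDerivWithinAt s h1 (fun τ hτ => mk_mem_prod hτ (mem_univ _))
    exact h2.derivWithin (uniqueDiffOn_Ico 0 T s hs)
  have hx : ∀ a, inner ℝ a (gradient (fun y => f s y v) x) = D (0, a, 0) := by
    intro a
    have h1 : HasFDerivWithinAt (fun y : Space3 => (s, y, v))
        ((0 : Space3 →L[ℝ] ℝ).prod ((ContinuousLinearMap.id ℝ Space3).prod 0)) univ x :=
      (hasFDerivWithinAt_const _ _ _).prodMk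
        ((hasFDerivWithinAt_id x _).prodMk (hasFDerivWithinAt_const _ _ _))
    have h2 := (hD.comp x h1 (fun y _ => mk_mem_prod hs (mem_univ _))).hasFDerivAt univ_mem
    have h3 : fderiv ℝ (fun y => f s y v) x = _ := h2.fderiv
    rw [inner_gradient_right, h3]
    simp
  have hv : ∀ a, inner ℝ a (gradient (fun w => f s x w) v) = D (0, 0, a) := by
    intro a
    have h1 : HasFDerivWithinAt (fun w : Space3 => (s, x, w))
        ((0 : Space3 →L[ℝ] ℝ).prod ((0 : Space3 →L[ℝ] Space3).prod
          (ContinuousLinearMap.id ℝ Space3))) univ v :=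
      (hasFDerivWithinAt_const _ _ _).prodMk
        ((hasFDerivWithinAt_const _ _ _).prodMk (hasFDerivWithinAt_id v _))
    have h2 := (hD.comp v h1 (fun y _ => mk_mem_prod hs (mem_univ _))).hasFDerivAt univ_mem
    have h3 : fderiv ℝ (fun w => f s x w) v = _ := h2.fderiv
    rw [inner_gradient_right, h3]
    simp
  have h := hS.vlasov s hs x v
  rw [ht, hx, hv] at h
  have e : ((1 : ℝ), v, -force F f A s x)
      = (1, 0, 0) + (0, v, 0) - (0, 0, field (rho F f s) x + A s x) := by
    simp [force]
  rw [e, map_sub, map_add]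
  exact h

/-- A solution is constant along characteristics. -/
lemma IsSolution.eq_initial (hS : IsSolution F f₀ A T f) {s : ℝ} (hs : s ∈ Ico 0 T)
    {x v : Space3} {X V : ℝ → Space3} (hc : IsCharacteristic (force F f A) s x v X V) :
    f s x v = f₀ (X 0) (V 0) := by
  have hder : ∀ τ ∈ Icc 0 s, HasDerivWithinAt (fun τ => f τ (X τ) (V τ)) 0 (Icc 0 s) τ := by
    intro τ hτ
    have hτT : τ ∈ Ico 0 T := ⟨hτ.1, hτ.2.trans_lt hs.2⟩
    have h1 : HasDerivWithinAt (fun τ => (τ, X τ, V τ)) (1, V τ, -force F f A τ (X τ))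
        (Icc 0 s) τ := (hasDerivWithinAt_id τ _).prodMk ((hc.deriv_X τ hτ).prodMk (hc.deriv_V τ hτ))
    have h2 := (hS.hasFDerivWithinAt hτT (X τ) (V τ)).comp_hasDerivWithinAt τ h1
      (fun τ' hτ' => mk_mem_prod (show _ ∈ Ico 0 T from ⟨hτ'.1, hτ'.2.trans_lt hs.2⟩) (mem_univ _))
    rw [hS.fderivWithin_characteristic hτT] at h2
    exact h2
  have hconst := constant_of_has_deriv_right_zero (f := fun τ => f τ (X τ) (V τ)) (a := 0) (b := s)
    (fun τ hτ => (hder τ hτ).continuousWithinAt)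
    (fun τ hτ => (hder τ ⟨hτ.1, hτ.2.le⟩).mono_of_mem_nhdsWithin
      (Icc_mem_nhdsGE_of_mem hτ)) s ⟨hs.1, le_rfl⟩
  simp only [hc.X_end, hc.V_end] at hconst
  rw [hconst, hS.initial]

/-- Domain of dependence: the value at `(s, x, v)` is bounded by initial values at velocities
that differ from `v` by at most `K s`. -/
lemma IsSolution.exists_le_initial (hS : IsSolution F f₀ A T f) {s : ℝ} (hs : s ∈ Ico 0 T) {K : ℝ}
    (hK : ∀ τ ∈ Icc 0 s, ∀ y, ‖force F f A τ y‖ ≤ K) (x v : Space3) {ε : ℝ} (hε : 0 < ε) :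
    ∃ y w, ‖w - v‖ ≤ K * s ∧ f s x v ≤ f₀ y w + ε * s := by
  have hK0 : 0 ≤ K := (norm_nonneg _).trans (hK 0 ⟨le_rfl, hs.1⟩ 0)
  set B := ‖v‖ + K * s
  have hB0 : 0 ≤ B := by have := hs.1; positivity
  -- Backward cone: velocities drift at rate at most `K`, hence stay below `B`, and positions drift
  -- at rate at most `B`. It is compact and contains every straight backward step in a
  -- characteristic direction.
  set D : Set (ℝ × Space3 × Space3) := (Icc 0 s ×ˢ closedBall x (B * s) ×ˢ closedBall v (K * s)) ∩
    {z | ‖z.2.1 - x‖ ≤ B * (s - z.1) ∧ ‖z.2.2 - v‖ ≤ K * (s - z.1)}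
  have hDmem : ∀ {τ y w}, (τ, y, w) ∈ D ↔
      τ ∈ Icc 0 s ∧ ‖y - x‖ ≤ B * (s - τ) ∧ ‖w - v‖ ≤ K * (s - τ) := by
    intro τ y w
    constructor
    · rintro ⟨⟨h1, -⟩, h2⟩
      exact ⟨h1, h2⟩
    · rintro ⟨h1, h2, h3⟩
      refine ⟨⟨h1, ?_, ?_⟩, h2, h3⟩
      · simp only [mem_closedBall, dist_eq_norm]
        exact h2.trans (mul_le_mul_of_nonneg_left (by linarith [h1.1]) hB0)
      · simp only [mem_closedBall, dist_eq_norm]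
        exact h3.trans (mul_le_mul_of_nonneg_left (by linarith [h1.1]) hK0)
  have hDc : IsCompact D := by
    refine IsCompact.inter_right (isCompact_Icc.prod
      ((isCompact_closedBall _ _).prod (isCompact_closedBall _ _))) ?_
    have h1 : IsClosed {z : ℝ × Space3 × Space3 | ‖z.2.1 - x‖ ≤ B * (s - z.1)} :=
      isClosed_le (by fun_prop) (by fun_prop)
    have h2 : IsClosed {z : ℝ × Space3 × Space3 | ‖z.2.2 - v‖ ≤ K * (s - z.1)} :=
      isClosed_le (by fun_prop) (by fun_prop)
    exact h1.inter h2
  have hDT : D ⊆ Ico 0 T ×ˢ univ := fun z hz => ⟨⟨hz.1.1.1, hz.1.1.2.trans_lt hs.2⟩, trivial⟩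
  have hcont : ContinuousOn (fun z : ℝ × Space3 × Space3 => f z.1 z.2.1 z.2.2 - ε * z.1) D :=
    (hS.contDiffOn.continuousOn.mono hDT).sub (by fun_prop)
  have hbase : (s, x, v) ∈ D := hDmem.2 ⟨⟨hs.1, le_rfl⟩, by simp, by simp⟩
  -- The penalty `ε τ` pushes the maximum to time zero: a straight step backward in the
  -- characteristic direction leaves `f` unchanged to first order and lowers the penalty at rate
  -- `ε`. No characteristic curve is needed, only the bound on the force.
  obtain ⟨⟨τ, y, w⟩, hz, hmax⟩ := hDc.exists_isMaxOn ⟨_, hbase⟩ hcont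
  obtain ⟨hτ, hy, hw⟩ := hDmem.1 hz
  rcases hτ.1.eq_or_lt with h0 | hpos
  · subst h0
    refine ⟨y, w, by simpa using hw, ?_⟩
    have := hmax hbase
    simp only [mem_ofPred_eq, mul_zero, sub_zero] at this
    rw [hS.initial] at this
    linarith
  · exfalso
    have hτT : τ ∈ Ico 0 T := ⟨hτ.1, hτ.2.trans_lt hs.2⟩
    set H := force F f A τ y
    have hcurve : ∀ δ ∈ Icc 0 τ, (τ - δ, y - δ • w, w + δ • H) ∈ D := by
      intro δ hδ
      have hwB : ‖w‖ ≤ B := by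
        have h1 : ‖w‖ ≤ ‖v‖ + ‖w - v‖ := by simpa using norm_add_le v (w - v)
        have h2 : K * (s - τ) ≤ K * s := mul_le_mul_of_nonneg_left (by linarith) hK0
        linarith
      refine hDmem.2 ⟨⟨by linarith [hδ.2], by linarith [hδ.1, hτ.2]⟩, ?_, ?_⟩
      · rw [show y - δ • w - x = (y - x) - δ • w by abel]
        refine (norm_sub_le _ _).trans ?_
        rw [norm_smul, Real.norm_of_nonneg hδ.1]
        have := mul_le_mul_of_nonneg_left hwB hδ.1
        linarith
      · rw [show w + δ • H - v = (w - v) + δ • H by abel]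
        refine (norm_add_le _ _).trans ?_
        rw [norm_smul, Real.norm_of_nonneg hδ.1]
        have := mul_le_mul_of_nonneg_left (hK τ hτ y) hδ.1
        linarith
    have hc1 : HasDerivWithinAt (fun δ : ℝ => (τ - δ, y - δ • w, w + δ • H)) (-1, -w, H)
        (Icc 0 τ) 0 := by
      refine HasDerivWithinAt.prodMk ?_ (HasDerivWithinAt.prodMk ?_ ?_)
      · simpa using (hasDerivWithinAt_id (0 : ℝ) (Icc 0 τ)).const_sub τ
      · simpa using ((hasDerivWithinAt_id (0 : ℝ) (Icc 0 τ)).smul_const w).const_sub y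
      · simpa using ((hasDerivWithinAt_id (0 : ℝ) (Icc 0 τ)).smul_const H).const_add w
    have hD' := hS.hasFDerivWithinAt hτT y w
    have h0 := hS.fderivWithin_characteristic hτT y w
    set D' := fderivWithin ℝ (fun z : ℝ × Space3 × Space3 => f z.1 z.2.1 z.2.2)
      (Ico 0 T ×ˢ univ) (τ, y, w)
    have hD'' : HasFDerivWithinAt (fun z : ℝ × Space3 × Space3 => f z.1 z.2.1 z.2.2) D'
      (Ico 0 T ×ˢ univ) (τ - 0, y - (0 : ℝ) • w, w + (0 : ℝ) • H) := by simpa using hD'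
    have hc2 := hD''.comp_hasDerivWithinAt (0 : ℝ) hc1 (fun δ hδ => hDT (hcurve δ hδ))
    have hval : D' (-1, -w, H) = 0 := by
      have : ((-1 : ℝ), -w, H) = -(1, w, -force F f A τ y) := by simp [H]
      rw [this, map_neg, h0, neg_zero]
    rw [hval] at hc2
    have hc3 : HasDerivWithinAt (fun δ : ℝ => ε * (τ - δ)) (-ε) (Icc 0 τ) 0 := by
      simpa using ((hasDerivWithinAt_id (0 : ℝ) (Icc 0 τ)).const_sub τ).const_mul ε
    have hc4 := hc2.sub hc3
    rw [hasDerivWithinAt_iff_tendsto_slope] at hc4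
    have hle : 0 - -ε ≤ 0 := by
      have hne : (𝓝[Icc 0 τ \ {0}] (0 : ℝ)).NeBot := by
        rw [Icc_sdiff_left]
        exact left_nhdsWithin_Ioc_neBot hpos
      refine le_of_tendsto hc4 ?_
      filter_upwards [self_mem_nhdsWithin] with δ hδ
      have hδ0 : 0 < δ := lt_of_le_of_ne hδ.1.1 (fun h => hδ.2 h.symm)
      have := hmax (hcurve δ hδ.1)
      simp only [mem_ofPred_eq] at this
      simp only [slope, vsub_eq_sub, sub_zero, smul_eq_mul, Pi.sub_apply, Function.comp, zero_smul,
        add_zero]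
      exact mul_nonpos_of_nonneg_of_nonpos (by positivity) (by linarith)
    linarith

/-- The bound on the velocity support has to precede the continuity of `ρ`, and with it the
existence of characteristics. It therefore rests on the domain of dependence, with `ε` tending to
zero. -/
lemma IsSolution.eq_zero_of_lt (hS : IsSolution F f₀ A T f) {s : ℝ} (hs : s ∈ Ico 0 T) {K P : ℝ}
    (hK : ∀ τ ∈ Icc 0 s, ∀ y, ‖force F f A τ y‖ ≤ K) (hP : ∀ x v, P < ‖v‖ → f₀ x v = 0)
    (x : Space3) {v : Space3} (hv : P + K * s < ‖v‖) : f s x v = 0 := by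
  refine le_antisymm ?_ (hS.nonneg s hs x v)
  have hle : ∀ ε : ℝ, 0 < ε → f s x v ≤ ε * s := by
    intro ε hε
    obtain ⟨y, w, hw, hf⟩ := hS.exists_le_initial hs hK x v hε
    rw [hP y w, zero_add] at hf
    · exact hf
    · have : ‖v‖ ≤ ‖w‖ + ‖w - v‖ := by
        simpa [norm_sub_rev] using norm_add_le w (v - w)
      linarith
  have hlim : Tendsto (fun ε : ℝ => ε * s) (𝓝[>] 0) (𝓝 (0 * s)) :=
    (tendsto_id.mono_left nhdsWithin_le_nhds).mul_const s
  rw [zero_mul] at hlim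
  exact ge_of_tendsto hlim (by filter_upwards [self_mem_nhdsWithin] with ε hε using hle ε hε)

/-! ### Regularity of the charge density and continuity of the field. -/

section Density

variable {t Q : ℝ}

lemma rho_eq_setIntegral {τ : ℝ} {x : Space3} (hF : ∀ v, Q < ‖v‖ → F v = 0)
    (hf : ∀ v, Q < ‖v‖ → f τ x v = 0) :
    rho F f τ x = ∫ v in closedBall 0 Q, (F v - f τ x v) := by
  rw [rho, setIntegral_eq_integral_of_forall_compl_eq_zero]
  intro v hv
  have : Q < ‖v‖ := by simpa using hv
  rw [hF v this, hf v this, sub_zero]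

lemma IsSolution.continuous_velocity (hS : IsSolution F f₀ A T f) {τ : ℝ} (hτ : τ ∈ Ico 0 T)
    (x : Space3) : Continuous (fun v => f τ x v) := by
  rw [← continuousOn_univ]
  exact hS.contDiffOn.continuousOn.comp (f := fun v => (τ, x, v)) (by fun_prop)
    (fun v _ => ⟨hτ, trivial⟩)

lemma IsSolution.abs_rho_sub_le (hS : IsSolution F f₀ A T f) (hFc : Continuous F)
    (hF : ∀ v, Q < ‖v‖ → F v = 0) {τ : ℝ} (hτ : τ ∈ Ico 0 T)
    (hf : ∀ x v, Q < ‖v‖ → f τ x v = 0) {x x' : Space3} {η : ℝ}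
    (hη : ∀ v ∈ closedBall (0 : Space3) Q, |f τ x' v - f τ x v| ≤ η) :
    |rho F f τ x' - rho F f τ x| ≤ η * volume.real (closedBall (0 : Space3) Q) := by
  have hi : ∀ x, IntegrableOn (fun v => F v - f τ x v) (closedBall 0 Q) := fun x =>
    (hFc.sub (hS.continuous_velocity hτ x)).continuousOn.integrableOn_compact
      (isCompact_closedBall _ _)
  rw [rho_eq_setIntegral hF (hf x'), rho_eq_setIntegral hF (hf x), ← integral_sub (hi x') (hi x),
    ← Real.norm_eq_abs]
  refine norm_setIntegral_le_of_norm_le_const measure_closedBall_lt_top fun v hv => ?_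
  rw [sub_sub_sub_cancel_left, Real.norm_eq_abs, abs_sub_comm]
  exact hη v hv

lemma IsSolution.continuousOn_rho (hS : IsSolution F f₀ A T f) (ht : t < T) (hFc : Continuous F)
    (hF : ∀ v, Q < ‖v‖ → F v = 0) (hf : ∀ τ ∈ Icc 0 t, ∀ x v, Q < ‖v‖ → f τ x v = 0) :
    ContinuousOn (fun z : ℝ × Space3 => rho F f z.1 z.2) (Icc 0 t ×ˢ univ) := by
  unfold rho
  refine continuousOn_integral_of_compact_support (isCompact_closedBall (0 : Space3) Q) ?_ ?_
  · have h1 : ContinuousOn (fun z : (ℝ × Space3) × Space3 => f z.1.1 z.1.2 z.2)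
        ((Icc 0 t ×ˢ univ) ×ˢ univ) :=
      hS.contDiffOn.continuousOn.comp
        (f := fun z : (ℝ × Space3) × Space3 => (z.1.1, z.1.2, z.2)) (by fun_prop)
        (fun z hz => ⟨⟨hz.1.1.1, hz.1.1.2.trans_lt ht⟩, trivial⟩)
    exact (hFc.comp continuous_snd).continuousOn.sub h1
  · intro z v hz hv
    have : Q < ‖v‖ := by simpa using hv
    rw [hF v this, hf z.1 hz.1 z.2 v this, sub_zero]

/-- This constant depends on the solution. It serves only to make the force locally Lipschitz, so
that characteristics exist; the uniform constant comes from `IsSolution.lipschitz_bound`. -/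
lemma IsSolution.exists_local_lipschitz_rho (hS : IsSolution F f₀ A T f) (ht : t < T)
    (hFc : Continuous F) (hF : ∀ v, Q < ‖v‖ → F v = 0)
    (hf : ∀ τ ∈ Icc 0 t, ∀ x v, Q < ‖v‖ → f τ x v = 0) (r : ℝ) :
    ∃ L, 0 ≤ L ∧ ∀ τ ∈ Icc 0 t, ∀ y ∈ closedBall (0 : Space3) r, ∀ y' ∈ closedBall (0 : Space3) r,
      |rho F f τ y' - rho F f τ y| ≤ L * ‖y' - y‖ := by
  set C : Set (ℝ × Space3 × Space3) := Icc 0 t ×ˢ closedBall 0 r ×ˢ closedBall 0 Q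
  have hCc : IsCompact C :=
    isCompact_Icc.prod ((isCompact_closedBall _ _).prod (isCompact_closedBall _ _))
  have hCconv : Convex ℝ C :=
    (convex_Icc _ _).prod ((convex_closedBall _ _).prod (convex_closedBall _ _))
  have hCT : C ⊆ Ico 0 T ×ˢ univ := fun z hz => ⟨⟨hz.1.1, hz.1.2.trans_lt ht⟩, trivial⟩
  have hud : UniqueDiffOn ℝ (Ico 0 T ×ˢ (univ : Set (Space3 × Space3))) :=
    (uniqueDiffOn_Ico 0 T).prod uniqueDiffOn_univ
  obtain ⟨L, hL⟩ := hCc.exists_bound_of_continuousOn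
    ((hS.contDiffOn.continuousOn_fderivWithin hud le_rfl).mono hCT)
  refine ⟨max L 0 * volume.real (closedBall (0 : Space3) Q), by positivity,
    fun τ hτ y hy y' hy' => ?_⟩
  refine (hS.abs_rho_sub_le hFc hF ⟨hτ.1, hτ.2.trans_lt ht⟩ (hf τ hτ)
    (η := max L 0 * ‖y' - y‖) fun v hv => ?_).trans (le_of_eq (by ring))
  have := hCconv.norm_image_sub_le_of_norm_hasFDerivWithin_le
    (f := fun z : ℝ × Space3 × Space3 => f z.1 z.2.1 z.2.2)
    (fun z hz => (hS.hasFDerivWithinAt (hCT hz).1 z.2.1 z.2.2).mono hCT)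
    (fun z hz => (hL z hz).trans (le_max_left L 0))
    (show (τ, y, v) ∈ C from ⟨hτ, hy, hv⟩) (show (τ, y', v) ∈ C from ⟨hτ, hy', hv⟩)
  simpa [Prod.norm_def] using this

/-- The substitution `z = x - y` frees the singular kernel from the base point, and the slow
variation of the weight provides one dominating function near `x₀`. -/
lemma continuousOn_field {σ : ℝ → Space3 → ℝ} {p M : ℝ} (hp : 3 < p) (hM : 0 ≤ M)
    (hσ : ContinuousOn (fun z : ℝ × Space3 => σ z.1 z.2) (Icc 0 t ×ˢ univ))
    (hb : ∀ τ ∈ Icc 0 t, ∀ y, |σ τ y| ≤ M * R y ^ (-p)) :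
    ContinuousOn (fun z : ℝ × Space3 => field (σ z.1) z.2) (Icc 0 t ×ˢ univ) := by
  rintro ⟨τ₀, x₀⟩ hz₀
  simp only [field_eq_fieldReg, fieldReg_eq_integral_comp_sub]
  have hcs : ∀ τ ∈ Icc 0 t, Continuous (σ τ) := fun τ hτ => by
    rw [← continuousOn_univ]
    exact hσ.comp (f := fun y => (τ, y)) (by fun_prop) (fun y _ => ⟨hτ, trivial⟩)
  have hnear : ∀ᶠ z in 𝓝[Icc 0 t ×ˢ univ] (τ₀, x₀), ‖x₀ - z.2‖ < 1 / 2 := by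
    refine nhdsWithin_le_nhds ?_
    have : ContinuousAt (fun z : ℝ × Space3 => ‖x₀ - z.2‖) (τ₀, x₀) := by fun_prop
    exact this.eventually_lt_const (by simp)
  refine continuousWithinAt_of_dominated
    (bound := fun z => M * 2 ^ p * (R (x₀ - z) ^ (-p) * (‖z‖ ^ 2)⁻¹)) ?_ ?_ ?_ ?_
  · filter_upwards [self_mem_nhdsWithin] with z hz
    exact ((hcs z.1 hz.1).comp (continuous_const.sub continuous_id)).aestronglyMeasurable.smul
      (measurable_ker 0).aestronglyMeasurable
  · filter_upwards [self_mem_nhdsWithin, hnear] with z hz hzn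
    refine Eventually.of_forall fun y => ?_
    rw [norm_smul, Real.norm_eq_abs]
    have h1 : R (z.2 - y) ^ (-p) ≤ 2 ^ p * R (x₀ - y) ^ (-p) := by
      refine R_rpow_neg_le (by linarith) ?_
      rw [sub_sub_sub_cancel_right]
      have := one_le_R (x₀ - y)
      linarith
    calc |σ z.1 (z.2 - y)| * ‖ker 0 y‖ ≤ (M * (2 ^ p * R (x₀ - y) ^ (-p))) * (‖y‖ ^ 2)⁻¹ := by
          refine mul_le_mul ((hb z.1 hz.1 _).trans (by gcongr)) (norm_ker_le y) (norm_nonneg _) ?_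
          have := R_pos (x₀ - y)
          positivity
      _ = _ := by ring
  · have := ((integral_weight_inv_sq_le hp x₀).1.comp_sub_left x₀).const_mul (M * 2 ^ p)
    simpa using this
  · refine Eventually.of_forall fun y => ?_
    have h2 := (hσ (τ₀, x₀ - y) ⟨hz₀.1, trivial⟩)
    have h3 : ContinuousWithinAt (fun z : ℝ × Space3 => σ z.1 (z.2 - y)) (Icc 0 t ×ˢ univ)
        (τ₀, x₀) :=
      ContinuousWithinAt.comp (f := fun z : ℝ × Space3 => (z.1, z.2 - y))
        (g := fun z : ℝ × Space3 => σ z.1 z.2) h2 (by fun_prop)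
        (fun z hz => ⟨hz.1, trivial⟩)
    exact h3.smul continuousWithinAt_const

end Density

end Solution

/-! ### Existence and separation of characteristics. -/

section Characteristics

variable {H : ℝ → Space3 → Space3} {s t K : ℝ} {x v x' v' : Space3} {X V X' V' : ℝ → Space3}

lemma exists_isCharacteristic
    (hHc : ContinuousOn (fun z : ℝ × Space3 => H z.1 z.2) (Icc 0 t ×ˢ univ))
    (hK : ∀ τ ∈ Icc 0 t, ∀ y, ‖H τ y‖ ≤ K)
    (hL : ∀ r : ℝ, ∃ L, 0 ≤ L ∧ ∀ τ ∈ Icc 0 t, ∀ y ∈ closedBall (0 : Space3) r,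
      ∀ y' ∈ closedBall (0 : Space3) r, ‖H τ y' - H τ y‖ ≤ L * ‖y' - y‖)
    (hs : s ∈ Icc 0 t) (x v : Space3) : ∃ X V, IsCharacteristic H s x v X V := by
  have hs0 : 0 ≤ s := hs.1
  have hK0 : 0 ≤ K := (norm_nonneg _).trans (hK s hs 0)
  have hsub : ∀ {τ}, τ ∈ Icc 0 s → τ ∈ Icc 0 t := fun hτ => ⟨hτ.1, hτ.2.trans hs.2⟩
  -- Free streaming is removed: the first component stands for `X - (τ - s) V`. The resulting vector
  -- field is bounded by `(s + 1) K` whatever the velocity, so the ball of radius `a` lets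
  -- Picard–Lindelöf cover all of `[0, s]` at once.
  set g : ℝ → Space3 × Space3 → Space3 × Space3 := fun τ z =>
    ((τ - s) • H τ (z.1 + (τ - s) • z.2), -H τ (z.1 + (τ - s) • z.2)) with hg
  set Lb : ℝ≥0 := ⟨(s + 1) * K, by positivity⟩
  set a : ℝ≥0 := ⟨(s + 1) * K * s, by positivity⟩
  obtain ⟨L, hL0, hL⟩ := hL ((‖x‖ + a) + s * (‖v‖ + a))
  set Kl : ℝ≥0 := ⟨(s + 1) * (L * (1 + s)), by positivity⟩
  have habs : ∀ {τ}, τ ∈ Icc 0 s → |τ - s| ≤ s := fun hτ => by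
    rw [abs_le]
    constructor <;> linarith [hτ.1, hτ.2]
  have hpos : ∀ {τ}, τ ∈ Icc 0 s → ∀ z ∈ closedBall (x, v) (a : ℝ),
      z.1 + (τ - s) • z.2 ∈ closedBall (0 : Space3) ((‖x‖ + a) + s * (‖v‖ + a)) := by
    intro τ hτ z hz
    rw [mem_closedBall, dist_eq_norm, Prod.norm_def, sup_le_iff, Prod.fst_sub, Prod.snd_sub] at hz
    have h1 : ‖z.1‖ ≤ ‖x‖ + a := by
      have : ‖z.1‖ ≤ ‖x‖ + ‖z.1 - x‖ := by simpa using norm_add_le x (z.1 - x)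
      linarith [hz.1]
    have h2 : ‖z.2‖ ≤ ‖v‖ + a := by
      have : ‖z.2‖ ≤ ‖v‖ + ‖z.2 - v‖ := by simpa using norm_add_le v (z.2 - v)
      linarith [hz.2]
    rw [mem_closedBall_zero_iff]
    refine (norm_add_le _ _).trans (add_le_add h1 ?_)
    rw [norm_smul, Real.norm_eq_abs]
    exact mul_le_mul (habs hτ) h2 (norm_nonneg _) hs0
  have hpl : IsPicardLindelof g (tmin := 0) (tmax := s) ⟨s, hs0, le_rfl⟩ (x, v) a 0 Lb Kl := by
    refine ⟨fun τ hτ => ?_, fun z _ => ?_, fun τ hτ z _ => ?_, ?_⟩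
    · refine LipschitzOnWith.of_dist_le_mul fun z hz z' hz' => ?_
      rw [dist_eq_norm, dist_eq_norm]
      have h1 := hL τ (hsub hτ) _ (hpos hτ z' hz') _ (hpos hτ z hz)
      have h2 : ‖z.1 + (τ - s) • z.2 - (z'.1 + (τ - s) • z'.2)‖ ≤ (1 + s) * ‖z - z'‖ := by
        rw [show z.1 + (τ - s) • z.2 - (z'.1 + (τ - s) • z'.2)
          = (z - z').1 + (τ - s) • (z - z').2 by
            simp only [Prod.fst_sub, Prod.snd_sub, smul_sub]; abel]
        refine (norm_add_le _ _).trans ?_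
        rw [norm_smul, Real.norm_eq_abs, add_mul, one_mul]
        exact add_le_add (norm_fst_le _)
          (mul_le_mul (habs hτ) (norm_snd_le _) (norm_nonneg _) hs0)
      have h3 : ‖H τ (z.1 + (τ - s) • z.2) - H τ (z'.1 + (τ - s) • z'.2)‖
          ≤ L * (1 + s) * ‖z - z'‖ := by
        refine h1.trans ?_
        rw [mul_assoc]
        gcongr
      have h4 : 0 ≤ L * (1 + s) * ‖z - z'‖ := by positivity
      have e : (Kl : ℝ) * ‖z - z'‖ = s * (L * (1 + s) * ‖z - z'‖) + L * (1 + s) * ‖z - z'‖ := by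
        rw [show (Kl : ℝ) = (s + 1) * (L * (1 + s)) from rfl]
        ring
      rw [e, Prod.norm_def, sup_le_iff]
      constructor
      · simp only [hg, Prod.fst_sub, ← smul_sub, norm_smul, Real.norm_eq_abs]
        have := mul_le_mul (habs hτ) h3 (norm_nonneg _) hs0
        linarith
      · simp only [hg, Prod.snd_sub, neg_sub_neg]
        rw [norm_sub_rev]
        have : 0 ≤ s * (L * (1 + s) * ‖z - z'‖) := by positivity
        linarith
    · have hcH : ContinuousOn (fun τ => H τ (z.1 + (τ - s) • z.2)) (Icc 0 s) :=
        hHc.comp (f := fun τ : ℝ => (τ, z.1 + (τ - s) • z.2)) (by fun_prop)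
          (fun τ hτ => ⟨hsub hτ, trivial⟩)
      exact ((by fun_prop : ContinuousOn (fun τ : ℝ => τ - s) (Icc 0 s)).smul hcH).prodMk hcH.neg
    · have h1 := hK τ (hsub hτ) (z.1 + (τ - s) • z.2)
      have e : (Lb : ℝ) = s * K + K := by
        rw [show (Lb : ℝ) = (s + 1) * K from rfl]
        ring
      rw [e, Prod.norm_def, sup_le_iff]
      constructor
      · simp only [hg, norm_smul, Real.norm_eq_abs]
        have := mul_le_mul (habs hτ) h1 (norm_nonneg _) hs0
        linarith
      · simp only [hg, norm_neg]
        have : 0 ≤ s * K := by positivity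
        linarith
    · rw [show (Lb : ℝ) = (s + 1) * K from rfl, show (a : ℝ) = (s + 1) * K * s from rfl]
      simp [hs0]
  obtain ⟨α, hα, hα'⟩ := hpl.exists_eq_forall_mem_Icc_hasDerivWithinAt₀
  simp only at hα
  refine ⟨fun τ => (α τ).1 + (τ - s) • (α τ).2, fun τ => (α τ).2, ?_, ?_, fun τ hτ => ?_,
    fun τ hτ => ?_⟩
  · simp [hα]
  · simp [hα]
  · have h1 := (hasFDerivAt_fst (𝕜 := ℝ) (p := α τ)).comp_hasDerivWithinAt τ (hα' τ hτ)
    have h2 := (hasFDerivAt_snd (𝕜 := ℝ) (p := α τ)).comp_hasDerivWithinAt τ (hα' τ hτ)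
    have h3 := h1.add (((hasDerivWithinAt_id τ (Icc 0 s)).sub_const s).smul h2)
    refine h3.congr_deriv ?_
    simp [hg]
  · have h2 := (hasFDerivAt_snd (𝕜 := ℝ) (p := α τ)).comp_hasDerivWithinAt τ (hα' τ hτ)
    exact h2

/-- Grönwall estimate for the difference of two characteristics. -/
lemma IsCharacteristic.norm_sub_le (hc : IsCharacteristic H s x v X V)
    (hc' : IsCharacteristic H s x' v' X' V') {κ κI : ℝ → ℝ} {ε : ℝ} (hε : 0 < ε)
    (hκI : ∀ τ, HasDerivAt κI (κ τ) τ) (hκ : ∀ τ ∈ Icc 0 s, 1 < κ τ)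
    (hH : ∀ τ ∈ Icc 0 s, ‖H τ (X' τ) - H τ (X τ)‖
      < κ τ * (‖(X' τ - X τ, V' τ - V τ)‖ + ε)) :
    ∀ τ ∈ Icc 0 s, ‖(X' τ - X τ, V' τ - V τ)‖ + ε
      ≤ (‖(x' - x, v' - v)‖ + ε) * Real.exp (κI s - κI τ) := by
  have hrev : ∀ {σ}, σ ∈ Icc 0 s → s - σ ∈ Icc 0 s := fun hσ =>
    ⟨by linarith [hσ.2], by linarith [hσ.1]⟩
  set D := ‖(x' - x, v' - v)‖ + ε
  have hD : 0 < D := by positivity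
  -- Time is reversed: the end data sit at `s`, whereas the comparison principle runs forward.
  set g : ℝ → Space3 × Space3 := fun σ => (X' (s - σ) - X (s - σ), V' (s - σ) - V (s - σ))
  have hg' : ∀ σ ∈ Icc 0 s, HasDerivWithinAt g
      (-(V' (s - σ) - V (s - σ)), H (s - σ) (X' (s - σ)) - H (s - σ) (X (s - σ))) (Icc 0 s) σ := by
    intro σ hσ
    have hr : HasDerivWithinAt (fun σ : ℝ => s - σ) (-1) (Icc 0 s) σ :=
      (hasDerivWithinAt_id σ _).const_sub s
    have hm : MapsTo (fun σ : ℝ => s - σ) (Icc 0 s) (Icc 0 s) := fun σ hσ => hrev hσ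
    have h1 := ((hc'.deriv_X _ (hrev hσ)).sub (hc.deriv_X _ (hrev hσ))).scomp σ hr hm
    have h2 := ((hc'.deriv_V _ (hrev hσ)).sub (hc.deriv_V _ (hrev hσ))).scomp σ hr hm
    refine (h1.prodMk h2).congr_deriv ?_
    simp only [neg_smul, one_smul, neg_sub_neg, neg_sub]
  have hB' : ∀ σ, HasDerivAt (fun σ => D * Real.exp (κI s - κI (s - σ)) - ε)
      (κ (s - σ) * (D * Real.exp (κI s - κI (s - σ)))) σ := by
    intro σ
    have h1 : HasDerivAt (fun σ => κI (s - σ)) (-κ (s - σ)) σ :=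
      (hκI (s - σ)).comp_const_sub s σ
    have h2 := ((h1.const_sub (κI s)).exp.const_mul D).sub_const ε
    refine h2.congr_deriv ?_
    ring
  have key := image_norm_le_of_norm_deriv_right_lt_deriv_boundary (a := 0) (b := s) (f := g)
    (fun σ hσ => (hg' σ hσ).continuousWithinAt)
    (fun σ hσ => (hg' σ ⟨hσ.1, hσ.2.le⟩).mono_of_mem_nhdsWithin (Icc_mem_nhdsGE_of_mem hσ))
    (by simp [g, D, hc.X_end, hc.V_end, hc'.X_end, hc'.V_end]) hB' ?_
  · intro τ hτ
    have := key (hrev hτ)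
    simp only [g, sub_sub_cancel] at this
    linarith
  -- Strict inequality is required only where the curve meets the barrier. For the position
  -- component it comes from `1 < κ` and `ε > 0`.
  · intro σ hσ heq
    have hσ' : s - σ ∈ Icc 0 s := hrev ⟨hσ.1, hσ.2.le⟩
    have hBe : D * Real.exp (κI s - κI (s - σ)) = ‖g σ‖ + ε := by rw [heq]; ring
    rw [hBe, Prod.norm_def, sup_lt_iff]
    refine ⟨?_, hH _ hσ'⟩
    rw [norm_neg]
    have h1 : ‖V' (s - σ) - V (s - σ)‖ ≤ ‖g σ‖ := norm_snd_le (g σ)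
    have h2 : 0 ≤ ‖g σ‖ := norm_nonneg _
    have h3 := hκ _ hσ'
    nlinarith

end Characteristics

/-! ### The halving iteration and the a priori Lipschitz bound. -/

/-- The map `m ↦ a + m / 2` contracts to `2 * a`. This replaces the usual Grönwall argument when
only some finite initial bound is known and the best constant need not be regular in time. -/
lemma halving_iterate {P : ℝ → Prop} {a b : ℝ} (ha : 0 ≤ a) (hb : 0 ≤ b) (h0 : P (2 * a + b))
    (hstep : ∀ m, 0 ≤ m → P m → P (a + m / 2)) (n : ℕ) : P (2 * a + b / 2 ^ n) := by
  induction n with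
  | zero => simpa using h0
  | succ n ih =>
    have := hstep _ (by positivity) ih
    convert this using 1
    rw [pow_succ]
    field_simp
    ring

lemma tendsto_halving (a b : ℝ) : Tendsto (fun n : ℕ => 2 * a + b / 2 ^ n) atTop (𝓝 (2 * a)) := by
  have h : Tendsto (fun n : ℕ => b / 2 ^ n) atTop (𝓝 0) :=
    tendsto_const_nhds.div_atTop (tendsto_pow_atTop_atTop_of_one_lt (by norm_num))
  simpa using h.const_add (2 * a)

section Lipschitz

variable {F : Space3 → ℝ} {f₀ : Space3 → Space3 → ℝ} {A : ℝ → Space3 → Space3} {T t : ℝ}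
  {f : ℝ → Space3 → Space3 → ℝ}

/-- A priori Lipschitz bound: if the Lipschitz constant of the force depends logarithmically on
that of the density, the latter stays bounded. -/
lemma IsSolution.lipschitz_bound (hS : IsSolution F f₀ A T f) (ht0 : 0 ≤ t) (ht : t < T)
    {L₀ B₀ c₁ : ℝ} (hL₀ : 1 ≤ L₀)
    (hf₀ : ∀ x v x' v', |f₀ x' v' - f₀ x v| ≤ L₀ * ‖(x' - x, v' - v)‖)
    (hB₀ : ∀ x v, f₀ x v ≤ B₀) (hc₁ : 0 ≤ c₁)
    (hchar : ∀ s ∈ Icc 0 t, ∀ x v, ∃ X V, IsCharacteristic (force F f A) s x v X V)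
    (hH : ∀ τ ∈ Icc 0 t, ∀ Λ ε : ℝ, 2 ≤ Λ → 0 < ε →
      (∀ x x' v, |f τ x' v - f τ x v| ≤ Λ * (‖x' - x‖ + ε)) →
      ∀ y y', ‖force F f A τ y' - force F f A τ y‖ ≤ c₁ * (1 + Real.log Λ) * (‖y' - y‖ + ε)) :
    ∀ s ∈ Icc 0 t, ∀ x v x' v', |f s x' v' - f s x v| ≤
      Real.exp (1 + 2 * (Real.log L₀ + (2 * c₁ + 2) * t) * Real.exp (2 * (2 * c₁ + 2) * t))
        * ‖(x' - x, v' - v)‖ := by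
  set c := 2 * c₁ + 2 with hc
  have hc0 : 0 < c := by positivity
  set a := Real.log L₀ + c * t with ha_def
  have ha : 0 ≤ a := by have := Real.log_nonneg hL₀; positivity
  have hB0 : 0 ≤ B₀ := by
    have h1 := hS.nonneg 0 ⟨le_rfl, ht0.trans_lt ht⟩ 0 0
    rw [hS.initial] at h1
    exact h1.trans (hB₀ 0 0)
  have hT : ∀ {s}, s ∈ Icc 0 t → s ∈ Ico 0 T := fun hs => ⟨hs.1, hs.2.trans_lt ht⟩
  have hfB : ∀ s ∈ Icc 0 t, ∀ x v, f s x v ≤ B₀ := by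
    intro s hs x v
    obtain ⟨X, V, hXV⟩ := hchar s hs x v
    rw [hS.eq_initial (hT hs) hXV]
    exact hB₀ _ _
  have main : ∀ ε : ℝ, 0 < ε → ∀ s ∈ Icc 0 t, ∀ x v x' v', |f s x' v' - f s x v| ≤
      Real.exp (1 + 2 * a * Real.exp (2 * c * s)) * (‖(x' - x, v' - v)‖ + ε) := by
    intro ε hε
    -- The added `ε` makes the starting bound follow from `0 ≤ f ≤ B₀` alone. The exponent `m * exp
    -- (2 * c * s)` is the logarithm of a Lipschitz constant, on which the force estimate depends
    -- affinely.
    set P : ℝ → Prop := fun m => ∀ s ∈ Icc 0 t, ∀ x v x' v', |f s x' v' - f s x v| ≤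
      Real.exp (1 + m * Real.exp (2 * c * s)) * (‖(x' - x, v' - v)‖ + ε) with hP
    have hinit : P (2 * a + B₀ / ε) := by
      intro s hs x v x' v'
      have h1 : |f s x' v' - f s x v| ≤ B₀ := by
        rw [abs_le]
        have := hfB s hs x v
        have := hfB s hs x' v'
        have := hS.nonneg s (hT hs) x v
        have := hS.nonneg s (hT hs) x' v'
        constructor <;> linarith
      have h2 : B₀ / ε ≤ Real.exp (1 + (2 * a + B₀ / ε) * Real.exp (2 * c * s)) := by
        have h3 : 1 ≤ Real.exp (2 * c * s) := Real.one_le_exp (by have := hs.1; positivity)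
        have h4 : 2 * a + B₀ / ε ≤ (2 * a + B₀ / ε) * Real.exp (2 * c * s) :=
          le_mul_of_one_le_right (by positivity) h3
        have h5 := Real.add_one_le_exp (1 + (2 * a + B₀ / ε) * Real.exp (2 * c * s))
        linarith
      calc |f s x' v' - f s x v| ≤ B₀ := h1
        _ = B₀ / ε * ε := by field_simp
        _ ≤ _ := by
          gcongr
          linarith [norm_nonneg (x' - x, v' - v)]
    have hstep : ∀ m, 0 ≤ m → P m → P (a + m / 2) := by
      intro m hm hPm s hs x v x' v'
      obtain ⟨X, V, hXV⟩ := hchar s hs x v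
      obtain ⟨X', V', hXV'⟩ := hchar s hs x' v'
      -- Integrating `exp (2 * c * τ)` against the rate `c` produces the factor `1 / 2` of the
      -- iteration.
      have hκI : ∀ τ : ℝ, HasDerivAt (fun τ => c * τ + m / 2 * Real.exp (2 * c * τ))
          (c * (1 + m * Real.exp (2 * c * τ))) τ := by
        intro τ
        have h1 := ((hasDerivAt_id τ).const_mul (2 * c)).exp.const_mul (m / 2)
        have h2 := ((hasDerivAt_id τ).const_mul c).add h1
        refine h2.congr_deriv ?_
        simp
        ring
      have hlip := hXV.norm_sub_le hXV' hε hκI (fun τ _ => ?_) (fun τ hτ => ?_) 0 ⟨le_rfl, hs.1⟩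
      · rw [hS.eq_initial (hT hs) hXV, hS.eq_initial (hT hs) hXV']
        have hδ : 0 < ‖(x' - x, v' - v)‖ + ε := by positivity
        have hexp : L₀ * Real.exp (c * s + m / 2 * Real.exp (2 * c * s)
            - (c * 0 + m / 2 * Real.exp (2 * c * 0)))
            ≤ Real.exp (1 + (a + m / 2) * Real.exp (2 * c * s)) := by
          nth_rewrite 1 [← Real.exp_log (by linarith : 0 < L₀)]
          rw [← Real.exp_add]
          refine Real.exp_le_exp.2 ?_
          have h3 : 1 ≤ Real.exp (2 * c * s) := Real.one_le_exp (by have := hs.1; positivity)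
          have h4 : a ≤ a * Real.exp (2 * c * s) := le_mul_of_one_le_right ha h3
          have h5 : c * s ≤ c * t := mul_le_mul_of_nonneg_left hs.2 hc0.le
          simp only [mul_zero, Real.exp_zero, mul_one, zero_add]
          linarith
        calc |f₀ (X' 0) (V' 0) - f₀ (X 0) (V 0)|
            ≤ L₀ * ‖(X' 0 - X 0, V' 0 - V 0)‖ := hf₀ _ _ _ _
          _ ≤ L₀ * ((‖(x' - x, v' - v)‖ + ε) * Real.exp (c * s + m / 2 * Real.exp (2 * c * s)
            - (c * 0 + m / 2 * Real.exp (2 * c * 0)))) := by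
            gcongr
            linarith
          _ = L₀ * Real.exp (c * s + m / 2 * Real.exp (2 * c * s)
            - (c * 0 + m / 2 * Real.exp (2 * c * 0))) * (‖(x' - x, v' - v)‖ + ε) := by ring
          _ ≤ _ := by gcongr
      · have : 0 ≤ m * Real.exp (2 * c * τ) := by positivity
        nlinarith
      · have hτt : τ ∈ Icc 0 t := ⟨hτ.1, hτ.2.trans hs.2⟩
        set e := m * Real.exp (2 * c * τ) with he
        have he0 : 0 ≤ e := by positivity
        have h2 : (2 : ℝ) ≤ Real.exp (1 + e) := by
          have := Real.add_one_le_exp (1 + e)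
          linarith
        have h3 := hH τ hτt (Real.exp (1 + e)) ε h2 hε (fun y y' w => by
          simpa [Prod.norm_def] using hPm τ hτt y w y' w) (X τ) (X' τ)
        rw [Real.log_exp] at h3
        have h4 : ‖X' τ - X τ‖ ≤ ‖(X' τ - X τ, V' τ - V τ)‖ :=
          norm_fst_le (X' τ - X τ, V' τ - V τ)
        have h5 : 0 < ‖(X' τ - X τ, V' τ - V τ)‖ + ε := by positivity
        calc _ ≤ c₁ * (1 + (1 + e)) * (‖X' τ - X τ‖ + ε) := h3
          _ ≤ c₁ * (1 + (1 + e)) * (‖(X' τ - X τ, V' τ - V τ)‖ + ε) := by gcongr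
          _ < c * (1 + e) * (‖(X' τ - X τ, V' τ - V τ)‖ + ε) := by
            refine mul_lt_mul_of_pos_right ?_ h5
            rw [hc]
            nlinarith [mul_nonneg hc₁ he0]
    intro s hs x v x' v'
    have hall := halving_iterate ha (by positivity : 0 ≤ B₀ / ε) hinit hstep
    refine ge_of_tendsto' (((((tendsto_halving a (B₀ / ε)).mul_const _).const_add 1).rexp).mul_const _)
      (fun n => hall n s hs x v x' v')
  intro s hs x v x' v'
  have hlim : Tendsto (fun ε : ℝ => Real.exp (1 + 2 * a * Real.exp (2 * c * s))
      * (‖(x' - x, v' - v)‖ + ε)) (𝓝[>] 0)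
      (𝓝 (Real.exp (1 + 2 * a * Real.exp (2 * c * s)) * (‖(x' - x, v' - v)‖ + 0))) :=
    ((tendsto_id.mono_left nhdsWithin_le_nhds).const_add _).const_mul _
  rw [add_zero] at hlim
  refine (ge_of_tendsto hlim ?_).trans ?_
  · filter_upwards [self_mem_nhdsWithin] with ε hε using main ε hε s hs x v x' v'
  · gcongr
    exact hs.2

end Lipschitz

/-! ### Change of variables for maps close to the identity. -/

/-- The determinant near the identity is governed by the trace. -/
lemma abs_det_sub_one_le {D : Space3 →L[ℝ] Space3} {b : ℝ} (hb1 : b ≤ 1)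
    (hD : ‖D - ContinuousLinearMap.id ℝ Space3‖ ≤ b) :
    |D.det - 1| ≤ |∑ i, (D (coordVec i)) i - 3| + 12 * b ^ 2 := by
  have hb0 : 0 ≤ b := (norm_nonneg _).trans hD
  set B : Fin 3 → Fin 3 → ℝ := fun i j => (D (coordVec j) - coordVec j) i with hB
  have hBb : ∀ i j, |B i j| ≤ b := by
    intro i j
    have h1 : |B i j| ≤ ‖D (coordVec j) - coordVec j‖ :=
      PiLp.norm_apply_le (D (coordVec j) - coordVec j) i
    have h2 := (D - ContinuousLinearMap.id ℝ Space3).le_opNorm (coordVec j)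
    simp only [sub_apply, ContinuousLinearMap.id_apply, PiLp.norm_single, norm_one,
      mul_one] at h2
    exact h1.trans (h2.trans hD)
  have hdet : D.det = Matrix.det (Matrix.of fun i j => (if i = j then 1 else 0) + B i j) := by
    rw [ContinuousLinearMap.det,
      ← LinearMap.det_toMatrix (EuclideanSpace.basisFun (Fin 3) ℝ).toBasis]
    congr 1
    ext i j
    simp [LinearMap.toMatrix_apply, hB]
  have htr : ∑ i, (D (coordVec i)) i - 3 = B 0 0 + B 1 1 + B 2 2 := by
    simp [Fin.sum_univ_three, hB]
    ring
  rw [htr, hdet, Matrix.det_fin_three]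
  simp only [Matrix.of_apply, Fin.isValue, if_true, show (0 : Fin 3) ≠ 1 by decide,
    show (0 : Fin 3) ≠ 2 by decide,
    show (1 : Fin 3) ≠ 0 by decide, show (1 : Fin 3) ≠ 2 by decide, show (2 : Fin 3) ≠ 0 by decide,
    show (2 : Fin 3) ≠ 1 by decide, if_false, zero_add]
  have m2 : ∀ i j k l, |B i j * B k l| ≤ b ^ 2 := fun i j k l => by
    rw [abs_mul, sq]
    exact mul_le_mul (hBb i j) (hBb k l) (abs_nonneg _) hb0
  -- Since `b ≤ 1`, the six cubic terms of the determinant are also at most `b ^ 2`; with the six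
  -- quadratic ones they make the constant `12`.
  have m3 : ∀ i j k l m n, |B i j * B k l * B m n| ≤ b ^ 2 := fun i j k l m n => by
    rw [abs_mul]
    calc _ ≤ b ^ 2 * b := mul_le_mul (m2 i j k l) (hBb m n) (abs_nonneg _) (by positivity)
      _ ≤ b ^ 2 * 1 := by gcongr
      _ = b ^ 2 := mul_one _
  have q1 := abs_le.1 (m2 0 0 1 1)
  have q2 := abs_le.1 (m2 0 0 2 2)
  have q3 := abs_le.1 (m2 1 1 2 2)
  have q4 := abs_le.1 (m2 0 1 1 0)
  have q5 := abs_le.1 (m2 0 2 2 0)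
  have q6 := abs_le.1 (m2 1 2 2 1)
  have c1 := abs_le.1 (m3 0 0 1 1 2 2)
  have c2 := abs_le.1 (m3 0 0 1 2 2 1)
  have c3 := abs_le.1 (m3 0 1 1 0 2 2)
  have c4 := abs_le.1 (m3 0 1 1 2 2 0)
  have c5 := abs_le.1 (m3 0 2 1 0 2 1)
  have c6 := abs_le.1 (m3 0 2 1 1 2 0)
  have r1 := neg_abs_le (B 0 0 + B 1 1 + B 2 2)
  have r2 := le_abs_self (B 0 0 + B 1 1 + B 2 2)
  rw [abs_le]
  constructor <;> linarith

/-- Maps that are Lipschitz close to the identity send null sets to null sets. -/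
lemma exists_null_image_const : ∃ δ : ℝ, 0 < δ ∧ δ ≤ 1 / 2 ∧
    ∀ (s : Set Space3) (G : Space3 → Space3),
      (∀ v ∈ s, ∀ w ∈ s, ‖G v - G w - (v - w)‖ ≤ δ * ‖v - w‖) → volume s = 0 →
      volume (G '' s) = 0 := by
  have h := addHaar_image_le_mul_of_det_lt (volume : Measure Space3)
    (ContinuousLinearMap.id ℝ Space3) (m := 2) (by simp [ContinuousLinearMap.det])
  have h2 : ∀ᶠ δ in 𝓝[>] (0 : ℝ≥0), δ < 1 / 2 := by
    refine nhdsWithin_le_nhds ?_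
    exact gt_mem_nhds (by positivity)
  obtain ⟨δ, ⟨hδ, hδ2⟩, hδ0⟩ := ((h.and h2).and self_mem_nhdsWithin).exists
  refine ⟨δ, by exact_mod_cast hδ0, by exact_mod_cast hδ2.le, fun s G hG hs => ?_⟩
  have := hδ s G hG
  rw [hs, mul_zero] at this
  exact le_antisymm this zero_le

/-- A map close to the identity on a ball covers slightly smaller balls. -/
lemma closedBall_subset_image {G : Space3 → Space3} {Q W g c : ℝ} (hc : c ≤ 1 / 2)
    (hG : ∀ v ∈ ball (0 : Space3) Q, ∀ w ∈ ball (0 : Space3) Q,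
      ‖G v - G w - (v - w)‖ ≤ c * ‖v - w‖) (hW : 0 ≤ W)
    (hg : ‖G 0‖ ≤ g) (hQ : 2 * (W + g) < Q) : closedBall 0 W ⊆ G '' ball 0 Q := by
  have hg0 : 0 ≤ g := (norm_nonneg _).trans hg
  have happ : ApproximatesLinearOn G (ContinuousLinearMap.id ℝ Space3) (ball 0 Q) (1 / 2) := by
    intro v hv w hw
    refine (hG v hv w hw).trans ?_
    gcongr
    simpa using hc
  let inv : (ContinuousLinearMap.id ℝ Space3).NonlinearRightInverse :=
    { toFun := id, nnnorm := 1, bound' := by simp, right_inv' := by simp }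
  -- With deviation at most `1 / 2`, the image of a ball of radius `r` about `0` contains the ball
  -- of radius `r / 2` about `G 0`; `r = 2 * (W + g)` makes the latter reach all of `closedBall 0
  -- W`.
  have hsub : closedBall (0 : Space3) (2 * (W + g)) ⊆ ball 0 Q := closedBall_subset_ball hQ
  have h := happ.surjOn_closedBall_of_nonlinearRightInverse inv (by positivity) hsub
  intro w hw
  obtain ⟨v, hv, rfl⟩ := h (show w ∈ _ by
    rw [mem_closedBall, dist_eq_norm]
    have h1 : ‖w‖ ≤ W := by simpa using hw
    have h2 := norm_sub_le w (G 0)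
    simp only [inv, NNReal.coe_one, inv_one, NNReal.coe_div, NNReal.coe_ofNat]
    linarith)
  exact ⟨v, hsub hv, rfl⟩

/-- Comparison of `∫ F` and `∫ F ∘ G` for a map `G` close to the identity. -/
lemma abs_integral_sub_comp_le {δ : ℝ} (hδ2 : δ ≤ 1 / 2)
    (hδ : ∀ (s : Set Space3) (G : Space3 → Space3),
      (∀ v ∈ s, ∀ w ∈ s, ‖G v - G w - (v - w)‖ ≤ δ * ‖v - w‖) → volume s = 0 →
      volume (G '' s) = 0)
    {F : Space3 → ℝ} (hFc : Continuous F) {W Q BF J : ℝ} (hF0 : ∀ v, W < ‖v‖ → F v = 0)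
    (hBF : ∀ v, |F v| ≤ BF) {G : Space3 → Space3}
    (hG : ∀ v ∈ ball (0 : Space3) Q, ∀ w ∈ ball (0 : Space3) Q,
      ‖G v - G w - (v - w)‖ ≤ δ * ‖v - w‖)
    (hWQ : W < Q) (hcover : closedBall 0 W ⊆ G '' ball 0 Q)
    (hJ : ∀ v ∈ ball (0 : Space3) Q, ∀ D : Space3 →L[ℝ] Space3, HasFDerivAt G D v →
      |D.det - 1| ≤ J) :
    |∫ v in ball 0 Q, (F v - F (G v))| ≤ BF * J * volume.real (ball (0 : Space3) Q) := by
  set b : Set Space3 := ball 0 Q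
  have hlip : LipschitzOnWith 2 G b := by
    refine LipschitzOnWith.of_dist_le_mul fun v hv w hw => ?_
    rw [dist_eq_norm, dist_eq_norm]
    have h1 := hG v hv w hw
    have h2 : ‖G v - G w‖ ≤ ‖G v - G w - (v - w)‖ + ‖v - w‖ := by
      simpa using norm_add_le (G v - G w - (v - w)) (v - w)
    have h3 := norm_nonneg (v - w)
    simp only [NNReal.coe_ofNat]
    nlinarith
  -- Rademacher's theorem supplies the derivative; the exceptional set is enlarged to a measurable
  -- null set and removed.
  have hdiff : ∀ᵐ v, v ∈ b → DifferentiableAt ℝ G v := by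
    filter_upwards [hlip.ae_differentiableWithinAt_of_mem (μ := volume)] with v hv hvb
    exact (hv hvb).differentiableAt (isOpen_ball.mem_nhds hvb)
  set N : Set Space3 := toMeasurable volume {v | ¬(v ∈ b → DifferentiableAt ℝ G v)}
  have hN : volume N = 0 := by
    rw [measure_toMeasurable]
    exact hdiff
  set S : Set Space3 := b \ N
  have hSm : MeasurableSet S := measurableSet_ball.diff (measurableSet_toMeasurable _ _)
  have hSb : S ⊆ b := sdiff_subset
  have hSd : ∀ v ∈ S, HasFDerivAt G (fderiv ℝ G v) v := by
    intro v hv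
    have : ¬¬(v ∈ b → DifferentiableAt ℝ G v) := fun h => hv.2 (subset_toMeasurable _ _ h)
    exact (not_not.1 this hv.1).hasFDerivAt
  have hinj : InjOn G b := by
    intro v hv w hw h
    have h1 := hG v hv w hw
    rw [h, sub_self, zero_sub, norm_neg] at h1
    have h2 := norm_nonneg (v - w)
    have h3 : ‖v - w‖ = 0 := by nlinarith
    exact sub_eq_zero.1 (norm_eq_zero.1 h3)
  have hSae : (S : Set Space3) =ᵐ[volume] b :=
    sdiff_null_ae_eq_self hN
  -- The removed points have a null image by the choice of `δ`, so the image still covers the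
  -- support of `F` up to a null set.
  have hGS : (G '' S : Set Space3) =ᵐ[volume] (G '' b : Set Space3) := by
    have hnull : volume (G '' (b ∩ N)) = 0 :=
      hδ _ G (fun v hv w hw => hG v hv.1 w hw.1) (measure_mono_null inter_subset_right hN)
    have hunion : G '' b = G '' S ∪ G '' (b ∩ N) := by
      rw [← image_union, sdiff_union_inter]
    rw [hunion]
    exact (union_ae_eq_left_of_ae_eq_empty (ae_eq_empty.2 hnull)).symm
  have hFb : ∫ v in b, F v = ∫ v, F v := by
    refine setIntegral_eq_integral_of_forall_compl_eq_zero fun v hv => hF0 v ?_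
    have : Q ≤ ‖v‖ := by simpa [b] using hv
    linarith
  have hFG : ∫ v in G '' S, F v = ∫ v, F v := by
    rw [setIntegral_congr_set hGS]
    refine setIntegral_eq_integral_of_forall_compl_eq_zero fun v hv => hF0 v ?_
    by_contra h
    exact hv (hcover (by simpa using h))
  have hcv := integral_image_eq_integral_abs_det_fderiv_smul volume hSm
    (fun v hv => (hSd v hv).hasFDerivWithinAt) (hinj.mono hSb) F
  have hFi : ∀ s : Set Space3, IntegrableOn F s := fun s => by
    have : Integrable F := hFc.integrable_of_hasCompactSupport
      (HasCompactSupport.intro (isCompact_closedBall (0 : Space3) W) fun v hv =>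
        hF0 v (by simpa using hv))
    exact this.integrableOn
  have hcvi := (integrableOn_image_iff_integrableOn_abs_det_fderiv_smul volume hSm
    (fun v hv => (hSd v hv).hasFDerivWithinAt) (hinj.mono hSb) F).1 (hFi _)
  have hFGi : IntegrableOn (fun v => F (G v)) b := by
    refine IntegrableOn.of_bound measure_ball_lt_top ?_ BF (Eventually.of_forall fun v => hBF _)
    exact (hFc.comp_continuousOn hlip.continuousOn).aestronglyMeasurable measurableSet_ball
  have e : ∫ v in b, (F v - F (G v)) = ∫ v in S, (|(fderiv ℝ G v).det| - 1) * F (G v) := by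
    rw [integral_sub (hFi b) hFGi, hFb, ← hFG, hcv, ← setIntegral_congr_set hSae,
      ← integral_sub hcvi (hFGi.mono_set hSb)]
    congr 1
    ext1 v
    simp only [smul_eq_mul]
    ring
  rw [e, ← Real.norm_eq_abs]
  have hvol : volume.real S = volume.real b := measureReal_congr hSae
  rw [← hvol]
  refine norm_setIntegral_le_of_norm_le_const
    ((measure_mono hSb).trans_lt measure_ball_lt_top) fun v hv => ?_
  rw [norm_mul, Real.norm_eq_abs, Real.norm_eq_abs, mul_comm]
  have h1 := hJ v (hSb hv) _ (hSd v hv)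
  have h2 : |(|(fderiv ℝ G v).det| - 1)| ≤ J := by
    have := abs_abs_sub_abs_le (fderiv ℝ G v).det 1
    rw [abs_one] at this
    exact this.trans h1
  exact mul_le_mul (hBF _) h2 (abs_nonneg _) ((abs_nonneg _).trans (hBF 0))

/-! ### Dependence of the initial velocity on the final velocity. -/

section Jacobian

variable {H : ℝ → Space3 → Space3} {s t k rad : ℝ} {x v v' : Space3} {X V X' V' : ℝ → Space3}

lemma IsCharacteristic.continuousOn_X (hc : IsCharacteristic H s x v X V) :
    ContinuousOn X (Icc 0 s) := fun τ hτ => (hc.deriv_X τ hτ).continuousWithinAt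

/-- Displacement bound along characteristics. -/
lemma IsCharacteristic.norm_V_sub_le (hc : IsCharacteristic H s x v X V) {K : ℝ}
    (hK : ∀ τ ∈ Icc 0 s, ∀ y, ‖H τ y‖ ≤ K) {τ : ℝ} (hτ : τ ∈ Icc 0 s) :
    ‖V τ - v‖ ≤ K * s := by
  have hs0 : 0 ≤ s := hτ.1.trans hτ.2
  have hK0 : 0 ≤ K := (norm_nonneg _).trans (hK τ hτ 0)
  have h := (convex_Icc 0 s).norm_image_sub_le_of_norm_hasDerivWithin_le (C := K)
    (fun σ hσ => hc.deriv_V σ hσ) (fun σ hσ => by rw [norm_neg]; exact hK σ hσ _)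
    (⟨hs0, le_rfl⟩ : s ∈ Icc 0 s) hτ
  rw [hc.V_end, Real.norm_eq_abs] at h
  refine h.trans (mul_le_mul_of_nonneg_left ?_ hK0)
  rw [abs_le]
  constructor <;> linarith [hτ.1, hτ.2]

lemma IsCharacteristic.norm_X_sub_le (hc : IsCharacteristic H s x v X V) {K : ℝ}
    (hK : ∀ τ ∈ Icc 0 s, ∀ y, ‖H τ y‖ ≤ K) {τ : ℝ} (hτ : τ ∈ Icc 0 s) :
    ‖X τ - x‖ ≤ (‖v‖ + K * s) * s := by
  have hs0 : 0 ≤ s := hτ.1.trans hτ.2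
  have hK0 : 0 ≤ K := (norm_nonneg _).trans (hK τ hτ 0)
  have h := (convex_Icc 0 s).norm_image_sub_le_of_norm_hasDerivWithin_le (C := ‖v‖ + K * s)
    (fun σ hσ => hc.deriv_X σ hσ) (fun σ hσ => by
      have h1 := hc.norm_V_sub_le hK hσ
      have h2 : ‖V σ‖ ≤ ‖v‖ + ‖V σ - v‖ := by simpa using norm_add_le v (V σ - v)
      linarith)
    (⟨hs0, le_rfl⟩ : s ∈ Icc 0 s) hτ
  rw [hc.X_end, Real.norm_eq_abs] at h
  refine h.trans (mul_le_mul_of_nonneg_left ?_ (by positivity))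
  rw [abs_le]
  constructor <;> linarith [hτ.1, hτ.2]

lemma abs_sub_le_of_mem_Icc {τ : ℝ} (hτ : τ ∈ Icc 0 s) : |τ - s| ≤ s := by
  rw [abs_le]
  constructor <;> linarith [hτ.1, hτ.2]

/-- Two characteristics through the same point `x`, in a region where `H` is Lipschitz. -/
lemma IsCharacteristic.norm_sub_le_exp (hc : IsCharacteristic H s x v X V)
    (hc' : IsCharacteristic H s x v' X' V') (hst : s ≤ t) (hk1 : k ≤ 1)
    (hL : ∀ τ ∈ Icc 0 s, ∀ y ∈ closedBall x rad, ∀ y' ∈ closedBall x rad,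
      ‖H τ y' - H τ y‖ ≤ k * ‖y' - y‖)
    (hX : ∀ τ ∈ Icc 0 s, X τ ∈ closedBall x rad) (hX' : ∀ τ ∈ Icc 0 s, X' τ ∈ closedBall x rad)
    {τ : ℝ} (hτ : τ ∈ Icc 0 s) :
    ‖(X' τ - X τ, V' τ - V τ)‖ ≤ Real.exp (3 * t) * ‖v' - v‖ := by
  have main : ∀ ε : ℝ, 0 < ε → ‖(X' τ - X τ, V' τ - V τ)‖ ≤ Real.exp (3 * t) * (‖v' - v‖ + ε) := by
    intro ε hε
    have h := hc.norm_sub_le hc' (κ := fun _ => 3) (κI := fun τ => 3 * τ) hε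
      (fun τ => by simpa using (hasDerivAt_id τ).const_mul 3) (fun _ _ => by norm_num)
      (fun τ hτ => ?_) τ hτ
    · have h2 : Real.exp (3 * s - 3 * τ) ≤ Real.exp (3 * t) :=
        Real.exp_le_exp.2 (by linarith [hτ.1])
      have h3 : ‖(x - x, v' - v)‖ = ‖v' - v‖ := by simp [Prod.norm_def]
      rw [h3] at h
      calc _ ≤ (‖v' - v‖ + ε) * Real.exp (3 * s - 3 * τ) := by linarith
        _ ≤ (‖v' - v‖ + ε) * Real.exp (3 * t) := by gcongr
        _ = _ := mul_comm _ _
    · have h1 := hL τ hτ _ (hX τ hτ) _ (hX' τ hτ)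
      have h2 : ‖X' τ - X τ‖ ≤ ‖(X' τ - X τ, V' τ - V τ)‖ :=
        norm_fst_le (X' τ - X τ, V' τ - V τ)
      have h3 := norm_nonneg (X' τ - X τ)
      nlinarith
  have hlim : Tendsto (fun ε : ℝ => Real.exp (3 * t) * (‖v' - v‖ + ε)) (𝓝[>] 0)
      (𝓝 (Real.exp (3 * t) * (‖v' - v‖ + 0))) :=
    ((tendsto_id.mono_left nhdsWithin_le_nhds).const_add _).const_mul _
  rw [add_zero] at hlim
  exact ge_of_tendsto hlim (by filter_upwards [self_mem_nhdsWithin] with ε hε using main ε hε)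

/-- Integrating the difference of the forces back from `s` gains a factor `k` over the exponential
bound. -/
lemma IsCharacteristic.norm_V_diff_le (hc : IsCharacteristic H s x v X V)
    (hc' : IsCharacteristic H s x v' X' V') (hst : s ≤ t) (hk0 : 0 ≤ k) (hk1 : k ≤ 1)
    (hL : ∀ τ ∈ Icc 0 s, ∀ y ∈ closedBall x rad, ∀ y' ∈ closedBall x rad,
      ‖H τ y' - H τ y‖ ≤ k * ‖y' - y‖)
    (hX : ∀ τ ∈ Icc 0 s, X τ ∈ closedBall x rad) (hX' : ∀ τ ∈ Icc 0 s, X' τ ∈ closedBall x rad)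
    {τ : ℝ} (hτ : τ ∈ Icc 0 s) :
    ‖V' τ - V τ - (v' - v)‖ ≤ k * t * Real.exp (3 * t) * ‖v' - v‖ := by
  have hs0 : 0 ≤ s := hτ.1.trans hτ.2
  have h := (convex_Icc 0 s).norm_image_sub_le_of_norm_hasDerivWithin_le
    (C := k * (Real.exp (3 * t) * ‖v' - v‖))
    (fun σ hσ => (hc'.deriv_V σ hσ).sub (hc.deriv_V σ hσ)) (fun σ hσ => by
      rw [neg_sub_neg, norm_sub_rev]
      refine (hL σ hσ _ (hX σ hσ) _ (hX' σ hσ)).trans (mul_le_mul_of_nonneg_left ?_ hk0)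
      exact (norm_fst_le (X' σ - X σ, V' σ - V σ)).trans
        (hc.norm_sub_le_exp hc' hst hk1 hL hX hX' hσ))
    (⟨hs0, le_rfl⟩ : s ∈ Icc 0 s) hτ
  simp only [Pi.sub_apply, hc.V_end, hc'.V_end, Real.norm_eq_abs] at h
  refine h.trans ?_
  calc _ ≤ k * (Real.exp (3 * t) * ‖v' - v‖) * t := by
        gcongr
        exact (abs_sub_le_of_mem_Icc hτ).trans hst
    _ = _ := by ring

/-- One more integration: the separation of positions differs from free streaming only at order `k`.
A further Lipschitz factor makes the remainder of the expansion of `V 0` quadratic in `k`. -/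
lemma IsCharacteristic.norm_X_diff_le (hc : IsCharacteristic H s x v X V)
    (hc' : IsCharacteristic H s x v' X' V') (hst : s ≤ t) (hk0 : 0 ≤ k) (hk1 : k ≤ 1)
    (hL : ∀ τ ∈ Icc 0 s, ∀ y ∈ closedBall x rad, ∀ y' ∈ closedBall x rad,
      ‖H τ y' - H τ y‖ ≤ k * ‖y' - y‖)
    (hX : ∀ τ ∈ Icc 0 s, X τ ∈ closedBall x rad) (hX' : ∀ τ ∈ Icc 0 s, X' τ ∈ closedBall x rad)
    {τ : ℝ} (hτ : τ ∈ Icc 0 s) :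
    ‖X' τ - X τ - (τ - s) • (v' - v)‖ ≤ k * t ^ 2 * Real.exp (3 * t) * ‖v' - v‖ := by
  have hs0 : 0 ≤ s := hτ.1.trans hτ.2
  have ht0 : 0 ≤ t := hs0.trans hst
  have h := (convex_Icc 0 s).norm_image_sub_le_of_norm_hasDerivWithin_le
    (f := fun σ => X' σ - X σ - (σ - s) • (v' - v))
    (f' := fun σ => V' σ - V σ - (v' - v))
    (C := k * t * Real.exp (3 * t) * ‖v' - v‖)
    (fun σ hσ => by
      have h1 := ((hasDerivWithinAt_id σ (Icc 0 s)).sub_const s).smul_const (v' - v)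
      rw [one_smul] at h1
      exact ((hc'.deriv_X σ hσ).sub (hc.deriv_X σ hσ)).sub h1)
    (fun σ hσ => hc.norm_V_diff_le hc' hst hk0 hk1 hL hX hX' hσ)
    (⟨hs0, le_rfl⟩ : s ∈ Icc 0 s) hτ
  simp only [hc.X_end, hc'.X_end, sub_self, zero_smul, sub_zero, Real.norm_eq_abs] at h
  refine h.trans ?_
  calc _ ≤ k * t * Real.exp (3 * t) * ‖v' - v‖ * t := by
        gcongr
        exact (abs_sub_le_of_mem_Icc hτ).trans hst
    _ = _ := by ring

lemma IsCharacteristic.continuousOn_force_shift (hc : IsCharacteristic H s x v X V)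
    (hHc : ContinuousOn (fun z : ℝ × Space3 => H z.1 z.2) (Icc 0 s ×ˢ univ)) (a : Space3) :
    ContinuousOn (fun τ => H τ (X τ + (τ - s) • a)) (Icc 0 s) := by
  refine hHc.comp (f := fun τ : ℝ => (τ, X τ + (τ - s) • a)) ?_ (fun τ hτ => ⟨hτ, trivial⟩)
  exact continuousOn_id.prodMk (hc.continuousOn_X.add (by fun_prop))

lemma IsCharacteristic.continuousOn_force (hc : IsCharacteristic H s x v X V)
    (hHc : ContinuousOn (fun z : ℝ × Space3 => H z.1 z.2) (Icc 0 s ×ˢ univ)) :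
    ContinuousOn (fun τ => H τ (X τ)) (Icc 0 s) := by
  simpa using hc.continuousOn_force_shift hHc 0

lemma IsCharacteristic.V_zero_eq (hc : IsCharacteristic H s x v X V) (hs : 0 ≤ s)
    (hHc : ContinuousOn (fun z : ℝ × Space3 => H z.1 z.2) (Icc 0 s ×ˢ univ)) :
    V 0 = v + ∫ τ in 0..s, H τ (X τ) := by
  have h := intervalIntegral.integral_eq_sub_of_hasDeriv_right_of_le hs
    (f := fun τ => V τ) (f' := fun τ => -H τ (X τ))
    (fun τ hτ => (hc.deriv_V τ hτ).continuousWithinAt)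
    (fun τ hτ => (hc.deriv_V τ ⟨hτ.1.le, hτ.2.le⟩).mono_of_mem_nhdsWithin
      (mem_of_superset (Icc_mem_nhdsGT_of_mem ⟨hτ.1.le, hτ.2⟩) subset_rfl))
    ((hc.continuousOn_force hHc).neg.intervalIntegrable_of_Icc hs)
  rw [intervalIntegral.integral_neg, hc.V_end] at h
  rw [← sub_eq_iff_eq_add', ← neg_inj, h]
  abel

/-- First order expansion of the initial velocity in the final velocity. -/
lemma IsCharacteristic.norm_V_zero_expansion_le (hc : IsCharacteristic H s x v X V)
    (hc' : IsCharacteristic H s x v' X' V') (hs : 0 ≤ s) (hst : s ≤ t) (hk0 : 0 ≤ k) (hk1 : k ≤ 1)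
    (hHc : ContinuousOn (fun z : ℝ × Space3 => H z.1 z.2) (Icc 0 s ×ˢ univ))
    (hL : ∀ τ ∈ Icc 0 s, ∀ y ∈ closedBall x rad, ∀ y' ∈ closedBall x rad,
      ‖H τ y' - H τ y‖ ≤ k * ‖y' - y‖)
    (hX : ∀ τ ∈ Icc 0 s, X τ ∈ closedBall x (rad / 2))
    (hX' : ∀ τ ∈ Icc 0 s, X' τ ∈ closedBall x (rad / 2)) (hsmall : t * ‖v' - v‖ ≤ rad / 2) :
    ‖V' 0 - V 0 - (v' - v) - ∫ τ in 0..s, (H τ (X τ + (τ - s) • (v' - v)) - H τ (X τ))‖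
      ≤ k ^ 2 * t ^ 3 * Real.exp (3 * t) * ‖v' - v‖ := by
  have ht0 : 0 ≤ t := hs.trans hst
  have hrad : 0 ≤ rad / 2 := (mul_nonneg ht0 (norm_nonneg _)).trans hsmall
  have hsub : closedBall x (rad / 2) ⊆ closedBall x rad := closedBall_subset_closedBall (by linarith)
  have i1 := (hc.continuousOn_force hHc).intervalIntegrable_of_Icc (μ := volume) hs
  have i2 := (hc'.continuousOn_force hHc).intervalIntegrable_of_Icc (μ := volume) hs
  have i3 := (hc.continuousOn_force_shift hHc (v' - v)).intervalIntegrable_of_Icc (μ := volume) hs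
  have e : V' 0 - V 0 - (v' - v) - ∫ τ in 0..s, (H τ (X τ + (τ - s) • (v' - v)) - H τ (X τ))
      = ∫ τ in 0..s, (H τ (X' τ) - H τ (X τ + (τ - s) • (v' - v))) := by
    rw [hc.V_zero_eq hs hHc, hc'.V_zero_eq hs hHc, intervalIntegral.integral_sub i3 i1,
      intervalIntegral.integral_sub i2 i3]
    abel
  rw [e]
  have hb : ∀ τ ∈ uIoc 0 s, ‖H τ (X' τ) - H τ (X τ + (τ - s) • (v' - v))‖
      ≤ k * (k * t ^ 2 * Real.exp (3 * t) * ‖v' - v‖) := by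
    intro τ hτ
    rw [uIoc_of_le hs] at hτ
    have hτ' : τ ∈ Icc 0 s := ⟨hτ.1.le, hτ.2⟩
    have hmem : X τ + (τ - s) • (v' - v) ∈ closedBall x rad := by
      rw [mem_closedBall, dist_eq_norm,
        show X τ + (τ - s) • (v' - v) - x = (X τ - x) + (τ - s) • (v' - v) by abel]
      have h1 : ‖X τ - x‖ ≤ rad / 2 := by simpa [dist_eq_norm] using hX τ hτ'
      have h2 : ‖(τ - s) • (v' - v)‖ ≤ rad / 2 := by
        rw [norm_smul, Real.norm_eq_abs]
        refine le_trans ?_ hsmall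
        gcongr
        exact (abs_sub_le_of_mem_Icc hτ').trans hst
      linarith [norm_add_le (X τ - x) ((τ - s) • (v' - v))]
    refine (hL τ hτ' _ hmem _ (hsub (hX' τ hτ'))).trans (mul_le_mul_of_nonneg_left ?_ hk0)
    rw [← sub_sub]
    exact hc.norm_X_diff_le hc' hst hk0 hk1 hL (fun σ hσ => hsub (hX σ hσ))
      (fun σ hσ => hsub (hX' σ hσ)) hτ'
  refine (intervalIntegral.norm_integral_le_of_norm_le_const hb).trans ?_
  rw [sub_zero, abs_of_nonneg hs]
  calc _ ≤ k * (k * t ^ 2 * Real.exp (3 * t) * ‖v' - v‖) * t := by gcongr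
    _ = _ := by ring

lemma tendsto_divQuot_of_hasFDerivAt {G : Space3 → Space3} {D : Space3 →L[ℝ] Space3} {v : Space3}
    (hD : HasFDerivAt G D v) :
    Tendsto (divQuot G v) (𝓝[≠] 0) (𝓝 (∑ i, (D (coordVec i)) i)) := by
  unfold divQuot
  refine tendsto_finsetSum _ fun i _ => ?_
  have hline : HasDerivAt (fun h : ℝ => v + h • coordVec i) (coordVec i) 0 := by
    simpa using ((hasDerivAt_id (0 : ℝ)).smul_const (coordVec i)).const_add v
  have h1 : HasDerivAt (fun h : ℝ => G (v + h • coordVec i)) (D (coordVec i)) 0 := by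
    have hD' : HasFDerivAt G D (v + (0 : ℝ) • coordVec i) := by simpa using hD
    exact hD'.comp_hasDerivAt (0 : ℝ) hline
  have h2 : HasDerivAt (fun h : ℝ => G (v + h • coordVec i) i) (D (coordVec i) i) 0 :=
    (EuclideanSpace.proj (𝕜 := ℝ) i).hasFDerivAt.comp_hasDerivAt (0 : ℝ) h1
  refine (hasDerivAt_iff_tendsto_slope_zero.1 h2).congr fun h => ?_
  simp [div_eq_inv_mul]

/-- The trace of the derivative of the initial velocity with respect to the final velocity. -/
lemma abs_trace_sub_le {Xf Vf : Space3 → ℝ → Space3} {Q : ℝ}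
    (hchar : ∀ w ∈ ball (0 : Space3) Q, IsCharacteristic H s x w (Xf w) (Vf w))
    (hs : 0 ≤ s) (hst : s ≤ t) (hrad : 0 < rad) (hk0 : 0 ≤ k) (hk1 : k ≤ 1)
    (hHc : ContinuousOn (fun z : ℝ × Space3 => H z.1 z.2) (Icc 0 s ×ˢ univ))
    (hL : ∀ τ ∈ Icc 0 s, ∀ y ∈ closedBall x rad, ∀ y' ∈ closedBall x rad,
      ‖H τ y' - H τ y‖ ≤ k * ‖y' - y‖)
    (hX : ∀ w ∈ ball (0 : Space3) Q, ∀ τ ∈ Icc 0 s, Xf w τ ∈ closedBall x (rad / 2))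
    (hv : v ∈ ball (0 : Space3) Q) {ℓ r : ℝ → ℝ}
    (hdiv : ∀ τ ∈ Icc 0 s, Tendsto (divQuot (H τ) (Xf v τ)) (𝓝[≠] 0) (𝓝 (ℓ τ)))
    (hℓ : ∀ τ ∈ Icc 0 s, |ℓ τ| ≤ r τ) (hr : Continuous r)
    {D : Space3 →L[ℝ] Space3} (hD : HasFDerivAt (fun w => Vf w 0) D v) :
    |∑ i, (D (coordVec i)) i - 3|
      ≤ 3 * (k ^ 2 * t ^ 3 * Real.exp (3 * t)) + t * ∫ τ in 0..s, r τ := by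
  have ht0 : 0 ≤ t := hs.trans hst
  have hc := hchar v hv
  -- A quotient in the final velocity with increment `h` becomes a position quotient of `H` with
  -- increment `(τ - s) * h`. Convergence of `divQuot` thus suffices, without a derivative of `H`.
  set φ : ℝ → ℝ → ℝ := fun h τ =>
    ∑ i : Fin 3, (H τ (Xf v τ + (τ - s) • (h • coordVec i)) i - H τ (Xf v τ) i) / h with hφ
  have hφdiv : ∀ h τ, φ h τ = (τ - s) * divQuot (H τ) (Xf v τ) ((τ - s) * h) := by
    intro h τ
    simp only [hφ, divQuot, Finset.mul_sum]
    refine Finset.sum_congr rfl fun i _ => ?_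
    rw [smul_smul]
    rcases eq_or_ne (τ - s) 0 with h0 | h0
    · simp [h0]
    · rcases eq_or_ne h 0 with rfl | hh
      · simp
      · field_simp
  have hcφ : ∀ h, ContinuousOn (φ h) (Icc 0 s) := by
    intro h
    refine continuousOn_finsetSum _ fun i _ => ?_
    refine ContinuousOn.div_const ?_ h
    have hproj : Continuous fun z : Space3 => z i := by fun_prop
    exact (hproj.comp_continuousOn (hc.continuousOn_force_shift hHc _)).sub
      (hproj.comp_continuousOn (hc.continuousOn_force hHc))
  have h_int : Tendsto (fun h => ∫ τ in 0..s, φ h τ) (𝓝[≠] 0) (𝓝 (∫ τ in 0..s, (τ - s) * ℓ τ)) := by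
    have hsm : ∀ᶠ h in 𝓝[≠] (0 : ℝ), t * |h| < rad / 2 := by
      refine nhdsWithin_le_nhds ?_
      have : ContinuousAt (fun h : ℝ => t * |h|) 0 := by fun_prop
      exact this.eventually_lt_const (by simpa using hrad)
    refine intervalIntegral.tendsto_integral_filter_of_dominated_convergence (fun _ => t * (3 * k))
      ?_ ?_ (by simp) ?_
    · refine Eventually.of_forall fun h => ?_
      rw [uIoc_of_le hs]
      exact ((hcφ h).mono Ioc_subset_Icc_self).aestronglyMeasurable measurableSet_Ioc
    · filter_upwards [hsm] with h hh
      refine Eventually.of_forall fun τ hτ => ?_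
      rw [uIoc_of_le hs] at hτ
      have hτ' : τ ∈ Icc 0 s := ⟨hτ.1.le, hτ.2⟩
      have habs := (abs_sub_le_of_mem_Icc hτ').trans hst
      rw [hφdiv, norm_mul, Real.norm_eq_abs, Real.norm_eq_abs]
      refine mul_le_mul habs ?_ (abs_nonneg _) ht0
      refine abs_divQuot_le (fun i => ?_) hk0
      have hn : ‖((τ - s) * h) • coordVec i‖ = |(τ - s) * h| := by simp [norm_smul]
      have h1 : ‖Xf v τ - x‖ ≤ rad / 2 := by simpa [dist_eq_norm] using hX v hv τ hτ'
      have h2 : |(τ - s) * h| ≤ rad / 2 := by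
        rw [abs_mul]
        exact (mul_le_mul_of_nonneg_right habs (abs_nonneg h)).trans hh.le
      refine (hL τ hτ' _ ?_ _ ?_).trans (le_of_eq ?_)
      · rw [mem_closedBall, dist_eq_norm]
        linarith
      · rw [mem_closedBall, dist_eq_norm, show Xf v τ + ((τ - s) * h) • coordVec i - x
          = (Xf v τ - x) + ((τ - s) * h) • coordVec i by abel]
        linarith [norm_add_le (Xf v τ - x) (((τ - s) * h) • coordVec i)]
      · rw [add_sub_cancel_left, hn]
    -- At `τ = s` the increment `(τ - s) * h` vanishes and leaves the punctured neighbourhood; a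
    -- single time is negligible.
    · have hne : ∀ᵐ τ : ℝ, τ ≠ s := by
        have : volume ({s} : Set ℝ) = 0 := by simp
        filter_upwards [measure_eq_zero_iff_ae_notMem.1 this] with τ hτ using hτ
      filter_upwards [hne] with τ hτs hτ
      rw [uIoc_of_le hs] at hτ
      have hτ' : τ ∈ Icc 0 s := ⟨hτ.1.le, hτ.2⟩
      simp only [hφdiv]
      refine Tendsto.const_mul _ ((hdiv τ hτ').comp ?_)
      have h0 : τ - s ≠ 0 := sub_ne_zero.2 hτs
      refine tendsto_nhdsWithin_iff.2 ⟨?_, ?_⟩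
      · have : Tendsto (fun h : ℝ => (τ - s) * h) (𝓝 0) (𝓝 ((τ - s) * 0)) :=
          tendsto_id.const_mul _
        rw [mul_zero] at this
        exact this.mono_left nhdsWithin_le_nhds
      · filter_upwards [self_mem_nhdsWithin] with h hh
        exact mul_ne_zero h0 hh
  have hquot : ∀ᶠ h in 𝓝[≠] (0 : ℝ), |divQuot (fun w => Vf w 0) v h - 3 - ∫ τ in 0..s, φ h τ|
      ≤ 3 * (k ^ 2 * t ^ 3 * Real.exp (3 * t)) := by
    have hsm : ∀ᶠ h in 𝓝[≠] (0 : ℝ), t * |h| < rad / 2 := by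
      refine nhdsWithin_le_nhds ?_
      have : ContinuousAt (fun h : ℝ => t * |h|) 0 := by fun_prop
      exact this.eventually_lt_const (by simpa using hrad)
    have hin : ∀ᶠ h in 𝓝[≠] (0 : ℝ), ∀ i, v + h • coordVec i ∈ ball (0 : Space3) Q := by
      refine nhdsWithin_le_nhds (eventually_all.2 fun i => ?_)
      have : ContinuousAt (fun h : ℝ => v + h • coordVec i) 0 := by fun_prop
      exact this.eventually_mem (isOpen_ball.mem_nhds (by simpa using hv))
    filter_upwards [hsm, hin, self_mem_nhdsWithin] with h h1 h2 h3
    have h3' : h ≠ 0 := h3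
    have hexp : ∀ i, ‖Vf (v + h • coordVec i) 0 - Vf v 0 - h • coordVec i
        - ∫ τ in 0..s, (H τ (Xf v τ + (τ - s) • (h • coordVec i)) - H τ (Xf v τ))‖
        ≤ k ^ 2 * t ^ 3 * Real.exp (3 * t) * |h| := by
      intro i
      have hn : ‖h • coordVec i‖ = |h| := by simp [norm_smul]
      have := hc.norm_V_zero_expansion_le (hchar _ (h2 i)) hs hst hk0 hk1 hHc hL (hX v hv)
        (hX _ (h2 i)) (by rw [add_sub_cancel_left, hn]; exact h1.le)
      rwa [add_sub_cancel_left, hn] at this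
    have hii : ∀ i : Fin 3, IntervalIntegrable
        (fun τ => H τ (Xf v τ + (τ - s) • (h • coordVec i)) - H τ (Xf v τ)) volume 0 s := fun i =>
      ((hc.continuousOn_force_shift hHc _).sub (hc.continuousOn_force hHc)).intervalIntegrable_of_Icc
        hs
    have hcoord : ∀ i : Fin 3, (∫ τ in 0..s,
        (H τ (Xf v τ + (τ - s) • (h • coordVec i)) - H τ (Xf v τ))) i
        = ∫ τ in 0..s, (H τ (Xf v τ + (τ - s) • (h • coordVec i)) i - H τ (Xf v τ) i) := by
      intro i
      have := (EuclideanSpace.proj (𝕜 := ℝ) i).intervalIntegral_comp_comm (hii i)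
      simpa using this.symm
    have e : divQuot (fun w => Vf w 0) v h - 3 - ∫ τ in 0..s, φ h τ
        = ∑ i : Fin 3, (Vf (v + h • coordVec i) 0 - Vf v 0 - h • coordVec i
        - ∫ τ in 0..s, (H τ (Xf v τ + (τ - s) • (h • coordVec i)) - H τ (Xf v τ))) i / h := by
      have e1 : ∫ τ in 0..s, φ h τ = ∑ i : Fin 3, (∫ τ in 0..s,
          (H τ (Xf v τ + (τ - s) • (h • coordVec i)) - H τ (Xf v τ))) i / h := by
        simp only [hφ]
        rw [intervalIntegral.integral_finsetSum]
        · refine Finset.sum_congr rfl fun i _ => ?_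
          rw [intervalIntegral.integral_div, hcoord]
        · intro i _
          have := (EuclideanSpace.proj (𝕜 := ℝ) i).integrable_comp (hii i).1
          refine IntervalIntegrable.div_const ?_ h
          rw [intervalIntegrable_iff_integrableOn_Ioc_of_le hs]
          simpa [IntegrableOn] using this
      have e2 : (3 : ℝ) = ∑ i : Fin 3, (h • coordVec i) i / h := by
        simp [h3']
      rw [e1, e2, divQuot, ← Finset.sum_sub_distrib, ← Finset.sum_sub_distrib]
      refine Finset.sum_congr rfl fun i _ => ?_
      simp only [PiLp.sub_apply]
      ring
    rw [e]
    refine (Finset.abs_sum_le_sum_abs _ _).trans ?_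
    have hterm : ∀ i ∈ (Finset.univ : Finset (Fin 3)),
        |(Vf (v + h • coordVec i) 0 - Vf v 0 - h • coordVec i
        - ∫ τ in 0..s, (H τ (Xf v τ + (τ - s) • (h • coordVec i)) - H τ (Xf v τ))) i / h|
        ≤ k ^ 2 * t ^ 3 * Real.exp (3 * t) := by
      intro i _
      rw [abs_div]
      refine div_le_of_le_mul₀ (abs_nonneg _) (by positivity) ?_
      exact (PiLp.norm_apply_le _ i).trans (hexp i)
    refine (Finset.sum_le_sum hterm).trans ?_
    simp
  have hlim := ((tendsto_divQuot_of_hasFDerivAt hD).sub_const 3).sub h_int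
  have h1 := le_of_tendsto hlim.abs hquot
  have h2 : |∫ τ in 0..s, (τ - s) * ℓ τ| ≤ t * ∫ τ in 0..s, r τ := by
    rw [← intervalIntegral.integral_const_mul, ← Real.norm_eq_abs]
    refine intervalIntegral.norm_integral_le_of_norm_le hs ?_ ((hr.intervalIntegrable 0 s).const_mul t)
    refine Eventually.of_forall fun τ hτ => ?_
    have hτ' : τ ∈ Icc 0 s := ⟨hτ.1.le, hτ.2⟩
    rw [norm_mul, Real.norm_eq_abs, Real.norm_eq_abs]
    exact mul_le_mul ((abs_sub_le_of_mem_Icc hτ').trans hst) (hℓ τ hτ') (abs_nonneg _) ht0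
  have h3 := abs_add_le (∑ i, (D (coordVec i)) i - 3 - ∫ τ in 0..s, (τ - s) * ℓ τ)
    (∫ τ in 0..s, (τ - s) * ℓ τ)
  rw [sub_add_cancel] at h3
  linarith

end Jacobian

/-! ### Quantitative bounds on the data. -/

/-- Quantitative form of the assumptions on the background, the initial datum and the external
field. -/
structure DataBounds (F : Space3 → ℝ) (f₀ : Space3 → Space3 → ℝ) (A : ℝ → Space3 → Space3)
    (W P N BF B₀ L₀ CA : ℝ) : Prop where
  W_pos : 0 < W
  F_cont : Continuous F
  F_zero : ∀ v, W < ‖v‖ → F v = 0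
  F_bound : ∀ v, |F v| ≤ BF
  N_pos : 0 < N
  f₀_zero : ∀ x v, P < ‖v‖ → f₀ x v = 0
  f₀_eq : ∀ x v, N < ‖x‖ → f₀ x v = F v
  f₀_le : ∀ x v, f₀ x v ≤ B₀
  one_le_L₀ : 1 ≤ L₀
  f₀_lip : ∀ x v x' v', |f₀ x' v' - f₀ x v| ≤ L₀ * ‖(x' - x, v' - v)‖
  CA_pos : 0 < CA
  A_cont : ContinuousOn (fun z : ℝ × Space3 => A z.1 z.2) (Ici 0 ×ˢ univ)
  A_bound : ∀ τ, 0 ≤ τ → ∀ y, ‖A τ y‖ ≤ CA * R y ^ (-2 : ℝ)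
  A_diff : ∀ τ, 0 ≤ τ → Differentiable ℝ (A τ)
  A_fderiv : ∀ τ, 0 ≤ τ → ∀ y, ‖fderiv ℝ (A τ) y‖ ≤ CA * R y ^ (-3 : ℝ)
  A_div : ∀ τ, 0 ≤ τ → ∀ y, divergence (A τ) y = 0

/-- Near a point off a product of two closed balls, `f₀` coincides with `F(v)` or with zero, so
compactness leaves only finitely many bounds to combine. -/
lemma exists_initial_bounds {F : Space3 → ℝ} {f₀ : Space3 → Space3 → ℝ} {P N : ℝ}
    (hF : ContDiff ℝ 2 F) (hFs : HasCompactSupport F)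
    (hf : ContDiff ℝ 1 (fun z : Space3 × Space3 => f₀ z.1 z.2))
    (hP : ∀ x v, P < ‖v‖ → f₀ x v = 0) (hN : ∀ x v, N < ‖x‖ → f₀ x v = F v) :
    ∃ B₀ L₀ : ℝ, (∀ x v, f₀ x v ≤ B₀) ∧ 1 ≤ L₀ ∧
      ∀ x v x' v', |f₀ x' v' - f₀ x v| ≤ L₀ * ‖(x' - x, v' - v)‖ := by
  set g : Space3 × Space3 → ℝ := fun z => f₀ z.1 z.2
  have hKc : IsCompact (closedBall (0 : Space3) N ×ˢ closedBall (0 : Space3) P) :=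
    (isCompact_closedBall _ _).prod (isCompact_closedBall _ _)
  obtain ⟨b₁, hb₁⟩ := hKc.exists_bound_of_continuousOn hf.continuous.continuousOn
  obtain ⟨b₂, hb₂⟩ := hF.continuous.bounded_above_of_compact_support hFs
  obtain ⟨l₁, hl₁⟩ := hKc.exists_bound_of_continuousOn
    (hf.continuous_fderiv one_ne_zero).continuousOn
  obtain ⟨l₂, hl₂⟩ := (hF.continuous_fderiv two_ne_zero).bounded_above_of_compact_support
    (hFs.fderiv (𝕜 := ℝ))
  refine ⟨max b₁ (max b₂ 0), max 1 (max l₁ (max l₂ 0)), fun x v => ?_, le_max_left _ _, ?_⟩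
  · by_cases hx : N < ‖x‖
    · rw [hN x v hx]
      exact (le_abs_self _).trans ((hb₂ v).trans (by simp))
    · by_cases hv : P < ‖v‖
      · rw [hP x v hv]
        simp
      · have := hb₁ (x, v) ⟨by simpa using hx, by simpa using hv⟩
        exact (le_abs_self _).trans (this.trans (by simp))
  · have hder : ∀ z ∈ (univ : Set (Space3 × Space3)),
        ‖fderiv ℝ g z‖ ≤ max 1 (max l₁ (max l₂ 0)) := by
      rintro ⟨x, v⟩ -
      by_cases hx : N < ‖x‖
      · have hev : g =ᶠ[𝓝 (x, v)] fun z => F z.2 := by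
          have : ContinuousAt (fun z : Space3 × Space3 => ‖z.1‖) (x, v) := by fun_prop
          filter_upwards [this.eventually_const_lt hx] with z hz using hN z.1 z.2 hz
        have hd : HasFDerivAt (fun z : Space3 × Space3 => F z.2)
            ((fderiv ℝ F v).comp (ContinuousLinearMap.snd ℝ Space3 Space3)) (x, v) :=
          ((hF.differentiable two_ne_zero) v).hasFDerivAt.comp (x, v) hasFDerivAt_snd
        rw [hev.fderiv_eq, hd.fderiv]
        refine (ContinuousLinearMap.opNorm_comp_le _ _).trans ?_
        calc _ ≤ ‖fderiv ℝ F v‖ * 1 := by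
              gcongr
              exact ContinuousLinearMap.norm_snd_le _ _ _
          _ ≤ l₂ := by rw [mul_one]; exact hl₂ v
          _ ≤ _ := by simp
      · by_cases hv : P < ‖v‖
        · have hev : g =ᶠ[𝓝 (x, v)] fun _ => 0 := by
            have : ContinuousAt (fun z : Space3 × Space3 => ‖z.2‖) (x, v) := by fun_prop
            filter_upwards [this.eventually_const_lt hv] with z hz using hP z.1 z.2 hz
          rw [hev.fderiv_eq]
          simp
        · exact (hl₁ (x, v) ⟨by simpa using hx, by simpa using hv⟩).trans (by simp)
    intro x v x' v'
    exact convex_univ.norm_image_sub_le_of_norm_fderiv_le (f := g) (x := (x, v)) (y := (x', v'))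
      (fun z _ => (hf.differentiable one_ne_zero) z) hder trivial trivial

lemma exists_dataBounds {F : Space3 → ℝ} {f₀ : Space3 → Space3 → ℝ} {A : ℝ → Space3 → Space3}
    (hF : BackgroundCondition F) (hf₀ : InitialCondition F f₀) (hA : ExternalFieldCondition A) :
    ∃ W P N BF B₀ L₀ CA : ℝ, DataBounds F f₀ A W P N BF B₀ L₀ CA := by
  obtain ⟨-, hF2, FR, hFR, -, W, hW, -, hW0⟩ := hF
  obtain ⟨hf1, -, ⟨Kv, hKv, hKv0⟩, N, hN, hNF⟩ := hf₀
  obtain ⟨hA1, ⟨CA, hCA, hAb⟩, hAd⟩ := hA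
  obtain ⟨P, hP⟩ := hKv.isBounded.subset_closedBall 0
  have hP0 : ∀ x v, P < ‖v‖ → f₀ x v = 0 := fun x v hv =>
    hKv0 x v fun h => by
      have := hP h
      rw [mem_closedBall_zero_iff] at this
      linarith
  have hF0 : ∀ v, W < ‖v‖ → F v = 0 := fun v hv => by rw [hFR, hW0 _ hv.le]
  have hFs : HasCompactSupport F :=
    HasCompactSupport.intro (isCompact_closedBall (0 : Space3) W) fun v hv =>
      hF0 v (by simpa using hv)
  obtain ⟨BF, hBF⟩ := hF2.continuous.bounded_above_of_compact_support hFs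
  obtain ⟨B₀, L₀, hB₀, hL₀, hlip⟩ := exists_initial_bounds hF2 hFs hf1 hP0 hNF
  refine ⟨W, P, N, BF, B₀, L₀, CA, hW, hF2.continuous, hF0, hBF, hN, hP0, hNF, hB₀, hL₀, hlip, hCA,
    hA1.continuousOn, fun τ hτ y => (hAb τ hτ y).1, fun τ hτ => ?_,
    fun τ hτ y => (hAb τ hτ y).2, hAd⟩
  have h1 : DifferentiableOn ℝ (fun y => A τ y) univ :=
    (hA1.differentiableOn one_ne_zero).comp (f := fun y : Space3 => (τ, y))
      (by fun_prop) (fun y _ => ⟨hτ, trivial⟩)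
  exact differentiableOn_univ.1 h1

namespace DataBounds

variable {F : Space3 → ℝ} {f₀ : Space3 → Space3 → ℝ} {A : ℝ → Space3 → Space3}
  {W P N BF B₀ L₀ CA : ℝ}

lemma BF_nonneg (hD : DataBounds F f₀ A W P N BF B₀ L₀ CA) : 0 ≤ BF :=
  (abs_nonneg _).trans (hD.F_bound 0)

lemma norm_A_sub_le (hD : DataBounds F f₀ A W P N BF B₀ L₀ CA) {τ : ℝ} (hτ : 0 ≤ τ)
    (y y' : Space3) : ‖A τ y' - A τ y‖ ≤ CA * ‖y' - y‖ :=
  convex_univ.norm_image_sub_le_of_norm_fderiv_le (fun z _ => hD.A_diff τ hτ z)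
    (fun z _ => (hD.A_fderiv τ hτ z).trans
      (mul_le_of_le_one_right hD.CA_pos.le (R_rpow_le_one (by norm_num) z))) trivial trivial

lemma norm_A_sub_le_weight (hD : DataBounds F f₀ A W P N BF B₀ L₀ CA) {τ : ℝ} (hτ : 0 ≤ τ)
    {x y y' : Space3} (hy : y ∈ closedBall x (R x / 8)) (hy' : y' ∈ closedBall x (R x / 8)) :
    ‖A τ y' - A τ y‖ ≤ 8 * CA * R x ^ (-3 : ℝ) * ‖y' - y‖ := by
  refine (convex_closedBall x (R x / 8)).norm_image_sub_le_of_norm_fderiv_le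
    (fun z _ => hD.A_diff τ hτ z) (fun z hz => (hD.A_fderiv τ hτ z).trans ?_) hy hy'
  have h1 : ‖x - z‖ ≤ R x / 2 := by
    rw [mem_closedBall, dist_eq_norm, norm_sub_rev] at hz
    linarith [R_pos x]
  have h2 := R_rpow_neg_le (by norm_num : (0 : ℝ) ≤ 3) h1
  rw [show (2 : ℝ) ^ (3 : ℝ) = 8 by norm_num] at h2
  calc _ ≤ CA * (8 * R x ^ (-3 : ℝ)) := mul_le_mul_of_nonneg_left h2 hD.CA_pos.le
    _ = _ := by ring

lemma tendsto_divQuot_A (hD : DataBounds F f₀ A W P N BF B₀ L₀ CA) {τ : ℝ} (hτ : 0 ≤ τ)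
    (y : Space3) : Tendsto (divQuot (A τ) y) (𝓝[≠] 0) (𝓝 0) := by
  have h := tendsto_divQuot_of_hasFDerivAt (hD.A_diff τ hτ y).hasFDerivAt
  rwa [show ∑ i, (fderiv ℝ (A τ) y (coordVec i)) i = 0 from hD.A_div τ hτ y] at h

end DataBounds

/-- Bounds on a solution up to time `t` that depend only on the data and on the decay of the
charge density. -/
structure ForceBounds (F : Space3 → ℝ) (f : ℝ → Space3 → Space3 → ℝ) (A : ℝ → Space3 → Space3)
    (t K Q CH : ℝ) : Prop where
  force_le : ∀ τ ∈ Icc 0 t, ∀ y, ‖force F f A τ y‖ ≤ K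
  f_zero : ∀ τ ∈ Icc 0 t, ∀ x v, Q < ‖v‖ → f τ x v = 0
  force_cont : ContinuousOn (fun z : ℝ × Space3 => force F f A z.1 z.2) (Icc 0 t ×ˢ univ)
  exists_char : ∀ s ∈ Icc 0 t, ∀ x v, ∃ X V, IsCharacteristic (force F f A) s x v X V
  force_lip : ∀ τ ∈ Icc 0 t, ∀ x, ∀ y ∈ closedBall x (R x / 8), ∀ y' ∈ closedBall x (R x / 8),
    ‖force F f A τ y' - force F f A τ y‖ ≤ CH * R x ^ (-3 : ℝ) * ‖y' - y‖
  force_div : ∀ τ ∈ Icc 0 t, ∀ y,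
    Tendsto (divQuot (force F f A τ) y) (𝓝[≠] 0) (𝓝 (3 * ballVol * rho F f τ y))

/-! ### Uniform bounds on the force, and the integral inequality for the density. -/

section Bounds

variable {F : Space3 → ℝ} {f₀ : Space3 → Space3 → ℝ} {A : ℝ → Space3 → Space3}
  {W P N BF B₀ L₀ CA p M t : ℝ}

/-- The bounds come in a forced order: size of the force, velocity support, continuity of `ρ` and of
the force, characteristics, logarithmic force estimate, Lipschitz bounds for `f` and `ρ`, and
finally the weighted Lipschitz bound and the divergence. The constants precede `T` and `f`, so they
do not depend on the solution. -/
lemma exists_forceBounds (hD : DataBounds F f₀ A W P N BF B₀ L₀ CA) (hp : 3 < p) (hM : 0 ≤ M)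
    (ht0 : 0 ≤ t) :
    ∃ K Q CH : ℝ, 0 ≤ K ∧ W ≤ Q ∧ 0 ≤ CH ∧ ∀ (T : ℝ) (f : ℝ → Space3 → Space3 → ℝ),
      IsSolution F f₀ A T f → t < T → (∀ τ ∈ Icc 0 t, ∀ y, |rho F f τ y| ≤ M * R y ^ (-p)) →
      ForceBounds F f A t K Q CH := by
  have hCA := hD.CA_pos
  have hfc := fieldConst_nonneg p
  have hlc := lipConst_nonneg hp
  have hgc := gradConst_nonneg hp
  have hbv := ballVol_nonneg
  set K := M * fieldConst p + CA
  have hK0 : 0 ≤ K := by positivity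
  set Q := max W P + K * t
  have hWQ : W ≤ Q := (le_max_left W P).trans (le_add_of_nonneg_right (by positivity))
  set vQ := volume.real (closedBall (0 : Space3) Q)
  have hvQ : 0 ≤ vQ := measureReal_nonneg
  set c₁ := 3 * ballVol * vQ + 8 * M * lipConst p + CA
  have hc₁ : 0 ≤ c₁ := by positivity
  set Λ := Real.exp (1 + 2 * (Real.log L₀ + (2 * c₁ + 2) * t) * Real.exp (2 * (2 * c₁ + 2) * t))
  have hΛ : 0 ≤ Λ := Real.exp_nonneg _
  -- Both factors `8 = 2 ^ 3` come from replacing the weight `R⁻³` at a nearby point by its value at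
  -- `x`.
  refine ⟨K, Q, 8 * (gradConst p * (M + Λ * vQ)) + 8 * CA, hK0, hWQ, by positivity,
    fun T f hS ht hb => ?_⟩
  have hT : ∀ {τ}, τ ∈ Icc 0 t → τ ∈ Ico 0 T := fun hτ => ⟨hτ.1, hτ.2.trans_lt ht⟩
  have force_le : ∀ τ ∈ Icc 0 t, ∀ y, ‖force F f A τ y‖ ≤ K := by
    intro τ hτ y
    have hR2 : R y ^ (-2 : ℝ) ≤ 1 := R_rpow_le_one (by norm_num) y
    refine (norm_add_le _ _).trans (add_le_add ?_ ?_)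
    · exact (norm_field_le hp hM (hb τ hτ) y).trans (mul_le_of_le_one_right (by positivity) hR2)
    · exact (hD.A_bound τ hτ.1 y).trans (mul_le_of_le_one_right hCA.le hR2)
  have f_zero : ∀ τ ∈ Icc 0 t, ∀ x v, Q < ‖v‖ → f τ x v = 0 := by
    intro τ hτ x v hv
    refine hS.eq_zero_of_lt (hT hτ) (fun σ hσ => force_le σ ⟨hσ.1, hσ.2.trans hτ.2⟩) hD.f₀_zero x ?_
    have h1 : K * τ ≤ K * t := mul_le_mul_of_nonneg_left hτ.2 hK0
    have h2 : P ≤ max W P := le_max_right _ _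
    exact lt_of_le_of_lt (add_le_add h2 h1) hv
  have F_zero : ∀ v, Q < ‖v‖ → F v = 0 := fun v hv => hD.F_zero v (hWQ.trans_lt hv)
  have rho_cont := hS.continuousOn_rho ht hD.F_cont F_zero f_zero
  have rho_cont_x : ∀ τ ∈ Icc 0 t, Continuous (rho F f τ) := fun τ hτ => by
    rw [← continuousOn_univ]
    exact rho_cont.comp (f := fun y => (τ, y)) (by fun_prop) (fun y _ => ⟨hτ, trivial⟩)
  have force_cont : ContinuousOn (fun z : ℝ × Space3 => force F f A z.1 z.2) (Icc 0 t ×ˢ univ) :=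
    (continuousOn_field hp hM rho_cont hb).add
      (hD.A_cont.mono (prod_mono Icc_subset_Ici_self subset_rfl))
  have force_sub : ∀ τ y y', ‖force F f A τ y' - force F f A τ y‖
      ≤ ‖field (rho F f τ) y' - field (rho F f τ) y‖ + ‖A τ y' - A τ y‖ := by
    intro τ y y'
    rw [force, force, add_sub_add_comm]
    exact norm_add_le _ _
  have force_loc : ∀ r : ℝ, ∃ L, 0 ≤ L ∧ ∀ τ ∈ Icc 0 t, ∀ y ∈ closedBall (0 : Space3) r,
      ∀ y' ∈ closedBall (0 : Space3) r,
        ‖force F f A τ y' - force F f A τ y‖ ≤ L * ‖y' - y‖ := by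
    intro r
    obtain ⟨L, hL0, hL⟩ := hS.exists_local_lipschitz_rho ht hD.F_cont F_zero f_zero (r + 1)
    have hlog : 0 ≤ Real.log (1 / (1 / 2)) := Real.log_nonneg (by norm_num)
    refine ⟨3 * ballVol * (1 / 2) * L + 8 * M * lipConst p * (1 + Real.log (1 / (1 / 2))) + CA,
      by positivity, fun τ hτ y hy y' hy' => ?_⟩
    have hmem : ∀ w ∈ closedBall (0 : Space3) r, ∀ z : Space3, ‖z‖ < 1 / 2 →
        w - z ∈ closedBall (0 : Space3) (r + 1) := by
      intro w hw z hz
      rw [mem_closedBall_zero_iff] at hw ⊢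
      linarith [norm_sub_le w z]
    have h1 := norm_field_sub_le_log hp (rho_cont_x τ hτ) hM (hb τ hτ) (d := 1 / 2)
      (η := L * ‖y' - y‖) (x := y) (x' := y') (by norm_num) le_rfl (fun z hz => by
        simpa using hL τ hτ _ (hmem y hy z hz) _ (hmem y' hy' z hz))
    have h2 := hD.norm_A_sub_le hτ.1 y y'
    refine (force_sub τ y y').trans ((add_le_add h1 h2).trans (le_of_eq (by ring)))
  have exists_char := fun s (hs : s ∈ Icc 0 t) x v =>
    exists_isCharacteristic force_cont force_le force_loc hs x v
  have force_log : ∀ τ ∈ Icc 0 t, ∀ Λ ε : ℝ, 2 ≤ Λ → 0 < ε →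
      (∀ x x' v, |f τ x' v - f τ x v| ≤ Λ * (‖x' - x‖ + ε)) →
      ∀ y y', ‖force F f A τ y' - force F f A τ y‖ ≤ c₁ * (1 + Real.log Λ) * (‖y' - y‖ + ε) := by
    intro τ hτ Λ ε hΛ2 hε hfΛ y y'
    have hΛ0 : 0 < Λ := by linarith
    -- The radius `1 / Λ` cancels the factor `Λ` in the near field and leaves it only in the
    -- logarithm.
    have h1 := norm_field_sub_le_log hp (rho_cont_x τ hτ) hM (hb τ hτ) (d := 1 / Λ)
      (η := Λ * (‖y' - y‖ + ε) * vQ) (x := y) (x' := y') (by positivity)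
      (one_div_le_one_div_of_le (by norm_num) hΛ2) (fun z _ => by
        refine hS.abs_rho_sub_le hD.F_cont F_zero (hT hτ) (f_zero τ hτ) fun v _ => ?_
        simpa using hfΛ (y - z) (y' - z) v)
    have h2 := hD.norm_A_sub_le hτ.1 y y'
    refine (force_sub τ y y').trans ((add_le_add h1 h2).trans ?_)
    rw [one_div_one_div]
    have hl : 0 ≤ Real.log Λ := Real.log_nonneg (by linarith)
    have e : 3 * ballVol * (1 / Λ) * (Λ * (‖y' - y‖ + ε) * vQ)
        = 3 * ballVol * vQ * (‖y' - y‖ + ε) := by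
      field_simp
    rw [e]
    have n0 := norm_nonneg (y' - y)
    have k1 : 0 ≤ 3 * ballVol * vQ * (‖y' - y‖ + ε) := by positivity
    have k2 : 0 ≤ 8 * M * lipConst p * (1 + Real.log Λ) * ε := by positivity
    have k3 : 0 ≤ CA * ε := by positivity
    have k4 : 0 ≤ (3 * ballVol * vQ + CA) * (‖y' - y‖ + ε) * Real.log Λ := by positivity
    have e2 : c₁ * (1 + Real.log Λ) * (‖y' - y‖ + ε)
        = 3 * ballVol * vQ * (‖y' - y‖ + ε)
          + (8 * M * lipConst p * (1 + Real.log Λ) * ‖y' - y‖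
            + 8 * M * lipConst p * (1 + Real.log Λ) * ε)
          + (CA * ‖y' - y‖ + CA * ε)
          + (3 * ballVol * vQ + CA) * (‖y' - y‖ + ε) * Real.log Λ := by
      simp only [c₁]
      ring
    rw [e2]
    linarith
  have f_lip := hS.lipschitz_bound ht0 ht hD.one_le_L₀ hD.f₀_lip hD.f₀_le hc₁ exists_char force_log
  have rho_lip : ∀ τ ∈ Icc 0 t, ∀ y y', |rho F f τ y' - rho F f τ y| ≤ Λ * vQ * ‖y' - y‖ := by
    intro τ hτ y y'
    refine (hS.abs_rho_sub_le hD.F_cont F_zero (hT hτ) (f_zero τ hτ) (η := Λ * ‖y' - y‖)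
      fun v _ => ?_).trans (le_of_eq (by ring))
    simpa [Prod.norm_def] using f_lip τ hτ y v y' v
  refine ⟨force_le, f_zero, force_cont, exists_char, fun τ hτ x y hy y' hy' => ?_,
    fun τ hτ y => ?_⟩
  · have h2 := hD.norm_A_sub_le_weight hτ.1 hy hy'
    rw [mem_closedBall, dist_eq_norm, norm_sub_rev] at hy
    rw [mem_closedBall, dist_eq_norm] at hy'
    have hRx := R_pos x
    have hRy := R_le_add x y
    have hyy : ‖y - y'‖ ≤ R y / 2 := by
      have : ‖y - y'‖ ≤ ‖x - y‖ + ‖y' - x‖ := by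
        rw [show y - y' = -((x - y) + (y' - x)) by abel, norm_neg]
        exact norm_add_le _ _
      linarith
    have h1 := norm_field_sub_le_weight hp (rho_cont_x τ hτ) hM (hb τ hτ)
      (by positivity : 0 ≤ Λ * vQ) (rho_lip τ hτ) hyy
    have h3 := R_rpow_neg_le (by norm_num : (0 : ℝ) ≤ 3) (show ‖x - y‖ ≤ R x / 2 by linarith)
    rw [show (2 : ℝ) ^ (3 : ℝ) = 8 by norm_num] at h3
    have h4 : gradConst p * (M + Λ * vQ) * R y ^ (-3 : ℝ) * ‖y' - y‖
        ≤ gradConst p * (M + Λ * vQ) * (8 * R x ^ (-3 : ℝ)) * ‖y' - y‖ := by gcongr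
    refine (force_sub τ y y').trans ((add_le_add (h1.trans h4) h2).trans (le_of_eq (by ring)))
  · have h1 := tendsto_divQuot_field hp (rho_cont_x τ hτ) (hb τ hτ) (x := y)
      (by positivity : 0 ≤ Λ * vQ) (fun z _ z' _ => rho_lip τ hτ z z')
    have h2 := h1.add (hD.tendsto_divQuot_A hτ.1 y)
    rw [add_zero] at h2
    refine h2.congr fun h => ?_
    exact (divQuot_add (field (rho F f τ)) (A τ) y h).symm

/-- Far away, the charge density is controlled by its values along the characteristics. -/
lemma ForceBounds.abs_rho_le {f : ℝ → Space3 → Space3 → ℝ} {T K Q CH δ : ℝ}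
    (hFB : ForceBounds F f A t K Q CH) (hD : DataBounds F f₀ A W P N BF B₀ L₀ CA)
    (hS : IsSolution F f₀ A T f) (ht : t < T) (hK0 : 0 ≤ K) (hWQ : W ≤ Q) (hCH : 0 ≤ CH)
    (hδ2 : δ ≤ 1 / 2)
    (hδ : ∀ (s : Set Space3) (G : Space3 → Space3),
      (∀ v ∈ s, ∀ w ∈ s, ‖G v - G w - (v - w)‖ ≤ δ * ‖v - w‖) → volume s = 0 →
      volume (G '' s) = 0)
    {Q₂ : ℝ} (hQ₂ : Q < Q₂) (hQ₂' : 2 * (W + K * t) < Q₂) {s : ℝ} (hs : s ∈ Icc 0 t) {x : Space3}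
    (hx₁ : (Q₂ + K * t) * t ≤ R x / 16) (hx₂ : 2 * (N + 1) ≤ R x) (hx₃ : CH * R x ^ (-3 : ℝ) ≤ 1)
    (hx₄ : CH * R x ^ (-3 : ℝ) * t * Real.exp (3 * t) ≤ δ) {r : ℝ → ℝ} (hr : Continuous r)
    (hrho : ∀ τ ∈ Icc 0 s, ∀ y ∈ closedBall x (R x / 16), |rho F f τ y| ≤ r τ) :
    |rho F f s x| ≤ BF * (3 * ((CH * R x ^ (-3 : ℝ)) ^ 2 * t ^ 3 * Real.exp (3 * t))
      + t * (∫ τ in 0..s, 3 * ballVol * r τ)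
      + 12 * (CH * R x ^ (-3 : ℝ) * t * Real.exp (3 * t)) ^ 2)
      * volume.real (ball (0 : Space3) Q₂) := by
  have ht0 : 0 ≤ t := hs.1.trans hs.2
  have hRx := R_pos x
  have hbv := ballVol_nonneg
  set k := CH * R x ^ (-3 : ℝ)
  have hk0 : 0 ≤ k := by positivity
  have hsT : s ∈ Ico 0 T := ⟨hs.1, hs.2.trans_lt ht⟩
  have hsub : ∀ {τ}, τ ∈ Icc 0 s → τ ∈ Icc 0 t := fun hτ => ⟨hτ.1, hτ.2.trans hs.2⟩
  -- The characteristics are merely chosen for each velocity; the regularity of `v ↦ Vf v 0` comes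
  -- from `hGk`.
  choose Xf Vf hchar using fun v => hFB.exists_char s hs x v
  have hKs : ∀ τ ∈ Icc 0 s, ∀ y, ‖force F f A τ y‖ ≤ K := fun τ hτ => hFB.force_le τ (hsub hτ)
  have hKst : K * s ≤ K * t := mul_le_mul_of_nonneg_left hs.2 hK0
  have hX : ∀ w ∈ ball (0 : Space3) Q₂, ∀ τ ∈ Icc 0 s, Xf w τ ∈ closedBall x (R x / 8 / 2) := by
    intro w hw τ hτ
    rw [mem_ball_zero_iff] at hw
    rw [mem_closedBall, dist_eq_norm]
    have h1 := (hchar w).norm_X_sub_le hKs hτ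
    have h2 : (‖w‖ + K * s) * s ≤ (Q₂ + K * t) * t :=
      mul_le_mul (add_le_add hw.le hKst) hs.2 hs.1
        (add_nonneg ((norm_nonneg w).trans hw.le) (by positivity))
    linarith
  have hX' : ∀ w ∈ ball (0 : Space3) Q₂, ∀ τ ∈ Icc 0 s, Xf w τ ∈ closedBall x (R x / 8) :=
    fun w hw τ hτ => closedBall_subset_closedBall (by linarith) (hX w hw τ hτ)
  have hL : ∀ τ ∈ Icc 0 s, ∀ y ∈ closedBall x (R x / 8), ∀ y' ∈ closedBall x (R x / 8),
      ‖force F f A τ y' - force F f A τ y‖ ≤ k * ‖y' - y‖ := fun τ hτ => hFB.force_lip τ (hsub hτ) x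
  have hGk : ∀ v ∈ ball (0 : Space3) Q₂, ∀ w ∈ ball (0 : Space3) Q₂,
      ‖Vf v 0 - Vf w 0 - (v - w)‖ ≤ k * t * Real.exp (3 * t) * ‖v - w‖ := fun v hv w hw =>
    (hchar w).norm_V_diff_le (hchar v) hs.2 hk0 hx₃ hL (hX' w hw) (hX' v hv) ⟨le_rfl, hs.1⟩
  have hG : ∀ v ∈ ball (0 : Space3) Q₂, ∀ w ∈ ball (0 : Space3) Q₂,
      ‖Vf v 0 - Vf w 0 - (v - w)‖ ≤ δ * ‖v - w‖ := fun v hv w hw =>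
    (hGk v hv w hw).trans (mul_le_mul_of_nonneg_right hx₄ (norm_nonneg _))
  have hrho_eq : rho F f s x = ∫ v in ball 0 Q₂, (F v - F (Vf v 0)) := by
    have h1 : rho F f s x = ∫ v in ball 0 Q₂, (F v - f s x v) := by
      rw [rho, setIntegral_eq_integral_of_forall_compl_eq_zero]
      intro v hv
      have hv' : Q < ‖v‖ := by
        rw [mem_ball_zero_iff, not_lt] at hv
        exact hQ₂.trans_le hv
      rw [hD.F_zero v (hWQ.trans_lt hv'), hFB.f_zero s hs x v hv', sub_zero]
    rw [h1]
    refine setIntegral_congr_fun measurableSet_ball fun v hv => ?_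
    -- The starting point has norm above `N`: the displacement is at most `R x / 16` and `R x ≥ 2 *
    -- (N + 1)`.
    rw [hS.eq_initial hsT (hchar v), hD.f₀_eq]
    have h2 := hX v hv 0 ⟨le_rfl, hs.1⟩
    rw [mem_closedBall, dist_eq_norm, norm_sub_rev] at h2
    have h3 := R_le_one_add_norm x
    have h4 : ‖x‖ ≤ ‖Xf v 0‖ + ‖x - Xf v 0‖ := by
      simpa using norm_add_le (Xf v 0) (x - Xf v 0)
    have := hD.N_pos
    linarith
  rw [hrho_eq]
  refine abs_integral_sub_comp_le hδ2 hδ hD.F_cont hD.F_zero hD.F_bound hG (hWQ.trans_lt hQ₂) ?_ ?_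
  · have hg : ‖Vf 0 0‖ ≤ K * t := by
      have := (hchar 0).norm_V_sub_le hKs ⟨le_rfl, hs.1⟩
      rw [sub_zero] at this
      exact this.trans hKst
    exact closedBall_subset_image hδ2 hG hD.W_pos.le hg hQ₂'
  · intro v hv D hDv
    have htr := abs_trace_sub_le (fun w _ => hchar w) hs.1 hs.2 (by positivity) hk0 hx₃
      (hFB.force_cont.mono (prod_mono (Icc_subset_Icc_right hs.2) subset_rfl)) hL hX hv
      (ℓ := fun τ => 3 * ballVol * rho F f τ (Xf v τ)) (r := fun τ => 3 * ballVol * r τ)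
      (fun τ hτ => hFB.force_div τ (hsub hτ) _)
      (fun τ hτ => by
        rw [abs_mul, abs_of_nonneg (by positivity)]
        refine mul_le_mul_of_nonneg_left (hrho τ hτ _ ?_) (by positivity)
        exact closedBall_subset_closedBall (by linarith) (hX v hv τ hτ))
      (hr.const_mul _) hDv
    have hn : ‖D - ContinuousLinearMap.id ℝ Space3‖ ≤ k * t * Real.exp (3 * t) := by
      have h0 : 0 ≤ k * t * Real.exp (3 * t) := by positivity
      have hder : HasFDerivAt (fun w => Vf w 0 - w) (D - ContinuousLinearMap.id ℝ Space3) v :=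
        hDv.sub (hasFDerivAt_id v)
      have hlip : LipschitzOnWith ⟨k * t * Real.exp (3 * t), h0⟩ (fun w => Vf w 0 - w)
          (ball (0 : Space3) Q₂) := by
        refine LipschitzOnWith.of_dist_le_mul fun v hv w hw => ?_
        rw [dist_eq_norm, dist_eq_norm, sub_sub_sub_comm]
        exact hGk v hv w hw
      exact hder.le_of_lipschitzOn (isOpen_ball.mem_nhds hv) hlip
    have := abs_det_sub_one_le (by linarith) hn
    linarith

end Bounds

/-! ### Closing the estimate: decay of order six. -/

section Decay

variable {F : Space3 → ℝ} {f₀ : Space3 → Space3 → ℝ} {A : ℝ → Space3 → Space3}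
  {W P N BF B₀ L₀ CA p M t : ℝ}

lemma integral_exp_mul_le {c s : ℝ} (hc : 0 < c) :
    ∫ τ in 0..s, Real.exp (c * τ) ≤ Real.exp (c * s) / c := by
  have hder : ∀ τ ∈ uIcc 0 s, HasDerivAt (fun τ => Real.exp (c * τ) / c) (Real.exp (c * τ)) τ := by
    intro τ _
    have h := ((hasDerivAt_id τ).const_mul c).exp.div_const c
    refine h.congr_deriv ?_
    simp
    field_simp
  rw [intervalIntegral.integral_eq_sub_of_hasDerivAt hder
    ((by fun_prop : Continuous fun τ => Real.exp (c * τ)).intervalIntegrable _ _)]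
  have : 0 < Real.exp (c * 0) / c := by positivity
  linarith

/-- The weight `R⁻⁶ + ε R⁻ᵖ` varies slowly. -/
lemma weight_le_of_near (hp : 3 < p) (hp6 : p ≤ 6) {ε : ℝ} (hε : 0 < ε) {x y : Space3}
    (h : ‖x - y‖ ≤ R x / 2) :
    R y ^ (-6 : ℝ) + ε * R y ^ (-p) ≤ 64 * (R x ^ (-6 : ℝ) + ε * R x ^ (-p)) := by
  have hRx := R_pos x
  have h1 := R_rpow_neg_le (by norm_num : (0 : ℝ) ≤ 6) h
  have h2 := R_rpow_neg_le (by linarith : 0 ≤ p) h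
  have e6 : (2 : ℝ) ^ (6 : ℝ) = 64 := by norm_num
  have h3 : (2 : ℝ) ^ p ≤ 64 := by
    rw [← e6]
    exact Real.rpow_le_rpow_of_exponent_le (by norm_num) hp6
  rw [e6] at h1
  have h4 : R y ^ (-p) ≤ 64 * R x ^ (-p) := h2.trans (by gcongr)
  have h5 := mul_le_mul_of_nonneg_left h4 hε.le
  linarith

lemma exists_rho_decay (hD : DataBounds F f₀ A W P N BF B₀ L₀ CA) (hp : 3 < p) (hp6 : p ≤ 6)
    (hM : 0 ≤ M) (ht0 : 0 ≤ t) :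
    ∃ C : ℝ, 0 ≤ C ∧ ∀ (T : ℝ) (f : ℝ → Space3 → Space3 → ℝ), IsSolution F f₀ A T f → t < T →
      (∀ τ ∈ Icc 0 t, ∀ y, |rho F f τ y| ≤ M * R y ^ (-p)) →
      ∀ x, |rho F f t x| ≤ C * R x ^ (-6 : ℝ) := by
  obtain ⟨K, Q, CH, hK0, hWQ, hCH, hFB⟩ := exists_forceBounds hD hp hM ht0
  obtain ⟨δ, hδ0, hδ2, hδ⟩ := exists_null_image_const
  have hBF := hD.BF_nonneg
  have hbv := ballVol_nonneg
  have hW := hD.W_pos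
  have hN := hD.N_pos
  -- Large enough that `F` and `f` vanish outside the ball and that the image of the ball covers the
  -- support of `F`.
  obtain ⟨Q₂, hQ₂_def⟩ : ∃ r : ℝ, r = Q + 2 * (W + K * t) + 1 := ⟨_, rfl⟩
  have hQ₂0 : 0 ≤ Q₂ := by
    have := hW.le.trans hWQ
    rw [hQ₂_def]
    positivity
  -- A sum of nonnegative thresholds, so that `R x ≥ R₀` implies each of the smallness conditions of
  -- `ForceBounds.abs_rho_le`.
  obtain ⟨R₀, hR₀_def⟩ : ∃ r : ℝ,
      r = 16 * ((Q₂ + K * t) * t) + 2 * (N + 1) + CH + CH * t * Real.exp (3 * t) / δ := ⟨_, rfl⟩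
  have hR₀ : 0 ≤ R₀ := by rw [hR₀_def]; positivity
  obtain ⟨vB, hvB_def⟩ : ∃ r : ℝ, r = volume.real (ball (0 : Space3) Q₂) := ⟨_, rfl⟩
  have hvB : 0 ≤ vB := hvB_def ▸ measureReal_nonneg
  obtain ⟨C₆, hC₆_def⟩ : ∃ r : ℝ,
      r = 3 * (CH ^ 2 * t ^ 3 * Real.exp (3 * t)) + 12 * (CH * t * Real.exp (3 * t)) ^ 2 := ⟨_, rfl⟩
  have hC₆ : 0 ≤ C₆ := by rw [hC₆_def]; positivity
  -- Here `192 = 3 * 64`: the `3` belongs to the divergence and `64 = 2 ^ 6` to the variation of the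
  -- weight. This rate makes the time integral cost at most half of `m`.
  obtain ⟨c, hc_def⟩ : ∃ r : ℝ, r = 192 * BF * vB * ballVol * t + 1 := ⟨_, rfl⟩
  have hc : 0 < c := by rw [hc_def]; positivity
  obtain ⟨a, ha_def⟩ : ∃ r : ℝ, r = BF * vB * C₆ + M * R₀ ^ 6 := ⟨_, rfl⟩
  have ha : 0 ≤ a := by rw [ha_def]; positivity
  refine ⟨2 * a * Real.exp (2 * c * t), by positivity, fun T f hS ht hb => ?_⟩
  have hFB := hFB T f hS ht hb
  have main : ∀ ε : ℝ, 0 < ε → ∀ s ∈ Icc 0 t, ∀ x, |rho F f s x|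
      ≤ 2 * a * Real.exp (2 * c * s) * (R x ^ (-6 : ℝ) + ε * R x ^ (-p)) := by
    intro ε hε
    -- The term `ε R⁻ᵖ` lets the assumed decay `M R⁻ᵖ` start the iteration with the finite constant
    -- `M / ε`, although no bound of order `R⁻⁶` is known yet.
    set w : Space3 → ℝ := fun x => R x ^ (-6 : ℝ) + ε * R x ^ (-p) with hw_def
    have hw0 : ∀ x, 0 ≤ w x := fun x => by have := R_pos x; positivity
    have hexp : ∀ {s}, s ∈ Icc 0 t → 1 ≤ Real.exp (2 * c * s) := fun hs =>
      Real.one_le_exp (by have := hs.1; positivity)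
    set PP : ℝ → Prop := fun m => ∀ s ∈ Icc 0 t, ∀ x, |rho F f s x|
      ≤ m * Real.exp (2 * c * s) * w x
    have hinit : PP (2 * a + M / ε) := by
      intro s hs x
      have hRx := R_pos x
      have h1 : M * R x ^ (-p) ≤ M / ε * w x := by
        have : M / ε * w x = M * R x ^ (-p) + M / ε * R x ^ (-6 : ℝ) := by
          simp only [hw_def]
          field_simp
          ring
        rw [this]
        have : 0 ≤ M / ε * R x ^ (-6 : ℝ) := by positivity
        linarith
      have h2 : M / ε ≤ (2 * a + M / ε) * Real.exp (2 * c * s) := by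
        have := le_mul_of_one_le_right (by positivity : 0 ≤ 2 * a + M / ε) (hexp hs)
        linarith
      exact (hb s hs x).trans (h1.trans (mul_le_mul_of_nonneg_right h2 (hw0 x)))
    have hstep : ∀ m, 0 ≤ m → PP m → PP (a + m / 2) := by
      intro m hm hPm s hs x
      have hRx := R_pos x
      have hR1 := one_le_R x
      have hR6 : R x ^ (-6 : ℝ) ≤ w x := le_add_of_nonneg_right (by positivity)
      have hmexp : 0 ≤ m / 2 * Real.exp (2 * c * s) * w x := by
        have := hw0 x
        positivity
      have ha_exp : a * w x ≤ a * Real.exp (2 * c * s) * w x :=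
        mul_le_mul_of_nonneg_right (le_mul_of_one_le_right ha (hexp hs)) (hw0 x)
      have hgoal : (a + m / 2) * Real.exp (2 * c * s) * w x
          = a * Real.exp (2 * c * s) * w x + m / 2 * Real.exp (2 * c * s) * w x := by ring
      rw [hgoal]
      -- For `R x < R₀` the assumed bound suffices, as `R⁻⁶` is bounded below there; this is the
      -- summand `M * R₀ ^ 6` of `a`.
      rcases lt_or_ge (R x) R₀ with hsmall | hlarge
      · have h1 : M * R x ^ (-p) ≤ M * R₀ ^ 6 * R x ^ (-6 : ℝ) := by
          have h2 : R x ^ (-p) ≤ 1 := R_rpow_le_one (by linarith) x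
          have h3 : 1 ≤ R₀ ^ 6 * R x ^ (-6 : ℝ) := by
            rw [Real.rpow_neg hRx.le, show (6 : ℝ) = (6 : ℕ) by norm_num, Real.rpow_natCast,
              ← div_eq_mul_inv, one_le_div (by positivity)]
            gcongr
          rw [mul_assoc]
          exact mul_le_mul_of_nonneg_left (h2.trans h3) hM
        have h4 : M * R₀ ^ 6 * R x ^ (-6 : ℝ) ≤ a * w x := by
          refine mul_le_mul ?_ hR6 (by positivity) ha
          rw [ha_def]
          exact le_add_of_nonneg_left (by positivity)
        have := hb s hs x
        linarith
      · have hinv : R x ^ (-3 : ℝ) ≤ (R x)⁻¹ := by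
          rw [← Real.rpow_neg_one]
          exact Real.rpow_le_rpow_of_exponent_le hR1 (by norm_num)
        have p1 : 0 ≤ 16 * ((Q₂ + K * t) * t) := by positivity
        have p2 : 0 ≤ CH * t * Real.exp (3 * t) / δ := by positivity
        have hx₁ : (Q₂ + K * t) * t ≤ R x / 16 := by
          have : 16 * ((Q₂ + K * t) * t) ≤ R x := by
            refine le_trans ?_ hlarge
            linarith
          linarith
        have hx₂ : 2 * (N + 1) ≤ R x := by
          refine le_trans ?_ hlarge
          linarith
        have hx₃ : CH * R x ^ (-3 : ℝ) ≤ 1 := by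
          have h1 : CH ≤ R x := by
            refine le_trans ?_ hlarge
            linarith
          calc CH * R x ^ (-3 : ℝ) ≤ R x * (R x)⁻¹ := by gcongr
            _ = 1 := mul_inv_cancel₀ hRx.ne'
        have hx₄ : CH * R x ^ (-3 : ℝ) * t * Real.exp (3 * t) ≤ δ := by
          have h1 : CH * t * Real.exp (3 * t) / δ ≤ R x := by
            refine le_trans ?_ hlarge
            linarith
          rw [div_le_iff₀ hδ0] at h1
          calc CH * R x ^ (-3 : ℝ) * t * Real.exp (3 * t)
              = CH * t * Real.exp (3 * t) * R x ^ (-3 : ℝ) := by ring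
            _ ≤ R x * δ * (R x)⁻¹ := by gcongr
            _ = δ := by field_simp
        have hkey := hFB.abs_rho_le hD hS ht hK0 hWQ hCH hδ2 hδ (Q₂ := Q₂)
          (by linarith [mul_nonneg hK0 ht0]) (by linarith [hW.le.trans hWQ]) hs hx₁ hx₂ hx₃ hx₄
          (r := fun τ => m * Real.exp (2 * c * τ) * (64 * w x)) (by fun_prop)
          (fun τ hτ y hy => by
            rw [mem_closedBall, dist_eq_norm, norm_sub_rev] at hy
            refine (hPm τ ⟨hτ.1, hτ.2.trans hs.2⟩ y).trans ?_
            refine mul_le_mul_of_nonneg_left (weight_le_of_near hp hp6 hε (by linarith)) ?_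
            positivity)
        have hI : ∫ τ in 0..s, 3 * ballVol * (m * Real.exp (2 * c * τ) * (64 * w x))
            ≤ 192 * ballVol * m * w x * (Real.exp (2 * c * s) / (2 * c)) := by
          have e : ∀ τ, 3 * ballVol * (m * Real.exp (2 * c * τ) * (64 * w x))
              = 192 * ballVol * m * w x * Real.exp (2 * c * τ) := fun τ => by ring
          simp_rw [e]
          rw [intervalIntegral.integral_const_mul]
          have := hw0 x
          exact mul_le_mul_of_nonneg_left (integral_exp_mul_le (by positivity)) (by positivity)
        have hsq : (R x ^ (-3 : ℝ)) ^ 2 = R x ^ (-6 : ℝ) := by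
          rw [← Real.rpow_natCast, ← Real.rpow_mul hRx.le]
          norm_num
        have e1 : 3 * ((CH * R x ^ (-3 : ℝ)) ^ 2 * t ^ 3 * Real.exp (3 * t))
            + 12 * (CH * R x ^ (-3 : ℝ) * t * Real.exp (3 * t)) ^ 2 = C₆ * R x ^ (-6 : ℝ) := by
          rw [← hsq, hC₆_def]
          ring
        have hI2 : BF * vB * t * (192 * ballVol * m * w x * (Real.exp (2 * c * s) / (2 * c)))
            ≤ m / 2 * Real.exp (2 * c * s) * w x := by
          have e2 : BF * vB * t * (192 * ballVol * m * w x * (Real.exp (2 * c * s) / (2 * c)))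
              = (192 * BF * vB * ballVol * t) / c * (m / 2 * Real.exp (2 * c * s) * w x) := by
            field_simp
          rw [e2]
          refine mul_le_of_le_one_left hmexp ?_
          rw [div_le_one hc]
          linarith
        have h5 : BF * vB * (C₆ * R x ^ (-6 : ℝ)) ≤ a * w x := by
          rw [← mul_assoc]
          refine mul_le_mul ?_ hR6 (by positivity) ha
          rw [ha_def]
          exact le_add_of_nonneg_right (by positivity)
        have h6 := mul_le_mul_of_nonneg_left hI (by positivity : 0 ≤ BF * vB * t)
        rw [← hvB_def] at hkey
        calc |rho F f s x| ≤ _ := hkey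
          _ = BF * vB * (3 * ((CH * R x ^ (-3 : ℝ)) ^ 2 * t ^ 3 * Real.exp (3 * t))
            + 12 * (CH * R x ^ (-3 : ℝ) * t * Real.exp (3 * t)) ^ 2)
            + BF * vB * t * ∫ τ in 0..s, 3 * ballVol * (m * Real.exp (2 * c * τ) * (64 * w x)) := by
            ring
          _ ≤ _ := by
            rw [e1]
            linarith
    intro s hs x
    have hall := halving_iterate ha (by positivity : 0 ≤ M / ε) hinit hstep
    exact ge_of_tendsto' (((tendsto_halving a (M / ε)).mul_const _).mul_const _)
      (fun n => hall n s hs x)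
  intro x
  have hlim : Tendsto (fun ε : ℝ => 2 * a * Real.exp (2 * c * t)
      * (R x ^ (-6 : ℝ) + ε * R x ^ (-p))) (𝓝[>] 0)
      (𝓝 (2 * a * Real.exp (2 * c * t) * (R x ^ (-6 : ℝ) + 0 * R x ^ (-p)))) :=
    (((tendsto_id.mono_left nhdsWithin_le_nhds).mul_const _).const_add _).const_mul _
  rw [zero_mul, add_zero] at hlim
  refine ge_of_tendsto hlim ?_
  filter_upwards [self_mem_nhdsWithin] with ε hε using main ε hε t ⟨ht0, le_rfl⟩ x

end Decay

/-! ### The exponent `p` and the final statement. -/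

lemma three_lt_pOf {q : ℝ} (hq : 7 + Real.sqrt 33 < q) : 3 < pOf q := by
  have h1 : (1 : ℝ) ≤ Real.sqrt 33 := Real.one_le_sqrt.2 (by norm_num)
  have hq0 : 0 < q := by linarith
  have : 8 / q < 1 := by rw [div_lt_one hq0]; linarith
  unfold pOf
  linarith

lemma pOf_le_six {q : ℝ} (hq : 7 + Real.sqrt 33 < q) : pOf q ≤ 6 := by
  have hq0 : 0 < q := by linarith [Real.sqrt_nonneg 33]
  have : 0 < 8 / q := by positivity
  unfold pOf
  linarith

lemma spaceNorm_le_iff {r : ℝ} {σ : Space3 → ℝ} {M : ℝ≥0} :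
    spaceNorm r σ ≤ M ↔ ∀ x, |σ x| ≤ M * R x ^ (-r) := by
  unfold spaceNorm
  rw [iSup_le_iff]
  refine forall_congr' fun x => ?_
  rw [ENNReal.ofReal_le_iff_le_toReal ENNReal.coe_ne_top, ENNReal.coe_toReal,
    Real.rpow_neg (R_pos x).le, ← div_eq_mul_inv, le_div_iff₀ (Real.rpow_pos_of_pos (R_pos x) r)]

end VlasovPoisson

end

open VlasovPoisson

theorem theorem3 (q : ℝ) (hq : 7 + Real.sqrt 33 < q)
    (F : Space3 → ℝ) (hF : VlasovPoisson.BackgroundCondition F)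
    (f₀ : Space3 → Space3 → ℝ) (hf₀ : VlasovPoisson.InitialCondition F f₀)
    (A : ℝ → Space3 → Space3) (hA : VlasovPoisson.ExternalFieldCondition A) :
    ∃ C : ℝ → ℝ≥0 → ℝ≥0,
      ∀ (T : ℝ) (f : ℝ → Space3 → Space3 → ℝ), 0 < T →
        VlasovPoisson.IsSolution F f₀ A T f →
        (∀ t ∈ Set.Ico 0 T, VlasovPoisson.tripleNorm q (fun x v => F v - f t x v) < ∞) →
        ∀ t ∈ Set.Ico 0 T, ∀ M : ℝ≥0,
          (⨆ τ ∈ Set.Icc 0 t,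
            VlasovPoisson.spaceNorm (VlasovPoisson.pOf q) (VlasovPoisson.rho F f τ)) ≤ M →
          VlasovPoisson.spaceNorm 6 (VlasovPoisson.rho F f t) ≤ C t M := by
  obtain ⟨W, P, N, BF, B₀, L₀, CA, hD⟩ := exists_dataBounds hF hf₀ hA
  -- The constant is chosen before `T` and `f`; negative times never occur and receive `0`.
  have key : ∀ (t : ℝ) (M : ℝ≥0), ∃ C : ℝ≥0, 0 ≤ t → ∀ (T : ℝ) (f : ℝ → Space3 → Space3 → ℝ),
      IsSolution F f₀ A T f → t < T →
      (∀ τ ∈ Icc 0 t, ∀ y, |rho F f τ y| ≤ M * R y ^ (-pOf q)) →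
      ∀ x, |rho F f t x| ≤ C * R x ^ (-6 : ℝ) := by
    intro t M
    by_cases ht0 : 0 ≤ t
    · obtain ⟨C, hC0, hC⟩ :=
        exists_rho_decay hD (three_lt_pOf hq) (pOf_le_six hq) M.coe_nonneg ht0
      exact ⟨⟨C, hC0⟩, fun _ => hC⟩
    · exact ⟨0, fun h => absurd h ht0⟩
  choose C hC using key
  refine ⟨C, fun T f _ hS _ t ht M hM => spaceNorm_le_iff.2 ?_⟩
  refine hC t M ht.1 T f hS ht.2 fun τ hτ => spaceNorm_le_iff.1 ?_
  exact (le_iSup₂ (f := fun τ (_ : τ ∈ Icc 0 t) => spaceNorm (pOf q) (rho F f τ)) τ hτ).trans hM
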